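/- Let $\mathcal S$ be a set of $n>1$ non-degenerate axis-parallel (horizontal or vertical) closed line segments in $\mathbb R^2$, in general position: any two of them meet in finitely many points, every intersection point lies on exactly two of the segments, and each intersection point is either a proper crossing of these two segments or an endpoint of one of them lying in the relative interior of the other. The arrangement $\mathcal A_{\mathcal S}$ consists of its vertices (the endpoints of the segments and the intersection points of two segments), its edges (the maximal non-degenerate sub-segments of the segments of $\mathcal S$ that contain no vertex in their relative interior) and its faces (the closures of the connected components of $\mathbb R^2\setminus\bigcup\mathcal S$). For a face $F$ let $E_F$ be the set of edges that bound $F$, that is, the edges contained in $F$; an edge that has the component on both of its sides is counted once. Then every face $F$ of $\mathcal A_{\mathcal S}$ satisfies $|E_F|\le 4n-4$. This bound is tight: for every $n>1$ with $n\ne 3$ there are a set $\mathcal S$ of $n$ segments as above and a face $F$ of $\mathcal A_{\mathcal S}$ with $|E_F|=4n-4$. -/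

import Mathlib

/-- A non-degenerate horizontal or vertical line segment in the plane, given by its endpoints. -/
structure AxisSegment where
  a : ℝ × ℝ
  b : ℝ × ℝ
  ne : a ≠ b
  axisParallel : a.1 = b.1 ∨ a.2 = b.2

namespace AxisSegment

/-- The (closed) segment as a set of points. -/
def carrier (s : AxisSegment) : Set (ℝ × ℝ) := segment ℝ s.a s.b

/-- The two endpoints of the segment. -/
def endpoints (s : AxisSegment) : Set (ℝ × ℝ) := {s.a, s.b}

/-- The relative interior of the segment: the segment without its endpoints. -/
def interior (s : AxisSegment) : Set (ℝ × ℝ) := s.carrier \ s.endpoints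

end AxisSegment

namespace Arrangement

/-- General position: two segments meet in finitely many points, every intersection point
lies on exactly two of the segments, and it is either a crossing (a common interior point; since
the two segments are straight and meet in finitely many points, they then cross properly there)
or an endpoint of one segment in the interior of the other. Collinear segments are allowed
as long as they are disjoint. -/
structure GeneralPosition (S : Finset AxisSegment) : Prop where
  finite_inter : ∀ s ∈ S, ∀ t ∈ S, s ≠ t → (s.carrier ∩ t.carrier).Finite
  no_triple : ∀ r ∈ S, ∀ s ∈ S, ∀ t ∈ S, r ≠ s → r ≠ t → s ≠ t →
    r.carrier ∩ s.carrier ∩ t.carrier = ∅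
  crossing_or_endpoint : ∀ s ∈ S, ∀ t ∈ S, s ≠ t → ∀ p ∈ s.carrier ∩ t.carrier,
    (p ∈ s.interior ∧ p ∈ t.interior) ∨
    (p ∈ s.endpoints ∧ p ∈ t.interior) ∨
    (p ∈ s.interior ∧ p ∈ t.endpoints)

/-- The union of the segments. -/
def support (S : Finset AxisSegment) : Set (ℝ × ℝ) := ⋃ s ∈ S, s.carrier

/-- The vertices of the arrangement: segment endpoints and intersection points. -/
def vertices (S : Finset AxisSegment) : Set (ℝ × ℝ) :=
  {p | (∃ s ∈ S, p ∈ s.endpoints) ∨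
    ∃ s ∈ S, ∃ t ∈ S, s ≠ t ∧ p ∈ s.carrier ∩ t.carrier}

/-- `e` is a non-degenerate closed sub-segment of `s` with no vertex in its relative interior. -/
def IsVertexFreePart (S : Finset AxisSegment) (s : AxisSegment) (e : Set (ℝ × ℝ)) : Prop :=
  ∃ p q : ℝ × ℝ, p ≠ q ∧ e = segment ℝ p q ∧ e ⊆ s.carrier ∧
    ∀ v ∈ vertices S, v ∉ openSegment ℝ p q

/-- The edges of the arrangement: maximal sub-segments of the segments with no vertex in
their relative interior. -/
def IsEdge (S : Finset AxisSegment) (e : Set (ℝ × ℝ)) : Prop :=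
  ∃ s ∈ S, Maximal (IsVertexFreePart S s) e

/-- The faces of the arrangement: closures of the connected components of the complement
of the union of the segments. -/
def IsFace (S : Finset AxisSegment) (F : Set (ℝ × ℝ)) : Prop :=
  ∃ x ∈ (support S)ᶜ, F = closure (connectedComponentIn (support S)ᶜ x)

/-- The set of edges that bound the (closed) face `F`, each counted once. Since the open face
is disjoint from every edge, an edge lies on its boundary exactly when it is contained
in its closure `F`; this includes the cut-edges, which have the open face on both sides. -/
def boundingEdges (S : Finset AxisSegment) (F : Set (ℝ × ℝ)) : Set (Set (ℝ × ℝ)) :=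
  {e | IsEdge S e ∧ e ⊆ F}

end Arrangement

/-! Discretize. Only the order of the endpoint coordinates matters, so the segments become segments
of an integer grid strictly inside a box, and the open face becomes a connected set `D` of grid
cells, closed under crossing unit edges not covered by a segment. The outermost strips of the grid
stand for unbounded strips, so the unbounded face owns the cells along the frame of the box.

Count corners, that is, pairs of an arm at a vertex and the cell of `D` clockwise after it. Each
side of an edge that faces `D` gives one corner. Spread the Euler characteristic of `D` over the
grid points, multiplied by four: a cell between two arms has weight 1, the flat side of a T-junction
0, a free end surrounded by `D` has -2. The corners at a point are then at most its weight, plus 1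
for a segment end with `D` straight beyond it, plus 2 more if that end is free (`corner_ineq`). An
edge leading to a free end inside `D` has both sides in `D` and is counted twice; this gains 1 back.
Altogether the number of edges is at most the inner weight plus 2 for each end with `D` beyond it
(`IsRegion.sum_card_edgesOn_le`).

Euler's inequality bounds the weight. For the unbounded face the inner weight is at most -4
(`sum_inner_weight_le_of_frame`), and the `2n` ends give at most `4n`. For a bounded face the weight
is at most 4, but the segments carrying a leftmost and a rightmost wall of `D` have no end with `D`
beyond it, so the ends give at most `4n - 8`. Both cases yield `4n - 4`.

The gain at free ends needs the two end edges of a segment to be different, hence a segment that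
meets another one. Isolated segments are removed beforehand; each costs one edge only. The bound is
attained by the outer face of a cross for `n = 2`, and of a lattice of 2 by `n - 2` segments for `n
≥ 4`. -/

/-! ### Counting the classes of a finite graph -/

open Relation in
theorem eqvGen_insert {α : Type*} [DecidableEq α] {E : Finset (α × α)} {a b x y : α}
    (h : EqvGen (fun u v => (u, v) ∈ insert (a, b) E) x y) :
    EqvGen (fun u v => (u, v) ∈ E) x y ∨
      (EqvGen (fun u v => (u, v) ∈ E) x a ∧ EqvGen (fun u v => (u, v) ∈ E) b y) ∨
      (EqvGen (fun u v => (u, v) ∈ E) x b ∧ EqvGen (fun u v => (u, v) ∈ E) a y) := by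
  induction h with
  | rel x y h =>
    rcases Finset.mem_insert.1 h with h | h
    · obtain ⟨rfl, rfl⟩ := Prod.mk.inj h
      exact Or.inr (Or.inl ⟨.refl _, .refl _⟩)
    · exact Or.inl (.rel _ _ h)
  | refl x => exact Or.inl (.refl _)
  | symm x y _ ih =>
    rcases ih with h | ⟨h, h'⟩ | ⟨h, h'⟩
    · exact Or.inl (.symm _ _ h)
    · exact Or.inr (Or.inr ⟨.symm _ _ h', .symm _ _ h⟩)
    · exact Or.inr (Or.inl ⟨.symm _ _ h', .symm _ _ h⟩)
  | trans x y z _ _ ih₁ ih₂ =>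
    rcases ih₁ with h | ⟨h, h'⟩ | ⟨h, h'⟩ <;> rcases ih₂ with k | ⟨k, k'⟩ | ⟨k, k'⟩
    · exact Or.inl (.trans _ _ _ h k)
    · exact Or.inr (Or.inl ⟨.trans _ _ _ h k, k'⟩)
    · exact Or.inr (Or.inr ⟨.trans _ _ _ h k, k'⟩)
    · exact Or.inr (Or.inl ⟨h, .trans _ _ _ h' k⟩)
    · exact Or.inr (Or.inl ⟨h, k'⟩)
    · exact Or.inl (.trans _ _ _ h k')
    · exact Or.inr (Or.inr ⟨h, .trans _ _ _ h' k⟩)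
    · exact Or.inl (.trans _ _ _ h k')
    · exact Or.inr (Or.inr ⟨h, k'⟩)

open Relation in
/-- `E` edges leave at least `|D| - |E|` classes among the points of `D`. -/
theorem exists_unrelated_subset {α : Type*} [DecidableEq α] (D : Finset α) (E : Finset (α × α)) :
    ∃ R ⊆ D, D.card ≤ R.card + E.card ∧
      ∀ x ∈ R, ∀ y ∈ R, EqvGen (fun u v => (u, v) ∈ E) x y → x = y := by
  classical
  induction E using Finset.induction_on with
  | empty =>
    refine ⟨D, subset_rfl, by simp, fun x _ y _ h => ?_⟩
    induction h with
    | rel x y h => simp at h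
    | refl x => rfl
    | symm x y _ ih => exact (ih ‹_› ‹_›).symm
    | trans x y z h₁ h₂ ih₁ ih₂ =>
      have key : ∀ {u v : α}, EqvGen (fun u v => (u, v) ∈ (∅ : Finset (α × α))) u v → u = v := by
        intro u v h
        induction h with
        | rel x y h => simp at h
        | refl x => rfl
        | symm x y _ ih => exact ih.symm
        | trans x y z _ _ ih₁ ih₂ => exact ih₁.trans ih₂
      exact (key h₁).trans (key h₂)
  | insert e E he ih =>
    obtain ⟨a, b⟩ := e
    obtain ⟨R, hRD, hcard, hR⟩ := ih
    -- The new edge merges at most the classes of `a` and `b`; dropping the representative of the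
    -- class of `a`, if there is one, restores independence.
    set A := R.filter (fun x => EqvGen (fun u v => (u, v) ∈ E) x a) with hA
    have hA1 : A.card ≤ 1 := by
      refine Finset.card_le_one.2 fun x hx y hy => ?_
      rw [hA, Finset.mem_filter] at hx hy
      exact hR x hx.1 y hy.1 (.trans _ _ _ hx.2 (.symm _ _ hy.2))
    refine ⟨R \ A, Finset.sdiff_subset.trans hRD, ?_, fun x hx y hy h => ?_⟩
    · have hAR : A ⊆ R := Finset.filter_subset _ _
      have h1 := Finset.card_sdiff_add_card_eq_card hAR
      rw [Finset.card_insert_of_notMem he]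
      omega
    · simp only [hA, Finset.mem_sdiff, Finset.mem_filter, not_and] at hx hy
      rcases eqvGen_insert h with h | ⟨h, -⟩ | ⟨-, h⟩
      · exact hR x hx.1 y hy.1 h
      · exact absurd h (hx.2 hx.1)
      · exact absurd (.symm _ _ h) (hy.2 hy.1)

open Relation in
theorem card_le_card_add_one_of_eqvGen {α : Type*} [DecidableEq α] (D : Finset α)
    (E : Finset (α × α))
    (h : ∀ x ∈ D, ∀ y ∈ D, EqvGen (fun u v => (u, v) ∈ E) x y) : D.card ≤ E.card + 1 := by
  obtain ⟨R, hRD, hcard, hR⟩ := exists_unrelated_subset D E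
  have : R.card ≤ 1 := Finset.card_le_one.2 fun x hx y hy =>
    hR x hx y hy (h x (hRD hx) y (hRD hy))
  omega

/-! ### Euler's inequality for cells of the integer grid -/

/-- Blocked unit edges of the integer grid: `h i j` says that the edge from `(i, j)` to
`(i + 1, j)` is blocked, `v i j` that the edge from `(i, j)` to `(i, j + 1)` is. -/
structure Walls where
  h : ℤ → ℤ → Prop
  v : ℤ → ℤ → Prop

namespace Walls

variable (W : Walls) (D : Finset (ℤ × ℤ))

open Classical in
/-- Unblocked horizontal edges between two cells of `D`, named by their upper cell. -/
noncomputable def openH : Finset (ℤ × ℤ) :=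
  D.filter fun c => (c.1, c.2 - 1) ∈ D ∧ ¬ W.h c.1 c.2

open Classical in
/-- Unblocked vertical edges between two cells of `D`, named by their right cell. -/
noncomputable def openV : Finset (ℤ × ℤ) :=
  D.filter fun c => (c.1 - 1, c.2) ∈ D ∧ ¬ W.v c.1 c.2

open Classical in
/-- Grid points surrounded by four cells of `D` and four unblocked edges. -/
noncomputable def openP : Finset (ℤ × ℤ) :=
  D.filter fun c => (c.1 - 1, c.2) ∈ D ∧ (c.1, c.2 - 1) ∈ D ∧ (c.1 - 1, c.2 - 1) ∈ D ∧
    ¬ W.h c.1 c.2 ∧ ¬ W.h (c.1 - 1) c.2 ∧ ¬ W.v c.1 c.2 ∧ ¬ W.v c.1 (c.2 - 1)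

/-- The adjacency of the cells of `D` across the given edges. -/
def Step (H V : Finset (ℤ × ℤ)) (x y : ℤ × ℤ) : Prop :=
  (x ∈ H ∧ y = (x.1, x.2 - 1)) ∨ (x ∈ V ∧ y = (x.1 - 1, x.2))

variable {W D}

theorem mem_openH {c : ℤ × ℤ} :
    c ∈ W.openH D ↔ c ∈ D ∧ (c.1, c.2 - 1) ∈ D ∧ ¬ W.h c.1 c.2 := by
  simp [openH]

theorem mem_openV {c : ℤ × ℤ} :
    c ∈ W.openV D ↔ c ∈ D ∧ (c.1 - 1, c.2) ∈ D ∧ ¬ W.v c.1 c.2 := by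
  simp [openV]

theorem mem_openP {c : ℤ × ℤ} :
    c ∈ W.openP D ↔ c ∈ D ∧ (c.1 - 1, c.2) ∈ D ∧ (c.1, c.2 - 1) ∈ D ∧ (c.1 - 1, c.2 - 1) ∈ D ∧
      ¬ W.h c.1 c.2 ∧ ¬ W.h (c.1 - 1) c.2 ∧ ¬ W.v c.1 c.2 ∧ ¬ W.v c.1 (c.2 - 1) := by
  simp [openP]

theorem openP_subset_openH : W.openP D ⊆ W.openH D := by
  intro c hc
  simp only [openP, openH, Finset.mem_filter] at hc ⊢
  tauto

open Relation in
theorem card_le_of_step {H V : Finset (ℤ × ℤ)}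
    (h : ∀ x ∈ D, ∀ y ∈ D, EqvGen (Step H V) x y) : D.card ≤ H.card + V.card + 1 := by
  classical
  refine (card_le_card_add_one_of_eqvGen D
    (H.image (fun c => (c, (c.1, c.2 - 1))) ∪ V.image (fun c => (c, (c.1 - 1, c.2))))
    fun x hx y hy => (h x hx y hy).mono ?_).trans ?_
  · rintro a b (⟨ha, rfl⟩ | ⟨ha, rfl⟩)
    · exact Finset.mem_union_left _ (Finset.mem_image_of_mem _ ha)
    · exact Finset.mem_union_right _ (Finset.mem_image_of_mem (fun c : ℤ × ℤ => (c, (c.1 - 1, c.2))) ha)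
  · gcongr
    exact (Finset.card_union_le _ _).trans (add_le_add Finset.card_image_le Finset.card_image_le)

-- The four unblocked edges around an open point form a cycle of the adjacency graph. Hence the
-- crossing to the right of the point can be replaced by the one to its left, and one dual edge per
-- open point is dispensable.
open Relation in
theorem eqvGen_step_of_openP {V H : Finset (ℤ × ℤ)} (hV : V = W.openV D) {i j : ℤ}
    (hp : (i, j) ∈ W.openP D)
    (ih : EqvGen (Step H V) (i - 1, j) (i - 1, j - 1)) :
    EqvGen (Step H V) (i, j) (i, j - 1) := by
  subst hV
  simp only [openP, Finset.mem_filter] at hp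
  have h1 : EqvGen (Step H (W.openV D)) (i, j) (i - 1, j) :=
    .rel _ _ (Or.inr ⟨by simp only [openV, Finset.mem_filter]; tauto, rfl⟩)
  have h2 : EqvGen (Step H (W.openV D)) (i, j - 1) (i - 1, j - 1) :=
    .rel _ _ (Or.inr ⟨by simp only [openV, Finset.mem_filter]; tauto, rfl⟩)
  exact .trans _ _ _ (.trans _ _ _ h1 ih) (.symm _ _ h2)

open Relation in
/-- Euler's inequality for a connected set of grid cells. -/
theorem euler_le (hD : ∀ c ∈ D, 0 ≤ c.1)
    (hconn : ∀ x ∈ D, ∀ y ∈ D, EqvGen (Step (W.openH D) (W.openV D)) x y) :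
    D.card + (W.openP D).card ≤ (W.openH D).card + (W.openV D).card + 1 := by
  -- The replacements move left column by column, and stop because no cell has a negative first
  -- coordinate.
  have key : ∀ n : ℕ, ∀ i j : ℤ, i < n → (i, j) ∈ W.openH D →
      EqvGen (Step (W.openH D \ W.openP D) (W.openV D)) (i, j) (i, j - 1) := by
    intro n
    induction n with
    | zero =>
      intro i j hi hij
      have := hD _ (mem_openH.1 hij).1
      simp only [Nat.cast_zero] at hi this
      omega
    | succ n ih =>
      intro i j hi hij
      by_cases hp : (i, j) ∈ W.openP D
      · refine eqvGen_step_of_openP rfl hp (ih _ _ (by push_cast at hi; omega) ?_)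
        simp only [openP, openH, Finset.mem_filter] at hp ⊢
        tauto
      · exact .rel _ _ (Or.inl ⟨Finset.mem_sdiff.2 ⟨hij, hp⟩, rfl⟩)
  have h := card_le_of_step (D := D) (H := W.openH D \ W.openP D) (V := W.openV D)
    fun x hx y hy => by
      have := hconn x hx y hy
      clear hx hy
      induction this with
      | rel x y h =>
        rcases h with ⟨h, rfl⟩ | h
        · exact key (x.1.toNat + 1) x.1 x.2 (by push_cast; omega) h
        · exact .rel _ _ (Or.inr h)
      | refl x => exact .refl _
      | symm x y _ ih => exact .symm _ _ ih
      | trans x y z _ _ ih₁ ih₂ => exact .trans _ _ _ ih₁ ih₂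
  have := Finset.card_sdiff_add_card_eq_card (openP_subset_openH (W := W) (D := D))
  omega

open Relation in
/-- Euler's inequality for a connected set of grid cells that surrounds a wall. -/
theorem euler_lt {N i₀ j₀ : ℤ} (hD : ∀ c ∈ D, 0 ≤ c.1)
    (hi₀ : 0 < i₀) (hi₀N : i₀ < N) (hj₀ : 0 < j₀) (hj₀N : j₀ < N)
    (hp : (i₀, j₀) ∉ W.openP D)
    (hleft : ∀ j, 0 < j → j < N → (0, j) ∈ W.openH D)
    (hbot : ∀ i, 0 < i → i < N → (i, 0) ∈ W.openV D)
    (htop : ∀ i, 0 < i → i < N → (i, N - 1) ∈ W.openV D)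
    (hright : ∀ j, 0 < j → j < N → (i₀, j) ∈ W.openH D)
    (hconn : ∀ x ∈ D, ∀ y ∈ D, EqvGen (Step (W.openH D) (W.openV D)) x y) :
    D.card + (W.openP D).card ≤ (W.openH D).card + (W.openV D).card := by
  -- Besides one edge per open point, the edge to the right of the wall point `(i₀, j₀)` is
  -- discarded; the loop around the wall makes up for it.
  set H := (W.openH D \ W.openP D).erase (i₀, j₀) with hH
  set V := W.openV D with hVdef
  have hcases : ∀ i j : ℤ, (i, j) ≠ (i₀, j₀) → (i, j) ∈ W.openH D →
      ((i, j) ∈ W.openP D → EqvGen (Step H V) (i - 1, j) (i - 1, j - 1)) →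
      EqvGen (Step H V) (i, j) (i, j - 1) := by
    intro i j hne hij ih
    by_cases hp : (i, j) ∈ W.openP D
    · exact eqvGen_step_of_openP rfl hp (ih hp)
    · exact .rel _ _ (Or.inl ⟨Finset.mem_erase.2 ⟨hne, Finset.mem_sdiff.2 ⟨hij, hp⟩⟩, rfl⟩)
  have hprev : ∀ i j : ℤ, (i, j) ∈ W.openP D → (i - 1, j) ∈ W.openH D := by
    intro i j hp
    simp only [openP, openH, Finset.mem_filter] at hp ⊢
    tauto
  -- Replacements only move left, so those starting in a column up to `i₀`, other than at `(i₀, j₀)`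
  -- itself, never use the discarded edge.
  have key₁ : ∀ n : ℕ, ∀ i j : ℤ, i < n → i ≤ i₀ → (i, j) ≠ (i₀, j₀) → (i, j) ∈ W.openH D →
      EqvGen (Step H V) (i, j) (i, j - 1) := by
    intro n
    induction n with
    | zero =>
      intro i j hi _ _ hij
      have := hD _ (mem_openH.1 hij).1
      simp only [Nat.cast_zero] at hi this
      omega
    | succ n ih =>
      intro i j hi hi' hne hij
      refine hcases i j hne hij fun hp => ih _ _ (by push_cast at hi; omega) (by omega) ?_
        (hprev i j hp)
      intro h
      have := (Prod.mk.inj h).1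
      omega
  have key₁' : ∀ i j : ℤ, i ≤ i₀ → (i, j) ≠ (i₀, j₀) → (i, j) ∈ W.openH D →
      EqvGen (Step H V) (i, j) (i, j - 1) := fun i j h h' h'' =>
    key₁ (i.toNat + 1) i j (by push_cast; omega) h h' h''
  have hrow : ∀ j, (∀ i, 0 < i → i < N → (i, j) ∈ V) → ∀ n : ℕ, (n : ℤ) < N →
      EqvGen (Step H V) ((n : ℤ), j) (0, j) := by
    intro j hj n
    induction n with
    | zero => intro _; exact .refl _
    | succ n ih =>
      intro hn
      push_cast at hn ⊢
      refine .trans _ _ _ (.rel _ _ (Or.inr ⟨hj _ (by omega) hn, rfl⟩)) ?_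
      simpa using ih (by omega)
  have hcol : ∀ i a : ℤ, i ≤ i₀ → 0 ≤ a → ∀ n : ℕ, a + n < N →
      (∀ j, a < j → j ≤ a + n → (i, j) ≠ (i₀, j₀) ∧ (i, j) ∈ W.openH D) →
      EqvGen (Step H V) (i, a + n) (i, a) := by
    intro i a hi ha n
    induction n with
    | zero => intro _ _; simpa using EqvGen.refl _
    | succ n ih =>
      intro hn hj
      push_cast at hn hj ⊢
      have h1 := hj (a + (n + 1)) (by omega) le_rfl
      refine .trans _ _ _ (key₁' _ _ hi h1.1 h1.2) ?_
      have : a + ((n : ℤ) + 1) - 1 = a + n := by ring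
      rw [this]
      exact ih (by omega) fun j h h' => hj j h (by omega)
  -- The detour for the discarded edge: up column `i₀`, left along the top row, down column 0, right
  -- along the bottom row and up column `i₀` again.
  have hlong : EqvGen (Step H V) (i₀, j₀) (i₀, j₀ - 1) := by
    have e1 := hcol i₀ j₀ le_rfl hj₀.le (N - 1 - j₀).toNat (by omega) fun j h h' =>
      ⟨fun h => by have := (Prod.mk.inj h).2; omega, hright j (by omega) (by omega)⟩
    have e2 := hrow (N - 1) htop i₀.toNat (by omega)
    have e3 := hcol 0 0 hi₀.le le_rfl (N - 1).toNat (by omega) fun j h h' =>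
      ⟨fun h => by have := (Prod.mk.inj h).1; omega, hleft j (by omega) (by omega)⟩
    have e4 := hrow 0 hbot i₀.toNat (by omega)
    have e5 := hcol i₀ 0 le_rfl le_rfl (j₀ - 1).toNat (by omega) fun j h h' =>
      ⟨fun h => by have := (Prod.mk.inj h).2; omega, hright j (by omega) (by omega)⟩
    rw [show j₀ + ((N - 1 - j₀).toNat : ℤ) = N - 1 by omega] at e1
    rw [show ((i₀.toNat : ℕ) : ℤ) = i₀ by omega] at e2 e4
    rw [show (0 : ℤ) + ((N - 1).toNat : ℤ) = N - 1 by omega] at e3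
    rw [show (0 : ℤ) + ((j₀ - 1).toNat : ℤ) = j₀ - 1 by omega] at e5
    exact .trans _ _ _ (.symm _ _ e1) (.trans _ _ _ e2 (.trans _ _ _ e3
      (.trans _ _ _ (.symm _ _ e4) (.symm _ _ e5))))
  have key₂ : ∀ n : ℕ, ∀ i j : ℤ, i < n → (i, j) ∈ W.openH D →
      EqvGen (Step H V) (i, j) (i, j - 1) := by
    intro n
    induction n with
    | zero =>
      intro i j hi hij
      have := hD _ (mem_openH.1 hij).1
      simp only [Nat.cast_zero] at hi this
      omega
    | succ n ih =>
      intro i j hi hij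
      by_cases hne : (i, j) = (i₀, j₀)
      · obtain ⟨rfl, rfl⟩ := Prod.mk.inj hne
        exact hlong
      · exact hcases i j hne hij fun hp => ih _ _ (by push_cast at hi; omega) (hprev i j hp)
  have h := card_le_of_step (D := D) (H := H) (V := V)
    fun x hx y hy => by
      have := hconn x hx y hy
      clear hx hy
      induction this with
      | rel x y h =>
        rcases h with ⟨h, rfl⟩ | h
        · exact key₂ (x.1.toNat + 1) x.1 x.2 (by push_cast; omega) h
        · exact .rel _ _ (Or.inr h)
      | refl x => exact .refl _
      | symm x y _ ih => exact .symm _ _ ih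
      | trans x y z _ _ ih₁ ih₂ => exact .trans _ _ _ ih₁ ih₂
  have h1 := Finset.card_sdiff_add_card_eq_card (openP_subset_openH (W := W) (D := D))
  have h2 : H.card + 1 = (W.openH D \ W.openP D).card :=
    Finset.card_erase_add_one (Finset.mem_sdiff.2 ⟨hright j₀ hj₀ hj₀N, hp⟩)
  omega

end Walls

/-! ### Grid arrangements, regions and the edges on one segment -/

/-- A segment of the integer grid on the vertical or horizontal line with number `line`. -/
structure GridSeg where
  vert : Bool
  line : ℤ
  lo : ℤ
  hi : ℤ
  lt : lo < hi

namespace GridSeg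

/-- The grid point of the line of `s` with coordinate `u` along that line. -/
def pos (s : GridSeg) (u : ℤ) : ℤ × ℤ := if s.vert then (s.line, u) else (u, s.line)

/-- The cell to the left of (or above) the unit edge of `s` that starts at `u`. -/
def lc (s : GridSeg) (u : ℤ) : ℤ × ℤ := if s.vert then (s.line - 1, u) else (u, s.line)

/-- The cell to the right of (or below) the unit edge of `s` that starts at `u`. -/
def rc (s : GridSeg) (u : ℤ) : ℤ × ℤ := if s.vert then (s.line, u) else (u, s.line - 1)

/-- The grid point `p` lies on `s`. -/
def Mem (s : GridSeg) (p : ℤ × ℤ) : Prop := ∃ u, s.lo ≤ u ∧ u ≤ s.hi ∧ s.pos u = p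

theorem pos_injective (s : GridSeg) {u u' : ℤ} (h : s.pos u = s.pos u') : u = u' := by
  unfold pos at h
  split_ifs at h <;> simpa using h

theorem mem_of_vert {s : GridSeg} (h : s.vert = true) {p : ℤ × ℤ} :
    s.Mem p ↔ s.line = p.1 ∧ s.lo ≤ p.2 ∧ p.2 ≤ s.hi := by
  obtain ⟨x, y⟩ := p
  simp only [Mem, pos, h, if_true, Prod.mk.injEq]
  constructor
  · rintro ⟨u, h1, h2, h3, rfl⟩; exact ⟨h3, h1, h2⟩
  · rintro ⟨h1, h2, h3⟩; exact ⟨y, h2, h3, h1, rfl⟩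

theorem mem_of_not_vert {s : GridSeg} (h : s.vert = false) {p : ℤ × ℤ} :
    s.Mem p ↔ s.line = p.2 ∧ s.lo ≤ p.1 ∧ p.1 ≤ s.hi := by
  obtain ⟨x, y⟩ := p
  simp only [Mem, pos, h, Bool.false_eq_true, if_false, Prod.mk.injEq]
  constructor
  · rintro ⟨u, h1, h2, rfl, h3⟩; exact ⟨h3, h1, h2⟩
  · rintro ⟨h1, h2, h3⟩; exact ⟨x, h2, h3, rfl, h1⟩

end GridSeg

/-- Segments of the integer grid in general position inside the box `(0, N) × (0, N)`. -/
structure GridArrangement (ι : Type*) where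
  seg : ι → GridSeg
  N : ℤ
  line_pos : ∀ s, 0 < (seg s).line
  line_lt : ∀ s, (seg s).line < N
  lo_pos : ∀ s, 0 < (seg s).lo
  hi_lt : ∀ s, (seg s).hi < N
  parallel : ∀ s t p, (seg s).vert = (seg t).vert → (seg s).Mem p → (seg t).Mem p → s = t
  cross : ∀ s t u u', (seg s).vert = false → (seg t).vert = true →
    (seg s).pos u = (seg t).pos u' → (u = (seg s).lo ∨ u = (seg s).hi) →
    (u' = (seg t).lo ∨ u' = (seg t).hi) → False

namespace GridArrangement

variable {ι : Type*} (A : GridArrangement ι)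

/-- The unit edges covered by the segments. -/
def walls : Walls where
  h i j := ∃ s, (A.seg s).vert = false ∧ (A.seg s).line = j ∧ (A.seg s).lo ≤ i ∧ i < (A.seg s).hi
  v i j := ∃ s, (A.seg s).vert = true ∧ (A.seg s).line = i ∧ (A.seg s).lo ≤ j ∧ j < (A.seg s).hi

/-- A connected set of cells of the box that is closed under crossing unblocked edges. -/
structure IsRegion (D : Finset (ℤ × ℤ)) : Prop where
  box : ∀ c ∈ D, 0 ≤ c.1 ∧ c.1 < A.N ∧ 0 ≤ c.2 ∧ c.2 < A.N
  closedH : ∀ i j, 0 ≤ i → i < A.N → 0 < j → j < A.N → ¬ A.walls.h i j →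
    ((i, j) ∈ D ↔ (i, j - 1) ∈ D)
  closedV : ∀ i j, 0 ≤ j → j < A.N → 0 < i → i < A.N → ¬ A.walls.v i j →
    ((i, j) ∈ D ↔ (i - 1, j) ∈ D)
  conn : ∀ x ∈ D, ∀ y ∈ D, Relation.EqvGen (Walls.Step (A.walls.openH D) (A.walls.openV D)) x y

/-- No other segment passes through the point of `s` with coordinate `u`. -/
def Free (s : ι) (u : ℤ) : Prop := ∀ t, t ≠ s → ¬ (A.seg t).Mem ((A.seg s).pos u)

/-- The point of `s` with coordinate `u` is a vertex of the arrangement. -/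
def IsVertexOn (s : ι) (u : ℤ) : Prop :=
  u = (A.seg s).lo ∨ u = (A.seg s).hi ∨ ¬ A.Free s u

/-- The grid point `p` is a vertex of the arrangement. -/
def IsVertex (p : ℤ × ℤ) : Prop :=
  ∃ s u, (A.seg s).lo ≤ u ∧ u ≤ (A.seg s).hi ∧ (A.seg s).pos u = p ∧ A.IsVertexOn s u

open Classical in
/-- The edges on `s` with a cell of `D` on at least one side, given by their lower endpoints. -/
noncomputable def edgesOn (D : Finset (ℤ × ℤ)) (s : ι) : Finset ℤ :=
  (Finset.Ico (A.seg s).lo (A.seg s).hi).filter fun u =>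
    A.IsVertexOn s u ∧ ((A.seg s).lc u ∈ D ∨ (A.seg s).rc u ∈ D)

variable {A} {D : Finset (ℤ × ℤ)}

namespace IsRegion

variable (hD : A.IsRegion D)
include hD

/-- A transverse wall separating two consecutive cells next to `s` would contain the grid point
between them. So the sides of `s` change their membership in `D` only at points that are not free;
this also applies across a free end, to the cells beyond it. -/
theorem lc_rc_step {s : ι} {u : ℤ} (h1 : (A.seg s).lo ≤ u) (h2 : u ≤ (A.seg s).hi)
    (hf : A.Free s u) :
    ((A.seg s).lc u ∈ D ↔ (A.seg s).lc (u - 1) ∈ D) ∧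
    ((A.seg s).rc u ∈ D ↔ (A.seg s).rc (u - 1) ∈ D) := by
  have a1 := A.line_pos s
  have a2 := A.line_lt s
  have a3 := A.lo_pos s
  have a4 := A.hi_lt s
  cases hs : (A.seg s).vert with
  | false =>
    have key : ∀ t, (A.seg t).vert = true → (A.seg t).line = u → (A.seg t).lo ≤ (A.seg s).line →
        (A.seg s).line ≤ (A.seg t).hi → False := by
      intro t ht h3 h4 h5
      refine hf t (by rintro rfl; simp [hs] at ht) ?_
      rw [GridSeg.mem_of_vert ht]
      simp [GridSeg.pos, hs, h3, h4, h5]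
    simp only [GridSeg.lc, GridSeg.rc, hs, Bool.false_eq_true, if_false]
    constructor
    · refine hD.closedV _ _ (by omega) (by omega) (by omega) (by omega) ?_
      rintro ⟨t, h3, h4, h5, h6⟩
      exact key t h3 h4 (by omega) (by omega)
    · refine hD.closedV _ _ (by omega) (by omega) (by omega) (by omega) ?_
      rintro ⟨t, h3, h4, h5, h6⟩
      exact key t h3 h4 (by omega) (by omega)
  | true =>
    have key : ∀ t, (A.seg t).vert = false → (A.seg t).line = u → (A.seg t).lo ≤ (A.seg s).line →
        (A.seg s).line ≤ (A.seg t).hi → False := by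
      intro t ht h3 h4 h5
      refine hf t (by rintro rfl; simp [hs] at ht) ?_
      rw [GridSeg.mem_of_not_vert ht]
      simp [GridSeg.pos, hs, h3, h4, h5]
    simp only [GridSeg.lc, GridSeg.rc, hs, if_true]
    constructor
    · refine hD.closedH _ _ (by omega) (by omega) (by omega) (by omega) ?_
      rintro ⟨t, h3, h4, h5, h6⟩
      exact key t h3 h4 (by omega) (by omega)
    · refine hD.closedH _ _ (by omega) (by omega) (by omega) (by omega) ?_
      rintro ⟨t, h3, h4, h5, h6⟩
      exact key t h3 h4 (by omega) (by omega)

theorem lc_iff_rc {s : ι} {u : ℤ} (hu : 0 ≤ u) (hu' : u < A.N)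
    (h : ∀ t, (A.seg t).vert = (A.seg s).vert → (A.seg t).line = (A.seg s).line →
      (A.seg t).lo ≤ u → u < (A.seg t).hi → False) :
    (A.seg s).lc u ∈ D ↔ (A.seg s).rc u ∈ D := by
  have a1 := A.line_pos s
  have a2 := A.line_lt s
  cases hs : (A.seg s).vert with
  | false =>
    simp only [GridSeg.lc, GridSeg.rc, hs, Bool.false_eq_true, if_false]
    refine hD.closedH _ _ hu hu' a1 a2 ?_
    rintro ⟨t, h3, h4, h5, h6⟩
    exact h t (by rw [h3, hs]) h4 h5 h6
  | true =>
    simp only [GridSeg.lc, GridSeg.rc, hs, if_true]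
    refine (hD.closedV _ _ hu hu' a1 a2 ?_).symm
    rintro ⟨t, h3, h4, h5, h6⟩
    exact h t (by rw [h3, hs]) h4 h5 h6

omit hD in
theorem mem_pos_of {s t : ι} (h : (A.seg t).vert = (A.seg s).vert)
    (h' : (A.seg t).line = (A.seg s).line) {u : ℤ} (h1 : (A.seg t).lo ≤ u)
    (h2 : u ≤ (A.seg t).hi) : (A.seg t).Mem ((A.seg s).pos u) :=
  ⟨u, h1, h2, by simp [GridSeg.pos, h, h']⟩

/-- By `parallel`, no collinear segment continues `s` at its end, so the unit edge just beyond it is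
unblocked. -/
theorem lc_iff_rc_hi (s : ι) :
    (A.seg s).lc (A.seg s).hi ∈ D ↔ (A.seg s).rc (A.seg s).hi ∈ D := by
  have a3 := A.lo_pos s
  have a4 := A.hi_lt s
  have a5 := (A.seg s).lt
  refine hD.lc_iff_rc (by omega) (by omega) fun t h1 h2 h3 h4 => ?_
  have := A.parallel t s _ h1 (mem_pos_of h1 h2 h3 h4.le) (mem_pos_of rfl rfl a5.le le_rfl)
  subst this
  omega

theorem lc_iff_rc_lo (s : ι) :
    (A.seg s).lc ((A.seg s).lo - 1) ∈ D ↔ (A.seg s).rc ((A.seg s).lo - 1) ∈ D := by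
  have a3 := A.lo_pos s
  have a4 := A.hi_lt s
  have a5 := (A.seg s).lt
  refine hD.lc_iff_rc (by omega) (by omega) fun t h1 h2 h3 h4 => ?_
  have := A.parallel t s _ h1 (mem_pos_of h1 h2 (by omega : _ ≤ (A.seg s).lo) (by omega))
    (mem_pos_of rfl rfl le_rfl a5.le)
  subst this
  omega

end IsRegion

/-- The number of edges with a property on a segment can be counted at either end. -/
theorem card_starts_eq_card_ends {lo hi : ℤ} (hlt : lo < hi) (V g : ℤ → Prop)
    [DecidablePred V] [DecidablePred g] (hlo : V lo) (hhi : V hi)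
    (hg : ∀ u, lo < u → u < hi → ¬ V u → (g u ↔ g (u - 1))) :
    ((Finset.Ico lo hi).filter fun u => V u ∧ g u).card =
      ((Finset.Ioc lo hi).filter fun u => V u ∧ g (u - 1)).card := by
  have e1 : ((Finset.Ico lo hi).filter fun u => g u).card =
      ((Finset.Ioc lo hi).filter fun u => g (u - 1)).card := by
    refine Finset.card_bij (fun u _ => u + 1) ?_ ?_ ?_
    · intro u hu
      simp only [Finset.mem_filter, Finset.mem_Ico, Finset.mem_Ioc, add_sub_cancel_right] at hu ⊢
      exact ⟨⟨by omega, by omega⟩, hu.2⟩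
    · intro u _ u' _ h
      simpa using h
    · intro u hu
      simp only [Finset.mem_filter, Finset.mem_Ioc] at hu
      exact ⟨u - 1, by simp only [Finset.mem_filter, Finset.mem_Ico]; exact ⟨by omega, hu.2⟩,
        by ring⟩
  have e2 : ((Finset.Ico lo hi).filter fun u => ¬ V u ∧ g u) =
      ((Finset.Ioc lo hi).filter fun u => ¬ V u ∧ g (u - 1)) := by
    ext u
    simp only [Finset.mem_filter, Finset.mem_Ico, Finset.mem_Ioc]
    constructor
    · rintro ⟨⟨h1, h2⟩, h3, h4⟩
      have h5 : lo < u := lt_of_le_of_ne h1 (by rintro rfl; exact h3 hlo)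
      exact ⟨⟨h5, h2.le⟩, h3, (hg u h5 h2 h3).1 h4⟩
    · rintro ⟨⟨h1, h2⟩, h3, h4⟩
      have h5 : u < hi := lt_of_le_of_ne h2 (by rintro rfl; exact h3 hhi)
      exact ⟨⟨h1.le, h5⟩, h3, (hg u h1 h5 h3).2 h4⟩
  have s1 := Finset.card_filter_add_card_filter_not (s := (Finset.Ico lo hi).filter fun u => g u) V
  have s2 := Finset.card_filter_add_card_filter_not
    (s := (Finset.Ioc lo hi).filter fun u => g (u - 1)) V
  simp only [Finset.filter_filter] at s1 s2
  simp only [and_comm (a := V _), and_comm (a := ¬ V _)] at e2 ⊢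
  rw [e2] at s1
  omega

open Classical in
/-- The end of `s` with coordinate `u` is free and lies on the boundary of `D`, where
`e` is the unit edge beyond it. -/
noncomputable def freeEnd (A : GridArrangement ι) (D : Finset (ℤ × ℤ)) (s : ι) (u e : ℤ) : ℕ :=
  if A.Free s u ∧ (A.seg s).lc e ∈ D then 1 else 0

-- Inclusion–exclusion for the edges with `D` on the right and those with `D` on the left. The edges
-- in the intersection pay for the free ends: around such an end the region passes from one side to
-- the other, so the last edge has it on both sides.
open Classical in
theorem IsRegion.card_edgesOn_add_le (hD : A.IsRegion D) (s : ι)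
    (hs : ∃ u, (A.seg s).lo ≤ u ∧ u ≤ (A.seg s).hi ∧ ¬ A.Free s u) :
    (A.edgesOn D s).card + (freeEnd A D s (A.seg s).lo ((A.seg s).lo - 1) +
        freeEnd A D s (A.seg s).hi (A.seg s).hi) ≤
      ((Finset.Ico (A.seg s).lo (A.seg s).hi).filter fun u =>
        A.IsVertexOn s u ∧ (A.seg s).rc u ∈ D).card +
      ((Finset.Ioc (A.seg s).lo (A.seg s).hi).filter fun u =>
        A.IsVertexOn s u ∧ (A.seg s).lc (u - 1) ∈ D).card := by
  have hlt := (A.seg s).lt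
  set lo := (A.seg s).lo with hlo
  set hi := (A.seg s).hi with hhi
  have hstep : ∀ u, lo ≤ u → u ≤ hi → A.Free s u → _ := fun u h h' h'' =>
    hD.lc_rc_step h h' h''
  have hnv : ∀ u, lo < u → u < hi → ¬ A.IsVertexOn s u → A.Free s u := by
    intro u _ _ h
    simp only [IsVertexOn, not_or, not_not] at h
    exact h.2.2
  -- Right sides are counted at the lower end of an edge and left sides at its upper end. Either way
  -- the cell comes clockwise after the arm of the edge at that end.
  rw [← card_starts_eq_card_ends hlt (A.IsVertexOn s) (fun u => (A.seg s).lc u ∈ D)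
    (Or.inl rfl) (Or.inr (Or.inl rfl)) fun u h h' h'' => (hstep u h.le h'.le (hnv u h h' h'')).1]
  set P := (Finset.Ico lo hi).filter (fun u => A.IsVertexOn s u ∧ (A.seg s).rc u ∈ D) with hP
  set Q := (Finset.Ico lo hi).filter (fun u => A.IsVertexOn s u ∧ (A.seg s).lc u ∈ D) with hQ
  have hU : A.edgesOn D s = P ∪ Q := by
    ext u
    simp only [edgesOn, hP, hQ, Finset.mem_union, Finset.mem_filter]
    tauto
  have h1 := Finset.card_union_add_card_inter P Q
  rw [hU, ← h1]
  refine Nat.add_le_add_left ?_ _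
  have hBlo : A.Free s lo → (A.seg s).lc (lo - 1) ∈ D → lo ∈ P ∩ Q := by
    intro hf hl
    have h2 := hstep lo le_rfl hlt.le hf
    have h3 := (hD.lc_iff_rc_lo s).1 hl
    simp only [hP, hQ, Finset.mem_inter, Finset.mem_filter, Finset.mem_Ico]
    exact ⟨⟨⟨le_rfl, hlt⟩, Or.inl rfl, h2.2.2 h3⟩, ⟨le_rfl, hlt⟩, Or.inl rfl, h2.1.2 hl⟩
  have hBhi : A.Free s hi → (A.seg s).lc hi ∈ D →
      ∃ u ∈ P ∩ Q, ∀ x, x < hi → lo ≤ x → A.IsVertexOn s x → x ≤ u := by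
    intro hf hl
    have h2 := hstep hi hlt.le le_rfl hf
    have h3 := (hD.lc_iff_rc_hi s).1 hl
    -- `u` is where the last edge of `s` starts; no vertex lies between it and `hi`, so its unit
    -- edges all have the same sides in `D`.
    obtain ⟨u, hu, hmax⟩ := ((Finset.Ico lo hi).filter (A.IsVertexOn s)).exists_max_image id
      ⟨lo, by simp only [Finset.mem_filter, Finset.mem_Ico]; exact ⟨⟨le_rfl, hlt⟩, Or.inl rfl⟩⟩
    simp only [Finset.mem_filter, Finset.mem_Ico, id] at hu hmax
    have hdown : ∀ n : ℕ, u + n < hi → ((A.seg s).lc (u + n) ∈ D ∧ (A.seg s).rc (u + n) ∈ D →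
        (A.seg s).lc u ∈ D ∧ (A.seg s).rc u ∈ D) := by
      intro n
      induction n with
      | zero => simp
      | succ n ih =>
        intro hn h
        push_cast at hn h
        have hx : ¬ A.IsVertexOn s (u + (n + 1)) := fun hv => by
          have := hmax _ ⟨⟨by omega, hn⟩, hv⟩
          omega
        have h4 := hstep _ (by omega) hn.le (hnv _ (by omega) hn hx)
        rw [show u + ((n : ℤ) + 1) - 1 = u + n by ring] at h4
        exact ih (by omega) ⟨h4.1.1 h.1, h4.2.1 h.2⟩
    have h5 := hdown (hi - 1 - u).toNat (by omega)
    rw [show u + ((hi - 1 - u).toNat : ℤ) = hi - 1 by omega] at h5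
    have h6 := h5 ⟨h2.1.1 hl, h2.2.1 h3⟩
    refine ⟨u, ?_, fun x h h' h'' => hmax x ⟨⟨h', h⟩, h''⟩⟩
    simp only [hP, hQ, Finset.mem_inter, Finset.mem_filter, Finset.mem_Ico]
    exact ⟨⟨hu.1, hu.2, h6.2⟩, hu.1, hu.2, h6.1⟩
  unfold freeEnd
  split_ifs with c1 c2 c2
  · obtain ⟨u, hu, hmax⟩ := hBhi c2.1 c2.2
    obtain ⟨x, hx1, hx2, hx3⟩ := hs
    -- Both ends are free, so the meeting point `x` is an inner vertex of `s`. The last edge starts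
    -- at or after `x`, hence differs from the first one.
    have hx4 : x ≠ lo := by rintro rfl; exact hx3 c1.1
    have hx5 : x ≠ hi := by rintro rfl; exact hx3 c2.1
    have hx6 := hmax x (by omega) hx1 (Or.inr (Or.inr hx3))
    refine (Finset.card_pair (show lo ≠ u by omega)).symm.le.trans
      (Finset.card_le_card fun y hy => ?_)
    simp only [Finset.mem_insert, Finset.mem_singleton] at hy
    rcases hy with rfl | rfl
    · exact hBlo c1.1 c1.2
    · exact hu
  · exact Finset.card_pos.2 ⟨_, hBlo c1.1 c1.2⟩
  · obtain ⟨u, hu, -⟩ := hBhi c2.1 c2.2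
    exact Finset.card_pos.2 ⟨_, hu⟩
  · exact Nat.zero_le _

end GridArrangement

/-! ### Local weights of the Euler characteristic -/

namespace Walls

variable (W : Walls) (D : Finset (ℤ × ℤ))

open Classical in
/-- Four times the local contribution of a grid point to the Euler characteristic. -/
noncomputable def weight (p : ℤ × ℤ) : ℤ :=
  ((if (p.1, p.2) ∈ D then 1 else 0) + (if (p.1 - 1, p.2) ∈ D then 1 else 0) +
    (if (p.1, p.2 - 1) ∈ D then 1 else 0) + (if (p.1 - 1, p.2 - 1) ∈ D then 1 else 0)) -
  2 * ((if (p.1, p.2) ∈ W.openH D then 1 else 0) + (if (p.1 - 1, p.2) ∈ W.openH D then 1 else 0) +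
    (if (p.1, p.2) ∈ W.openV D then 1 else 0) + (if (p.1, p.2 - 1) ∈ W.openV D then 1 else 0)) +
  4 * (if (p.1, p.2) ∈ W.openP D then 1 else 0)

open Classical in
theorem sum_indicator_shift (B E : Finset (ℤ × ℤ)) (a b : ℤ)
    (h : ∀ c ∈ E, (c.1 + a, c.2 + b) ∈ B) :
    ∑ p ∈ B, (if (p.1 - a, p.2 - b) ∈ E then (1 : ℤ) else 0) = E.card := by
  rw [Finset.sum_boole]
  congr 1
  refine Finset.card_bij (fun p _ => (p.1 - a, p.2 - b)) ?_ ?_ ?_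
  · intro p hp
    exact (Finset.mem_filter.1 hp).2
  · rintro ⟨x, y⟩ _ ⟨x', y'⟩ _ h
    simpa using h
  · rintro ⟨x, y⟩ hc
    exact ⟨(x + a, y + b), Finset.mem_filter.2 ⟨h _ hc, by simpa using hc⟩, by simp⟩

-- Each cell has four corners of share 1, each open edge two ends of share 2, and each open point
-- counts 4.
variable {W D} in
theorem sum_weight {N : ℤ} (hD : ∀ c ∈ D, 0 ≤ c.1 ∧ c.1 < N ∧ 0 ≤ c.2 ∧ c.2 < N) :
    ∑ p ∈ Finset.Icc 0 N ×ˢ Finset.Icc 0 N, W.weight D p =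
      4 * (D.card - (W.openH D).card - (W.openV D).card + (W.openP D).card) := by
  classical
  have hH : ∀ c ∈ W.openH D, c ∈ D := fun c hc => (mem_openH.1 hc).1
  have hV : ∀ c ∈ W.openV D, c ∈ D := fun c hc => (mem_openV.1 hc).1
  have hP : ∀ c ∈ W.openP D, c ∈ D := fun c hc => (mem_openP.1 hc).1
  have key : ∀ E : Finset (ℤ × ℤ), (∀ c ∈ E, c ∈ D) → ∀ a b : ℤ, 0 ≤ a → a ≤ 1 → 0 ≤ b → b ≤ 1 →
      ∑ p ∈ Finset.Icc 0 N ×ˢ Finset.Icc 0 N, (if (p.1 - a, p.2 - b) ∈ E then (1 : ℤ) else 0) =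
        E.card := by
    intro E hE a b _ _ _ _
    refine sum_indicator_shift _ E a b fun c hc => ?_
    have := hD c (hE c hc)
    simp only [Finset.mem_product, Finset.mem_Icc]
    omega
  have k1 := fun E hE => key E hE 0 0 (by simp) (by simp) (by simp) (by simp)
  have k2 := fun E hE => key E hE 1 0 (by simp) (by simp) (by simp) (by simp)
  have k3 := fun E hE => key E hE 0 1 (by simp) (by simp) (by simp) (by simp)
  have k4 := fun E hE => key E hE 1 1 (by simp) (by simp) (by simp) (by simp)
  simp only [sub_zero] at k1 k2 k3
  simp only [weight, Finset.sum_add_distrib, Finset.sum_sub_distrib, ← Finset.mul_sum]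
  rw [k1 D fun _ h => h, k2 D fun _ h => h, k3 D fun _ h => h, k4 D fun _ h => h, k1 _ hH,
    k2 _ hH, k1 _ hV, k3 _ hV, k1 _ hP]
  ring

end Walls

/-! ### The frame of the box and the weight of the inner points -/

namespace GridArrangement

variable {ι : Type*} {A : GridArrangement ι} {D : Finset (ℤ × ℤ)}

open Walls

theorem not_h_of_le {A : GridArrangement ι} {i j : ℤ} (h : i ≤ 0 ∨ A.N - 1 ≤ i ∨ j ≤ 0 ∨ A.N ≤ j) :
    ¬ A.walls.h i j := by
  rintro ⟨s, -, h1, h2, h3⟩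
  have a1 := A.line_pos s
  have a2 := A.line_lt s
  have a3 := A.lo_pos s
  have a4 := A.hi_lt s
  omega

theorem not_v_of_le {A : GridArrangement ι} {i j : ℤ} (h : j ≤ 0 ∨ A.N - 1 ≤ j ∨ i ≤ 0 ∨ A.N ≤ i) :
    ¬ A.walls.v i j := by
  rintro ⟨s, -, h1, h2, h3⟩
  have a1 := A.line_pos s
  have a2 := A.line_lt s
  have a3 := A.lo_pos s
  have a4 := A.hi_lt s
  omega

/-- Every grid point of a segment has a blocked arm. -/
theorem arm_of_mem {s : ι} {p : ℤ × ℤ} (h : (A.seg s).Mem p) :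
    ((A.seg s).vert = false → A.walls.h p.1 p.2 ∨ A.walls.h (p.1 - 1) p.2) ∧
    ((A.seg s).vert = true → A.walls.v p.1 p.2 ∨ A.walls.v p.1 (p.2 - 1)) := by
  have := (A.seg s).lt
  constructor
  · intro hs
    rw [GridSeg.mem_of_not_vert hs] at h
    rcases lt_or_eq_of_le h.2.2 with h1 | h1
    · exact Or.inl ⟨s, hs, h.1, h.2.1, h1⟩
    · exact Or.inr ⟨s, hs, h.1, by omega, by omega⟩
  · intro hs
    rw [GridSeg.mem_of_vert hs] at h
    rcases lt_or_eq_of_le h.2.2 with h1 | h1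
    · exact Or.inl ⟨s, hs, h.1, h.2.1, h1⟩
    · exact Or.inr ⟨s, hs, h.1, by omega, by omega⟩

theorem mem_box {s : ι} {p : ℤ × ℤ} (hp : (A.seg s).Mem p) :
    0 < p.1 ∧ p.1 < A.N ∧ 0 < p.2 ∧ p.2 < A.N := by
  have a1 := A.line_pos s
  have a2 := A.line_lt s
  have a3 := A.lo_pos s
  have a4 := A.hi_lt s
  cases hs : (A.seg s).vert with
  | false => rw [GridSeg.mem_of_not_vert hs] at hp; omega
  | true => rw [GridSeg.mem_of_vert hs] at hp; omega

namespace IsRegion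

variable (hD : A.IsRegion D)
include hD

/-- A frame point touches at most two cells of the box, joined by at most one edge: the weight is at
least 1 for a single cell and 2 - 2 for two. -/
theorem weight_nonneg_of_frame {p : ℤ × ℤ} (hp : p.1 ≤ 0 ∨ A.N ≤ p.1 ∨ p.2 ≤ 0 ∨ A.N ≤ p.2) :
    0 ≤ A.walls.weight D p := by
  obtain ⟨i, j⟩ := p
  have b1 := hD.box (i, j)
  have b2 := hD.box (i - 1, j)
  have b3 := hD.box (i, j - 1)
  have b4 := hD.box (i - 1, j - 1)
  simp only at hp b1 b2 b3 b4
  rcases hp with hp | hp | hp | hp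
  · have n2 : (i - 1, j) ∉ D := fun h => by have := b2 h; omega
    have n4 : (i - 1, j - 1) ∉ D := fun h => by have := b4 h; omega
    by_cases q1 : (i, j) ∈ D <;> by_cases q3 : (i, j - 1) ∈ D <;>
      simp [weight, mem_openH, mem_openV, mem_openP, n2, n4, q1, q3] <;> split_ifs <;> simp
  · have n2 : (i, j) ∉ D := fun h => by have := b1 h; omega
    have n4 : (i, j - 1) ∉ D := fun h => by have := b3 h; omega
    by_cases q1 : (i - 1, j) ∈ D <;> by_cases q3 : (i - 1, j - 1) ∈ D <;>
      simp [weight, mem_openH, mem_openV, mem_openP, n2, n4, q1, q3] <;> split_ifs <;> simp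
  · have n2 : (i, j - 1) ∉ D := fun h => by have := b3 h; omega
    have n4 : (i - 1, j - 1) ∉ D := fun h => by have := b4 h; omega
    by_cases q1 : (i, j) ∈ D <;> by_cases q3 : (i - 1, j) ∈ D <;>
      simp [weight, mem_openH, mem_openV, mem_openP, n2, n4, q1, q3] <;> split_ifs <;> simp
  · have n2 : (i, j) ∉ D := fun h => by have := b1 h; omega
    have n4 : (i - 1, j) ∉ D := fun h => by have := b2 h; omega
    by_cases q1 : (i, j - 1) ∈ D <;> by_cases q3 : (i - 1, j - 1) ∈ D <;>
      simp [weight, mem_openH, mem_openV, mem_openP, n2, n4, q1, q3] <;> split_ifs <;> simp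

/-- The cells along the frame of the box belong to the same region. -/
theorem frame_mem_iff {i j : ℤ} (hi : 0 ≤ i) (hi' : i < A.N) (hj : 0 ≤ j)
    (hj' : j < A.N) (hij : i = 0 ∨ i = A.N - 1 ∨ j = 0 ∨ j = A.N - 1) :
    (i, j) ∈ D ↔ (0, 0) ∈ D := by
  have col : ∀ i, 0 ≤ i → i < A.N → (∀ j, 0 < j → j < A.N → ¬ A.walls.h i j) →
      ∀ n : ℕ, (n : ℤ) < A.N → ((i, (n : ℤ)) ∈ D ↔ (i, 0) ∈ D) := by
    intro i h1 h2 h3 n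
    induction n with
    | zero => intro _; rfl
    | succ n ih =>
      intro hn
      push_cast at hn ⊢
      rw [hD.closedH _ _ h1 h2 (by omega) hn (h3 _ (by omega) hn)]
      simpa using ih (by omega)
  have row : ∀ j, 0 ≤ j → j < A.N → (∀ i, 0 < i → i < A.N → ¬ A.walls.v i j) →
      ∀ n : ℕ, (n : ℤ) < A.N → (((n : ℤ), j) ∈ D ↔ (0, j) ∈ D) := by
    intro j h1 h2 h3 n
    induction n with
    | zero => intro _; rfl
    | succ n ih =>
      intro hn
      push_cast at hn ⊢
      rw [hD.closedV _ _ h1 h2 (by omega) hn (h3 _ (by omega) hn)]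
      simpa using ih (by omega)
  have e0 := col 0 le_rfl (by omega) (fun j _ _ => not_h_of_le (by omega)) j.toNat (by omega)
  rw [show (j.toNat : ℤ) = j by omega] at e0
  have e1 := row 0 le_rfl (by omega) (fun j _ _ => not_v_of_le (by omega)) i.toNat (by omega)
  rw [show (i.toNat : ℤ) = i by omega] at e1
  rcases hij with rfl | rfl | rfl | rfl
  · exact e0
  · have := col (A.N - 1) hi hi' (fun j _ _ => not_h_of_le (by omega)) j.toNat (by omega)
    rw [show (j.toNat : ℤ) = j by omega] at this
    exact this.trans e1
  · exact e1
  · have := row (A.N - 1) hj hj' (fun j _ _ => not_v_of_le (by omega)) i.toNat (by omega)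
    rw [show (i.toNat : ℤ) = i by omega] at this
    exact this.trans e0

theorem frame_mem (h : (0, 0) ∈ D) {i j : ℤ} (hi : 0 ≤ i) (hi' : i < A.N) (hj : 0 ≤ j)
    (hj' : j < A.N) (hij : i = 0 ∨ i = A.N - 1 ∨ j = 0 ∨ j = A.N - 1) : (i, j) ∈ D :=
  (hD.frame_mem_iff hi hi' hj hj' hij).2 h

theorem sum_inner_weight_le :
    ∑ p ∈ Finset.Ioo 0 A.N ×ˢ Finset.Ioo 0 A.N, A.walls.weight D p ≤ 4 := by
  have h1 := euler_le (fun c hc => (hD.box c hc).1) hD.conn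
  have h2 := sum_weight (W := A.walls) hD.box
  have h3 : ∑ p ∈ Finset.Ioo 0 A.N ×ˢ Finset.Ioo 0 A.N, A.walls.weight D p ≤
      ∑ p ∈ Finset.Icc 0 A.N ×ˢ Finset.Icc 0 A.N, A.walls.weight D p := by
    refine Finset.sum_le_sum_of_subset_of_nonneg
      (Finset.product_subset_product Finset.Ioo_subset_Icc_self Finset.Ioo_subset_Icc_self)
      fun p _ hp => hD.weight_nonneg_of_frame ?_
    simp only [Finset.mem_product, Finset.mem_Ioo] at hp
    omega
  omega

/-- The frame of cells closes up around the segments, which lowers the bound on the Euler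
characteristic from 1 to 0 (`euler_lt`). The four corners of the box carry weight 1 each, leaving at
most -4 for the inner points. -/
theorem sum_inner_weight_le_of_frame [Fintype ι] [Nonempty ι] (h0 : (0, 0) ∈ D) :
    ∑ p ∈ Finset.Ioo 0 A.N ×ˢ Finset.Ioo 0 A.N, A.walls.weight D p ≤ -4 := by
  classical
  have hmem := fun s p => mem_box (A := A) (s := s) (p := p)
  -- `(i₀, j₀)` is a rightmost grid point on the segments. No vertical wall lies to its right and no
  -- horizontal wall crosses column `i₀`, so that whole column of cells belongs to the outer region.
  obtain ⟨⟨i₀, j₀⟩, hp₀, hmax⟩ := ((Finset.Ioo 0 A.N ×ˢ Finset.Ioo 0 A.N).filter fun p =>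
    ∃ s, (A.seg s).Mem p).exists_max_image Prod.fst (by
      let s : ι := Classical.arbitrary ι
      have hm : (A.seg s).Mem ((A.seg s).pos (A.seg s).lo) := ⟨_, le_rfl, (A.seg s).lt.le, rfl⟩
      have := hmem s _ hm
      refine ⟨_, Finset.mem_filter.2 ⟨?_, s, hm⟩⟩
      simp only [Finset.mem_product, Finset.mem_Ioo]
      omega)
  obtain ⟨hbox, s₀, hs₀⟩ := Finset.mem_filter.1 hp₀
  have hbox' := hmem s₀ _ hs₀
  simp only at hbox' hmax
  have hmax' : ∀ s p, (A.seg s).Mem p → p.1 ≤ i₀ := by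
    intro s p hp
    have := hmem s p hp
    refine hmax p (Finset.mem_filter.2 ⟨?_, s, hp⟩)
    simp only [Finset.mem_product, Finset.mem_Ioo]
    omega
  have hv : ∀ i j, i₀ < i → ¬ A.walls.v i j := by
    rintro i j hi ⟨s, h1, h2, h3, h4⟩
    have := hmax' s (i, j) ((GridSeg.mem_of_vert h1).2 ⟨h2, h3, h4.le⟩)
    simp only at this
    omega
  have hh : ∀ j, ¬ A.walls.h i₀ j := by
    rintro j ⟨s, h1, h2, h3, h4⟩
    have := hmax' s (i₀ + 1, j) ((GridSeg.mem_of_not_vert h1).2 ⟨h2, by simp only; omega, by simp only; omega⟩)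
    simp only at this
    omega
  have hcol : ∀ j, 0 ≤ j → j < A.N → (i₀, j) ∈ D := by
    intro j h1 h2
    have key : ∀ n : ℕ, i₀ ≤ A.N - 1 - n → (A.N - 1 - n, j) ∈ D := by
      intro n
      induction n with
      | zero => intro _; exact hD.frame_mem h0 (by simp; omega) (by simp) h1 h2 (by simp)
      | succ n ih =>
        intro hn
        push_cast at hn ⊢
        have := (hD.closedV (A.N - 1 - n) j h1 h2 (by omega) (by omega) (hv _ _ (by omega))).1
          (ih (by omega))
        rwa [show A.N - 1 - (n : ℤ) - 1 = A.N - 1 - (n + 1) by ring] at this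
    have := key (A.N - 1 - i₀).toNat (by omega)
    rwa [show A.N - 1 - ((A.N - 1 - i₀).toNat : ℤ) = i₀ by omega] at this
  have h1 := euler_lt (N := A.N) (i₀ := i₀) (j₀ := j₀) (fun c hc => (hD.box c hc).1)
    hbox'.1 hbox'.2.1 hbox'.2.2.1 hbox'.2.2.2
    (by
      rw [mem_openP]
      have := arm_of_mem hs₀
      cases hs : (A.seg s₀).vert with
      | false => have := this.1 hs; tauto
      | true => have := this.2 hs; tauto)
    (fun j h h' => mem_openH.2 ⟨hD.frame_mem h0 le_rfl (by omega) h.le h' (Or.inl rfl),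
      hD.frame_mem h0 le_rfl (by omega) (by simp; omega) (by simp; omega) (Or.inl rfl), not_h_of_le (by simp)⟩)
    (fun i h h' => mem_openV.2 ⟨hD.frame_mem h0 h.le h' le_rfl (by omega) (by simp),
      hD.frame_mem h0 (by simp; omega) (by simp; omega) le_rfl (by omega) (by simp),
      not_v_of_le (by simp)⟩)
    (fun i h h' => mem_openV.2 ⟨hD.frame_mem h0 h.le h' (by omega) (by omega) (by simp),
      hD.frame_mem h0 (by simp; omega) (by simp; omega) (by simp; omega) (by simp) (by simp),
      not_v_of_le (by simp)⟩)
    (fun j h h' => mem_openH.2 ⟨hcol j h.le h', hcol _ (by simp; omega) (by simp; omega), hh j⟩)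
    hD.conn
  have h2 := sum_weight (W := A.walls) hD.box
  have hN : 1 < A.N := by omega
  have hI : Finset.Ioo 0 A.N ×ˢ Finset.Ioo 0 A.N ⊆ Finset.Icc 0 A.N ×ˢ Finset.Icc 0 A.N :=
    Finset.product_subset_product Finset.Ioo_subset_Icc_self Finset.Ioo_subset_Icc_self
  have h3 := Finset.sum_sdiff (f := A.walls.weight D) hI
  have h4 : ∑ p ∈ ({(0, 0), (0, A.N), (A.N, 0), (A.N, A.N)} : Finset (ℤ × ℤ)), A.walls.weight D p ≤
      ∑ p ∈ (Finset.Icc 0 A.N ×ˢ Finset.Icc 0 A.N) \ (Finset.Ioo 0 A.N ×ˢ Finset.Ioo 0 A.N),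
        A.walls.weight D p := by
    refine Finset.sum_le_sum_of_subset_of_nonneg ?_ fun p hp _ => hD.weight_nonneg_of_frame ?_
    · intro p hp
      simp only [Finset.mem_insert, Finset.mem_singleton] at hp
      simp only [Finset.mem_sdiff, Finset.mem_product, Finset.mem_Icc, Finset.mem_Ioo]
      rcases hp with rfl | rfl | rfl | rfl <;> simp <;> omega
    · simp only [Finset.mem_sdiff, Finset.mem_product, Finset.mem_Icc, Finset.mem_Ioo] at hp
      omega
  have m1 := hD.frame_mem h0 (i := 0) (j := A.N - 1) (by omega) (by omega) (by omega) (by omega)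
    (by omega)
  have m2 := hD.frame_mem h0 (i := A.N - 1) (j := 0) (by omega) (by omega) (by omega) (by omega)
    (by omega)
  have m3 := hD.frame_mem h0 (i := A.N - 1) (j := A.N - 1) (by omega) (by omega) (by omega)
    (by omega) (by omega)
  have nm : ∀ i j : ℤ, (i < 0 ∨ A.N ≤ i ∨ j < 0 ∨ A.N ≤ j) → (i, j) ∉ D := by
    intro i j h hm
    have := hD.box _ hm
    simp only at this
    omega
  have n1 : ∀ j, (-1, j) ∉ D := fun j => nm _ _ (by simp)
  have n2 : ∀ i, (i, -1) ∉ D := fun i => nm _ _ (by simp)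
  have n3 : ∀ j, (A.N, j) ∉ D := fun j => nm _ _ (by simp)
  have n4 : ∀ i, (i, A.N) ∉ D := fun i => nm _ _ (by simp)
  have h5 : ∑ p ∈ ({(0, 0), (0, A.N), (A.N, 0), (A.N, A.N)} : Finset (ℤ × ℤ)),
      A.walls.weight D p = 4 := by
    rw [Finset.sum_insert (by simp; omega), Finset.sum_insert (by simp; omega),
      Finset.sum_insert (by simp; omega), Finset.sum_singleton]
    simp [weight, mem_openH, mem_openV, mem_openP, h0, m1, m2, m3, n1, n2, n3, n4]
  omega

end IsRegion

end GridArrangement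

/-! ### Counting corners: the discrete bound -/

namespace GridArrangement

variable {ι : Type*} {A : GridArrangement ι} {D : Finset (ℤ × ℤ)}

open Walls

open Classical in
/-- The number of pairs of an arm at the vertex `p` and the cell of `D` clockwise after it. -/
noncomputable def cornerCount (A : GridArrangement ι) (D : Finset (ℤ × ℤ)) (p : ℤ × ℤ) : ℤ :=
  (if A.IsVertex p ∧ A.walls.h p.1 p.2 ∧ (p.1, p.2 - 1) ∈ D then 1 else 0) +
  (if A.IsVertex p ∧ A.walls.v p.1 p.2 ∧ (p.1, p.2) ∈ D then 1 else 0) +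
  (if A.IsVertex p ∧ A.walls.h (p.1 - 1) p.2 ∧ (p.1 - 1, p.2) ∈ D then 1 else 0) +
  (if A.IsVertex p ∧ A.walls.v p.1 (p.2 - 1) ∧ (p.1 - 1, p.2 - 1) ∈ D then 1 else 0)

open Classical in
/-- `1` if the region lies straight beyond an end of `s`, plus `2` if this end is free. -/
noncomputable def endWeight (A : GridArrangement ι) (D : Finset (ℤ × ℤ)) (s : ι) (u e : ℤ) : ℤ :=
  (if (A.seg s).lc e ∈ D then 1 else 0) + 2 * freeEnd A D s u e

theorem endWeight_nonneg (s : ι) (u e : ℤ) : 0 ≤ endWeight A D s u e := by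
  unfold endWeight
  split_ifs <;> positivity

/-- The total weight of the ends at the point `p`. -/
noncomputable def endSum [Fintype ι] (A : GridArrangement ι) (D : Finset (ℤ × ℤ)) (p : ℤ × ℤ) : ℤ :=
  ∑ s, ((if (A.seg s).pos (A.seg s).lo = p then
      endWeight A D s (A.seg s).lo ((A.seg s).lo - 1) else 0) +
    (if (A.seg s).pos (A.seg s).hi = p then endWeight A D s (A.seg s).hi (A.seg s).hi else 0))

theorem endSum_term_nonneg (s : ι) (p : ℤ × ℤ) :
    0 ≤ ((if (A.seg s).pos (A.seg s).lo = p then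
      endWeight A D s (A.seg s).lo ((A.seg s).lo - 1) else 0) +
    (if (A.seg s).pos (A.seg s).hi = p then endWeight A D s (A.seg s).hi (A.seg s).hi else 0)) := by
  have h1 := endWeight_nonneg (A := A) (D := D) s (A.seg s).lo ((A.seg s).lo - 1)
  have h2 := endWeight_nonneg (A := A) (D := D) s (A.seg s).hi (A.seg s).hi
  split_ifs <;> omega

theorem endSum_nonneg [Fintype ι] (p : ℤ × ℤ) : 0 ≤ endSum A D p :=
  Finset.sum_nonneg fun s _ => endSum_term_nonneg s p

theorem le_endSum_lo [Fintype ι] {s : ι} {p : ℤ × ℤ} (h : (A.seg s).pos (A.seg s).lo = p) :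
    endWeight A D s (A.seg s).lo ((A.seg s).lo - 1) ≤ endSum A D p := by
  refine le_trans ?_ (Finset.single_le_sum (fun s _ => endSum_term_nonneg s p) (Finset.mem_univ s))
  have h2 := endWeight_nonneg (A := A) (D := D) s (A.seg s).hi (A.seg s).hi
  rw [if_pos h]
  split_ifs <;> omega

theorem le_endSum_hi [Fintype ι] {s : ι} {p : ℤ × ℤ} (h : (A.seg s).pos (A.seg s).hi = p) :
    endWeight A D s (A.seg s).hi (A.seg s).hi ≤ endSum A D p := by
  refine le_trans ?_ (Finset.single_le_sum (fun s _ => endSum_term_nonneg s p) (Finset.mem_univ s))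
  have h2 := endWeight_nonneg (A := A) (D := D) s (A.seg s).lo ((A.seg s).lo - 1)
  rw [if_pos h]
  split_ifs <;> omega

/-- Only one segment passes through a point with arms in a single direction. -/
theorem free_of_arms {s : ι} {u : ℤ} (h1 : (A.seg s).lo ≤ u) (h2 : u ≤ (A.seg s).hi)
    {p : ℤ × ℤ} (hp : (A.seg s).pos u = p)
    (h : ((A.seg s).vert = false → ¬ A.walls.v p.1 p.2 ∧ ¬ A.walls.v p.1 (p.2 - 1)) ∧
      ((A.seg s).vert = true → ¬ A.walls.h p.1 p.2 ∧ ¬ A.walls.h (p.1 - 1) p.2)) :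
    A.Free s u := by
  intro t hts hm
  rw [hp] at hm
  have harm := arm_of_mem hm
  have hpar : (A.seg t).vert = (A.seg s).vert → False := fun h' =>
    hts (A.parallel t s p h' hm ⟨u, h1, h2, hp⟩)
  cases ht : (A.seg t).vert <;> cases hs : (A.seg s).vert
  · exact hpar (by rw [ht, hs])
  · have := harm.1 ht; have := h.2 hs; tauto
  · have := harm.2 ht; have := h.1 hs; tauto
  · exact hpar (by rw [ht, hs])

theorem exists_end_right {i j : ℤ} (h : A.walls.h i j) (h' : ¬ A.walls.h (i - 1) j) :
    ∃ s, (A.seg s).vert = false ∧ (A.seg s).pos (A.seg s).lo = (i, j) ∧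
      (A.seg s).lc ((A.seg s).lo - 1) = (i - 1, j) := by
  obtain ⟨s, h1, h2, h3, h4⟩ := h
  have h5 : (A.seg s).lo = i := by
    by_contra hne
    exact h' ⟨s, h1, h2, by omega, by omega⟩
  exact ⟨s, h1, by simp [GridSeg.pos, h1, h2, h5], by simp [GridSeg.lc, h1, h2, h5]⟩

theorem exists_end_left {i j : ℤ} (h : A.walls.h (i - 1) j) (h' : ¬ A.walls.h i j) :
    ∃ s, (A.seg s).vert = false ∧ (A.seg s).pos (A.seg s).hi = (i, j) ∧
      (A.seg s).lc (A.seg s).hi = (i, j) := by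
  obtain ⟨s, h1, h2, h3, h4⟩ := h
  have h5 : (A.seg s).hi = i := by
    by_contra hne
    exact h' ⟨s, h1, h2, by omega, by omega⟩
  exact ⟨s, h1, by simp [GridSeg.pos, h1, h2, h5], by simp [GridSeg.lc, h1, h2, h5]⟩

theorem exists_end_up {i j : ℤ} (h : A.walls.v i j) (h' : ¬ A.walls.v i (j - 1)) :
    ∃ s, (A.seg s).vert = true ∧ (A.seg s).pos (A.seg s).lo = (i, j) ∧
      (A.seg s).lc ((A.seg s).lo - 1) = (i - 1, j - 1) := by
  obtain ⟨s, h1, h2, h3, h4⟩ := h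
  have h5 : (A.seg s).lo = j := by
    by_contra hne
    exact h' ⟨s, h1, h2, by omega, by omega⟩
  exact ⟨s, h1, by simp [GridSeg.pos, h1, h2, h5], by simp [GridSeg.lc, h1, h2, h5]⟩

theorem exists_end_down {i j : ℤ} (h : A.walls.v i (j - 1)) (h' : ¬ A.walls.v i j) :
    ∃ s, (A.seg s).vert = true ∧ (A.seg s).pos (A.seg s).hi = (i, j) ∧
      (A.seg s).lc (A.seg s).hi = (i - 1, j) := by
  obtain ⟨s, h1, h2, h3, h4⟩ := h
  have h5 : (A.seg s).hi = j := by
    by_contra hne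
    exact h' ⟨s, h1, h2, by omega, by omega⟩
  exact ⟨s, h1, by simp [GridSeg.pos, h1, h2, h5], by simp [GridSeg.lc, h1, h2, h5]⟩

/-- No two segments meet in a common endpoint. -/
theorem not_corner {i j : ℤ} : ¬ ((A.walls.h i j ∧ ¬ A.walls.h (i - 1) j ∨
    A.walls.h (i - 1) j ∧ ¬ A.walls.h i j) ∧ (A.walls.v i j ∧ ¬ A.walls.v i (j - 1) ∨
    A.walls.v i (j - 1) ∧ ¬ A.walls.v i j)) := by
  rintro ⟨h, v⟩
  have hh : ∃ s u, (A.seg s).vert = false ∧ (A.seg s).pos u = (i, j) ∧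
      (u = (A.seg s).lo ∨ u = (A.seg s).hi) := by
    rcases h with ⟨h, h'⟩ | ⟨h, h'⟩
    · obtain ⟨s, h1, h2, -⟩ := exists_end_right h h'
      exact ⟨s, _, h1, h2, Or.inl rfl⟩
    · obtain ⟨s, h1, h2, -⟩ := exists_end_left h h'
      exact ⟨s, _, h1, h2, Or.inr rfl⟩
  have hv : ∃ s u, (A.seg s).vert = true ∧ (A.seg s).pos u = (i, j) ∧
      (u = (A.seg s).lo ∨ u = (A.seg s).hi) := by
    rcases v with ⟨h, h'⟩ | ⟨h, h'⟩
    · obtain ⟨s, h1, h2, -⟩ := exists_end_up h h'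
      exact ⟨s, _, h1, h2, Or.inl rfl⟩
    · obtain ⟨s, h1, h2, -⟩ := exists_end_down h h'
      exact ⟨s, _, h1, h2, Or.inr rfl⟩
  obtain ⟨s, u, hs, hu, hu'⟩ := hh
  obtain ⟨t, w, ht, hw, hw'⟩ := hv
  exact A.cross s t u w hs ht (hu.trans hw.symm) hu' hw'

/-- By `parallel`, both arms belong to one segment. The point is then inner to it, and a second
segment through the point would need a vertical arm. -/
theorem not_isVertex_of_h {i j : ℤ} (h1 : A.walls.h i j) (h2 : A.walls.h (i - 1) j)
    (h3 : ¬ A.walls.v i j) (h4 : ¬ A.walls.v i (j - 1)) : ¬ A.IsVertex (i, j) := by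
  rintro ⟨s, u, h5, h6, h7, h8⟩
  have hs : (A.seg s).vert = false := by
    by_contra hs
    have := (arm_of_mem (A := A) ⟨u, h5, h6, h7⟩).2 (by simpa using hs)
    tauto
  have hp : u = i ∧ (A.seg s).line = j := by simpa [GridSeg.pos, hs] using h7
  obtain ⟨rfl, rfl⟩ := hp
  obtain ⟨t, a1, a2, a3, a4⟩ := h1
  obtain ⟨r, b1, b2, b3, b4⟩ := h2
  have m1 : (A.seg t).Mem ((A.seg s).pos u) := IsRegion.mem_pos_of (a1.trans hs.symm) a2 a3 a4.le
  have m2 : (A.seg r).Mem ((A.seg s).pos u) :=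
    IsRegion.mem_pos_of (b1.trans hs.symm) b2 (by omega) (by omega)
  have e1 := A.parallel t s _ (a1.trans hs.symm) m1 ⟨u, h5, h6, rfl⟩
  have e2 := A.parallel r s _ (b1.trans hs.symm) m2 ⟨u, h5, h6, rfl⟩
  subst e1 e2
  rcases h8 with h8 | h8 | h8
  · omega
  · omega
  · refine h8 (free_of_arms h5 h6 h7 ⟨fun _ => ⟨h3, h4⟩, fun h => ?_⟩)
    rw [hs] at h
    cases h

theorem not_isVertex_of_v {i j : ℤ} (h1 : A.walls.v i j) (h2 : A.walls.v i (j - 1))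
    (h3 : ¬ A.walls.h i j) (h4 : ¬ A.walls.h (i - 1) j) : ¬ A.IsVertex (i, j) := by
  rintro ⟨s, u, h5, h6, h7, h8⟩
  have hs : (A.seg s).vert = true := by
    by_contra hs
    have := (arm_of_mem (A := A) ⟨u, h5, h6, h7⟩).1 (by simpa using hs)
    tauto
  have hp : (A.seg s).line = i ∧ u = j := by simpa [GridSeg.pos, hs] using h7
  obtain ⟨rfl, rfl⟩ := hp
  obtain ⟨t, a1, a2, a3, a4⟩ := h1
  obtain ⟨r, b1, b2, b3, b4⟩ := h2
  have m1 : (A.seg t).Mem ((A.seg s).pos u) := IsRegion.mem_pos_of (a1.trans hs.symm) a2 a3 a4.le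
  have m2 : (A.seg r).Mem ((A.seg s).pos u) :=
    IsRegion.mem_pos_of (b1.trans hs.symm) b2 (by omega) (by omega)
  have e1 := A.parallel t s _ (a1.trans hs.symm) m1 ⟨u, h5, h6, rfl⟩
  have e2 := A.parallel r s _ (b1.trans hs.symm) m2 ⟨u, h5, h6, rfl⟩
  subst e1 e2
  rcases h8 with h8 | h8 | h8
  · omega
  · omega
  · refine h8 (free_of_arms h5 h6 h7 ⟨fun h => ?_, fun _ => ⟨h3, h4⟩⟩)
    rw [hs] at h
    cases h

theorem endWeight_of_mem {s : ι} {u e : ℤ} (h : (A.seg s).lc e ∈ D) :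
    1 ≤ endWeight A D s u e ∧ (A.Free s u → 3 ≤ endWeight A D s u e) := by
  unfold endWeight freeEnd
  rw [if_pos h]
  constructor
  · split_ifs <;> simp
  · intro hf
    rw [if_pos ⟨hf, h⟩]
    simp

open Classical in
/-- The local form of the corner count: `R`, `L`, `U`, `V` are the arms at a point (right, left,
up, down) and `q₁`, `q₂`, `q₃`, `q₄` the cells around it in counterclockwise order. -/
theorem corner_ineq {R L U V q₁ q₂ q₃ q₄ X : Prop} {E : ℤ}
    (c₁ : ¬ R → (q₁ ↔ q₄)) (c₂ : ¬ L → (q₂ ↔ q₃)) (c₃ : ¬ U → (q₁ ↔ q₂)) (c₄ : ¬ V → (q₄ ↔ q₃))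
    (hE : 0 ≤ E)
    (hEr : R → ¬ L → q₂ → 1 ≤ E ∧ (¬ U → ¬ V → 3 ≤ E))
    (hEl : L → ¬ R → q₁ → 1 ≤ E ∧ (¬ U → ¬ V → 3 ≤ E))
    (hEu : U → ¬ V → q₃ → 1 ≤ E ∧ (¬ R → ¬ L → 3 ≤ E))
    (hEd : V → ¬ U → q₂ → 1 ≤ E ∧ (¬ R → ¬ L → 3 ≤ E))
    (hc : ¬ ((R ∧ ¬ L ∨ L ∧ ¬ R) ∧ (U ∧ ¬ V ∨ V ∧ ¬ U)))
    (hH : R → L → ¬ U → ¬ V → ¬ X) (hV : U → V → ¬ R → ¬ L → ¬ X) :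
    (if X ∧ R ∧ q₄ then (1 : ℤ) else 0) + (if X ∧ U ∧ q₁ then 1 else 0) +
        (if X ∧ L ∧ q₂ then 1 else 0) + (if X ∧ V ∧ q₃ then 1 else 0) ≤
      ((if q₁ then 1 else 0) + (if q₂ then 1 else 0) + (if q₄ then 1 else 0) +
        (if q₃ then 1 else 0)) -
      2 * ((if q₁ ∧ q₄ ∧ ¬ R then 1 else 0) + (if q₂ ∧ q₃ ∧ ¬ L then 1 else 0) +
        (if q₁ ∧ q₂ ∧ ¬ U then 1 else 0) + (if q₄ ∧ q₃ ∧ ¬ V then 1 else 0)) +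
      4 * (if q₁ ∧ q₂ ∧ q₄ ∧ q₃ ∧ ¬ R ∧ ¬ L ∧ ¬ U ∧ ¬ V then 1 else 0) + E := by
  -- All configurations of arms and cells are checked. Equality occurs for a cell between two arms
  -- (1 = 1 + 0), on the flat side of a T-junction (1 = 0 + 1) and around a free end (1 = (4 - 2 ·
  -- 3) + 3).
  by_cases hr : R <;> by_cases hl : L <;> by_cases hu : U <;> by_cases hd : V <;>
    simp only [hr, hl, hu, hd, not_true_eq_false, not_false_eq_true, forall_true_left,
      false_imp_iff, true_and, and_true, false_and, and_false, or_false, false_or, or_self,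
      if_false] at c₁ c₂ c₃ c₄ hEr hEl hEu hEd hc hH hV ⊢ <;>
    clear hr hl hu hd <;>
    by_cases q1 : q₁ <;> by_cases q2 : q₂ <;> by_cases q3 : q₃ <;> by_cases q4 : q₄ <;>
    simp_all <;> split_ifs <;> omega

theorem IsRegion.cornerCount_le [Fintype ι] (hD : A.IsRegion D) {p : ℤ × ℤ}
    (hp : p ∈ Finset.Ioo 0 A.N ×ˢ Finset.Ioo 0 A.N) :
    cornerCount A D p ≤ A.walls.weight D p + endSum A D p := by
  obtain ⟨i, j⟩ := p
  simp only [Finset.mem_product, Finset.mem_Ioo] at hp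
  obtain ⟨⟨hi, hi'⟩, hj, hj'⟩ := hp
  have c1 := hD.closedH i j hi.le hi' hj hj'
  have c2 := hD.closedH (i - 1) j (by omega) (by omega) hj hj'
  have c3 := hD.closedV i j hj.le hj' hi hi'
  have c4 := hD.closedV i (j - 1) (by omega) (by omega) hi hi'
  have hE := endSum_nonneg (A := A) (D := D) (i, j)
  have hEr : A.walls.h i j → ¬ A.walls.h (i - 1) j → (i - 1, j) ∈ D →
      1 ≤ endSum A D (i, j) ∧
      (¬ A.walls.v i j → ¬ A.walls.v i (j - 1) → 3 ≤ endSum A D (i, j)) := by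
    intro h h' hq
    obtain ⟨s, h1, h2, h3⟩ := exists_end_right h h'
    have e := endWeight_of_mem (A := A) (D := D) (s := s) (u := (A.seg s).lo) (h3 ▸ hq)
    have l := le_endSum_lo (A := A) (D := D) h2
    exact ⟨e.1.trans l, fun k k' => (e.2 (free_of_arms le_rfl (A.seg s).lt.le h2
      ⟨fun _ => ⟨k, k'⟩, fun h => by rw [h1] at h; cases h⟩)).trans l⟩
  have hEl : A.walls.h (i - 1) j → ¬ A.walls.h i j → (i, j) ∈ D →
      1 ≤ endSum A D (i, j) ∧
      (¬ A.walls.v i j → ¬ A.walls.v i (j - 1) → 3 ≤ endSum A D (i, j)) := by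
    intro h h' hq
    obtain ⟨s, h1, h2, h3⟩ := exists_end_left h h'
    have e := endWeight_of_mem (A := A) (D := D) (s := s) (u := (A.seg s).hi) (h3 ▸ hq)
    have l := le_endSum_hi (A := A) (D := D) h2
    exact ⟨e.1.trans l, fun k k' => (e.2 (free_of_arms (A.seg s).lt.le le_rfl h2
      ⟨fun _ => ⟨k, k'⟩, fun h => by rw [h1] at h; cases h⟩)).trans l⟩
  have hEu : A.walls.v i j → ¬ A.walls.v i (j - 1) → (i - 1, j - 1) ∈ D →
      1 ≤ endSum A D (i, j) ∧
      (¬ A.walls.h i j → ¬ A.walls.h (i - 1) j → 3 ≤ endSum A D (i, j)) := by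
    intro h h' hq
    obtain ⟨s, h1, h2, h3⟩ := exists_end_up h h'
    have e := endWeight_of_mem (A := A) (D := D) (s := s) (u := (A.seg s).lo) (h3 ▸ hq)
    have l := le_endSum_lo (A := A) (D := D) h2
    exact ⟨e.1.trans l, fun k k' => (e.2 (free_of_arms le_rfl (A.seg s).lt.le h2
      ⟨fun h => (by rw [h1] at h; cases h), fun _ => ⟨k, k'⟩⟩)).trans l⟩
  have hEd : A.walls.v i (j - 1) → ¬ A.walls.v i j → (i - 1, j) ∈ D →
      1 ≤ endSum A D (i, j) ∧
      (¬ A.walls.h i j → ¬ A.walls.h (i - 1) j → 3 ≤ endSum A D (i, j)) := by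
    intro h h' hq
    obtain ⟨s, h1, h2, h3⟩ := exists_end_down h h'
    have e := endWeight_of_mem (A := A) (D := D) (s := s) (u := (A.seg s).hi) (h3 ▸ hq)
    have l := le_endSum_hi (A := A) (D := D) h2
    exact ⟨e.1.trans l, fun k k' => (e.2 (free_of_arms (A.seg s).lt.le le_rfl h2
      ⟨fun h => (by rw [h1] at h; cases h), fun _ => ⟨k, k'⟩⟩)).trans l⟩
  have hc := not_corner (A := A) (i := i) (j := j)
  have hH := not_isVertex_of_h (A := A) (i := i) (j := j)
  have hV := not_isVertex_of_v (A := A) (i := i) (j := j)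
  have := corner_ineq c1 c2 c3 c4 hE hEr hEl hEu hEd hc hH hV
  refine le_trans (le_of_eq ?_) (this.trans (le_of_eq ?_))
  · simp only [cornerCount]
    congr
  · simp only [weight]
    congr! 4 <;> first | simp [mem_openP] | (congr! 4 <;> simp [mem_openH, mem_openV])

-- Parallel segments share no grid point, so a starting edge is determined by its direction and its
-- starting point; the disjoint sum records the direction.
open Classical in
theorem sum_starts_le [Fintype ι] (A : GridArrangement ι) (D : Finset (ℤ × ℤ)) :
    ∑ s, ((Finset.Ico (A.seg s).lo (A.seg s).hi).filter fun u =>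
        A.IsVertexOn s u ∧ (A.seg s).rc u ∈ D).card ≤
      ((Finset.Ioo 0 A.N ×ˢ Finset.Ioo 0 A.N).filter fun p : ℤ × ℤ =>
        A.IsVertex p ∧ A.walls.h p.1 p.2 ∧ (p.1, p.2 - 1) ∈ D).card +
      ((Finset.Ioo 0 A.N ×ˢ Finset.Ioo 0 A.N).filter fun p : ℤ × ℤ =>
        A.IsVertex p ∧ A.walls.v p.1 p.2 ∧ (p.1, p.2) ∈ D).card := by
  rw [← Finset.card_sigma, ← Finset.card_disjSum]
  refine Finset.card_le_card_of_injOn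
    (fun x => if (A.seg x.1).vert then Sum.inr ((A.seg x.1).pos x.2)
      else Sum.inl ((A.seg x.1).pos x.2)) ?_ ?_
  · rintro ⟨s, u⟩ hx
    simp only [Finset.coe_sigma, Finset.coe_univ, Set.mem_sigma_iff, Set.mem_univ, true_and,
      Finset.coe_filter, Set.mem_ofPred_eq, Finset.mem_Ico] at hx
    obtain ⟨⟨h1, h2⟩, h3, h4⟩ := hx
    have hb := mem_box (A := A) ⟨u, h1, h2.le, rfl⟩
    have hv : A.IsVertex ((A.seg s).pos u) := ⟨s, u, h1, h2.le, rfl, h3⟩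
    cases hs : (A.seg s).vert with
    | false =>
      simp only [GridSeg.pos, GridSeg.rc, hs, Bool.false_eq_true, if_false] at hb hv h4 ⊢
      simp only [Finset.mem_coe, Finset.inl_mem_disjSum, Finset.mem_filter, Finset.mem_product,
        Finset.mem_Ioo]
      exact ⟨by omega, hv, ⟨s, hs, rfl, h1, h2⟩, h4⟩
    | true =>
      simp only [GridSeg.pos, GridSeg.rc, hs, if_true] at hb hv h4 ⊢
      simp only [Finset.mem_coe, Finset.inr_mem_disjSum, Finset.mem_filter, Finset.mem_product,
        Finset.mem_Ioo]
      exact ⟨by omega, hv, ⟨s, hs, rfl, h1, h2⟩, h4⟩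
  · rintro ⟨s, u⟩ hx ⟨t, w⟩ hy h
    simp only [Finset.coe_sigma, Finset.coe_univ, Set.mem_sigma_iff, Set.mem_univ, true_and,
      Finset.coe_filter, Set.mem_ofPred_eq, Finset.mem_Ico] at hx hy
    have key : (A.seg s).vert = (A.seg t).vert ∧ (A.seg s).pos u = (A.seg t).pos w := by
      cases hs : (A.seg s).vert <;> cases ht : (A.seg t).vert <;> simp [hs, ht] at h ⊢ <;> exact h
    obtain rfl := A.parallel s t _ key.1 ⟨u, hx.1.1, hx.1.2.le, rfl⟩
      ⟨w, hy.1.1, hy.1.2.le, key.2.symm⟩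
    obtain rfl := GridSeg.pos_injective _ key.2
    rfl

open Classical in
theorem sum_ends_le [Fintype ι] (A : GridArrangement ι) (D : Finset (ℤ × ℤ)) :
    ∑ s, ((Finset.Ioc (A.seg s).lo (A.seg s).hi).filter fun u =>
        A.IsVertexOn s u ∧ (A.seg s).lc (u - 1) ∈ D).card ≤
      ((Finset.Ioo 0 A.N ×ˢ Finset.Ioo 0 A.N).filter fun p : ℤ × ℤ =>
        A.IsVertex p ∧ A.walls.h (p.1 - 1) p.2 ∧ (p.1 - 1, p.2) ∈ D).card +
      ((Finset.Ioo 0 A.N ×ˢ Finset.Ioo 0 A.N).filter fun p : ℤ × ℤ =>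
        A.IsVertex p ∧ A.walls.v p.1 (p.2 - 1) ∧ (p.1 - 1, p.2 - 1) ∈ D).card := by
  rw [← Finset.card_sigma, ← Finset.card_disjSum]
  refine Finset.card_le_card_of_injOn
    (fun x => if (A.seg x.1).vert then Sum.inr ((A.seg x.1).pos x.2)
      else Sum.inl ((A.seg x.1).pos x.2)) ?_ ?_
  · rintro ⟨s, u⟩ hx
    simp only [Finset.coe_sigma, Finset.coe_univ, Set.mem_sigma_iff, Set.mem_univ, true_and,
      Finset.coe_filter, Set.mem_ofPred_eq, Finset.mem_Ioc] at hx
    obtain ⟨⟨h1, h2⟩, h3, h4⟩ := hx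
    have hb := mem_box (A := A) ⟨u, h1.le, h2, rfl⟩
    have hv : A.IsVertex ((A.seg s).pos u) := ⟨s, u, h1.le, h2, rfl, h3⟩
    cases hs : (A.seg s).vert with
    | false =>
      simp only [GridSeg.pos, GridSeg.lc, hs, Bool.false_eq_true, if_false] at hb hv h4 ⊢
      simp only [Finset.mem_coe, Finset.inl_mem_disjSum, Finset.mem_filter, Finset.mem_product,
        Finset.mem_Ioo]
      exact ⟨by omega, hv, ⟨s, hs, rfl, by omega, by omega⟩, h4⟩
    | true =>
      simp only [GridSeg.pos, GridSeg.lc, hs, if_true] at hb hv h4 ⊢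
      simp only [Finset.mem_coe, Finset.inr_mem_disjSum, Finset.mem_filter, Finset.mem_product,
        Finset.mem_Ioo]
      exact ⟨by omega, hv, ⟨s, hs, rfl, by omega, by omega⟩, h4⟩
  · rintro ⟨s, u⟩ hx ⟨t, w⟩ hy h
    simp only [Finset.coe_sigma, Finset.coe_univ, Set.mem_sigma_iff, Set.mem_univ, true_and,
      Finset.coe_filter, Set.mem_ofPred_eq, Finset.mem_Ioc] at hx hy
    have key : (A.seg s).vert = (A.seg t).vert ∧ (A.seg s).pos u = (A.seg t).pos w := by
      cases hs : (A.seg s).vert <;> cases ht : (A.seg t).vert <;> simp [hs, ht] at h ⊢ <;> exact h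
    obtain rfl := A.parallel s t _ key.1 ⟨u, hx.1.1.le, hx.1.2, rfl⟩
      ⟨w, hy.1.1.le, hy.1.2, key.2.symm⟩
    obtain rfl := GridSeg.pos_injective _ key.2
    rfl

theorem sum_endSum_le [Fintype ι] (A : GridArrangement ι) (D B : Finset (ℤ × ℤ)) :
    ∑ p ∈ B, endSum A D p ≤ ∑ s, (endWeight A D s (A.seg s).lo ((A.seg s).lo - 1) +
      endWeight A D s (A.seg s).hi (A.seg s).hi) := by
  simp only [endSum]
  rw [Finset.sum_comm]
  refine Finset.sum_le_sum fun s _ => ?_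
  rw [Finset.sum_add_distrib, Finset.sum_ite_eq, Finset.sum_ite_eq]
  have h1 := endWeight_nonneg (A := A) (D := D) s (A.seg s).lo ((A.seg s).lo - 1)
  have h2 := endWeight_nonneg (A := A) (D := D) s (A.seg s).hi (A.seg s).hi
  split_ifs <;> omega

open Classical in
/-- The number of ends of `s` beyond which the region lies. -/
noncomputable def facing (A : GridArrangement ι) (D : Finset (ℤ × ℤ)) (s : ι) : ℤ :=
  (if (A.seg s).lc ((A.seg s).lo - 1) ∈ D then 1 else 0) +
    (if (A.seg s).lc (A.seg s).hi ∈ D then 1 else 0)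

theorem facing_le (s : ι) : facing A D s ≤ 2 := by
  unfold facing
  split_ifs <;> simp

/-- Edges plus free ends are at most the corners, and corners are at most weight plus end weights.
Passing to `facing` uses that a free end counted by `freeEnd` has the region beyond it. -/
theorem IsRegion.sum_card_edgesOn_le [Fintype ι] (hD : A.IsRegion D)
    (hs : ∀ s, ∃ u, (A.seg s).lo ≤ u ∧ u ≤ (A.seg s).hi ∧ ¬ A.Free s u) :
    ((∑ s, (A.edgesOn D s).card : ℕ) : ℤ) ≤
      ∑ p ∈ Finset.Ioo 0 A.N ×ˢ Finset.Ioo 0 A.N, A.walls.weight D p + 2 * ∑ s, facing A D s := by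
  classical
  have h1 : ∑ s, ((A.edgesOn D s).card + (freeEnd A D s (A.seg s).lo ((A.seg s).lo - 1) +
      freeEnd A D s (A.seg s).hi (A.seg s).hi)) ≤ _ :=
    Finset.sum_le_sum fun s _ => hD.card_edgesOn_add_le s (hs s)
  rw [Finset.sum_add_distrib, Finset.sum_add_distrib (f := fun s => Finset.card _)] at h1
  have h2 := h1.trans (add_le_add (sum_starts_le A D) (sum_ends_le A D))
  have h3 : ∑ p ∈ Finset.Ioo 0 A.N ×ˢ Finset.Ioo 0 A.N, cornerCount A D p ≤
      ∑ p ∈ Finset.Ioo 0 A.N ×ˢ Finset.Ioo 0 A.N, (A.walls.weight D p + endSum A D p) :=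
    Finset.sum_le_sum fun p hp => hD.cornerCount_le hp
  rw [Finset.sum_add_distrib] at h3
  have h4 := h3.trans (add_le_add_right (sum_endSum_le A D _) _)
  simp only [cornerCount, Finset.sum_add_distrib, Finset.sum_boole] at h4
  -- With `f` for a facing end and `e` for a free facing end, the end weight is `f + 2e`, and `e ≤
  -- f` gives `f + 2e ≤ 2f + e`.
  have h5 : ∑ s, (endWeight A D s (A.seg s).lo ((A.seg s).lo - 1) +
      endWeight A D s (A.seg s).hi (A.seg s).hi) ≤
      2 * ∑ s, facing A D s + ((∑ s, (freeEnd A D s (A.seg s).lo ((A.seg s).lo - 1) +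
      freeEnd A D s (A.seg s).hi (A.seg s).hi) : ℕ) : ℤ) := by
    rw [Finset.mul_sum, Nat.cast_sum, ← Finset.sum_add_distrib]
    refine Finset.sum_le_sum fun s _ => ?_
    simp only [endWeight, facing, freeEnd]
    split_ifs <;> simp_all
  rw [Finset.sum_add_distrib] at h5
  simp only [Prod.mk.eta] at h2 h4
  zify at h2 h5 ⊢
  linarith

/-- The discrete form of the bound on the number of edges of a face. -/
theorem IsRegion.sum_card_edgesOn_le_four_mul [Fintype ι] [Nonempty ι] (hD : A.IsRegion D)
    (hs : ∀ s, ∃ u, (A.seg s).lo ≤ u ∧ u ≤ (A.seg s).hi ∧ ¬ A.Free s u) :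
    ∑ s, (A.edgesOn D s).card + 4 ≤ 4 * Fintype.card ι := by
  classical
  have h1 := hD.sum_card_edgesOn_le hs
  by_cases h0 : (0, 0) ∈ D
  · have h2 := hD.sum_inner_weight_le_of_frame h0
    have h3 : ∑ s, facing A D s ≤ ∑ _s : ι, 2 := Finset.sum_le_sum fun s _ => facing_le s
    simp only [Finset.sum_const, Finset.card_univ, nsmul_eq_mul] at h3
    omega
  · have h2 := hD.sum_inner_weight_le
    by_cases hne : D.Nonempty
    · obtain ⟨⟨i, j⟩, hij, hmin⟩ := D.exists_min_image Prod.fst hne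
      obtain ⟨⟨i', j'⟩, hij', hmax⟩ := D.exists_max_image Prod.fst hne
      have b := hD.box _ hij
      have b' := hD.box _ hij'
      simp only at b b' hmin hmax
      have hi : 0 < i := by
        by_contra hi
        refine h0 ((hD.frame_mem_iff b.1 b.2.1 b.2.2.1 b.2.2.2 (by omega)).1 hij)
      have hi' : i' + 1 < A.N := by
        by_contra hi'
        refine h0 ((hD.frame_mem_iff b'.1 b'.2.1 b'.2.2.1 b'.2.2.2 (by omega)).1 hij')
      have hv : A.walls.v i j := by
        by_contra hv
        have := hmin _ ((hD.closedV i j b.2.2.1 b.2.2.2 hi b.2.1 hv).1 hij)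
        simp only at this
        omega
      have hv' : A.walls.v (i' + 1) j' := by
        by_contra hv
        have := hmax _ ((hD.closedV (i' + 1) j' b'.2.2.1 b'.2.2.2 (by omega) hi' hv).2
          (by rwa [add_sub_cancel_right]))
        simp only at this
        omega
      obtain ⟨s, s1, s2, -⟩ := hv
      obtain ⟨t, t1, t2, -⟩ := hv'
      have hst : s ≠ t := by
        rintro rfl
        have := hmin _ hij'
        simp only at this
        omega
      have fs : facing A D s = 0 := by
        have : ∀ u, (A.seg s).lc u ∉ D := by
          intro u hu
          have := hmin _ hu
          simp only [GridSeg.lc, s1, s2, if_true] at this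
          omega
        simp [facing, this]
      have ft : facing A D t = 0 := by
        have : ∀ u, (A.seg t).rc u ∉ D := by
          intro u hu
          have := hmax _ hu
          simp only [GridSeg.rc, t1, t2, if_true] at this
          omega
        simp [facing, this, hD.lc_iff_rc_hi, hD.lc_iff_rc_lo]
      have h3 : ∑ r ∈ {s, t}, (2 - facing A D r) ≤ ∑ r, (2 - facing A D r) :=
        Finset.sum_le_sum_of_subset_of_nonneg (Finset.subset_univ _) fun r _ _ => by
          have := facing_le (A := A) (D := D) r
          omega
      rw [Finset.sum_pair hst, fs, ft, Finset.sum_sub_distrib] at h3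
      simp only [Finset.sum_const, Finset.card_univ, nsmul_eq_mul] at h3
      omega
    · rw [Finset.not_nonempty_iff_eq_empty] at hne
      subst hne
      have := Fintype.card_pos (α := ι)
      simp [edgesOn]
      omega

end GridArrangement

/-! ### Strips of the real line between consecutive grid coordinates -/

open Topology Filter

/-- The affine parametrization of the vertical or horizontal line with coordinate `c`. -/
def axisLine (vert : Bool) (c : ℝ) : ℝ →ᵃ[ℝ] ℝ × ℝ :=
  if vert then (LinearMap.inr ℝ ℝ ℝ).toAffineMap + AffineMap.const ℝ ℝ (c, 0)
  else (LinearMap.inl ℝ ℝ ℝ).toAffineMap + AffineMap.const ℝ ℝ (0, c)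

theorem axisLine_true (c r : ℝ) : axisLine true c r = (c, r) := by simp [axisLine]

theorem axisLine_false (c r : ℝ) : axisLine false c r = (r, c) := by simp [axisLine]

theorem axisLine_injective (v : Bool) (c : ℝ) : Function.Injective (axisLine v c) := by
  intro r r' h
  cases v <;> simpa [axisLine_true, axisLine_false] using h

namespace GridSeg

/-- The real line that carries `s` when the grid lines have the coordinates `ξ`. -/
noncomputable def param (s : GridSeg) (ξ : ℤ → ℝ) : ℝ →ᵃ[ℝ] ℝ × ℝ := axisLine s.vert (ξ s.line)

/-- The real segment described by `s` when the grid lines have the coordinates `ξ`. -/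
def carrier (s : GridSeg) (ξ : ℤ → ℝ) : Set (ℝ × ℝ) := s.param ξ '' Set.Icc (ξ s.lo) (ξ s.hi)

theorem param_apply (s : GridSeg) (ξ : ℤ → ℝ) (u : ℤ) :
    s.param ξ (ξ u) = (ξ (s.pos u).1, ξ (s.pos u).2) := by
  cases h : s.vert <;> simp [param, pos, h, axisLine_true, axisLine_false]

theorem mem_carrier_of_vert {s : GridSeg} {ξ : ℤ → ℝ} (h : s.vert = true) {p : ℝ × ℝ} :
    p ∈ s.carrier ξ ↔ ξ s.line = p.1 ∧ ξ s.lo ≤ p.2 ∧ p.2 ≤ ξ s.hi := by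
  obtain ⟨x, y⟩ := p
  simp only [carrier, param, h, Set.mem_image, axisLine_true, Set.mem_Icc, Prod.mk.injEq]
  constructor
  · rintro ⟨r, h1, h2, rfl⟩; exact ⟨h2, h1⟩
  · rintro ⟨h1, h2⟩; exact ⟨y, h2, h1, rfl⟩

theorem mem_carrier_of_not_vert {s : GridSeg} {ξ : ℤ → ℝ} (h : s.vert = false) {p : ℝ × ℝ} :
    p ∈ s.carrier ξ ↔ ξ s.line = p.2 ∧ ξ s.lo ≤ p.1 ∧ p.1 ≤ ξ s.hi := by
  obtain ⟨x, y⟩ := p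
  simp only [carrier, param, h, Set.mem_image, axisLine_false, Set.mem_Icc, Prod.mk.injEq]
  constructor
  · rintro ⟨r, h1, rfl, h2⟩; exact ⟨h2, h1⟩
  · rintro ⟨h1, h2⟩; exact ⟨x, h2, rfl, h1⟩

end GridSeg

/-- `y` lies in the closed strip number `i` between the lines `ξ i` and `ξ (i + 1)`, where the
strips `0` and `N - 1` are unbounded. -/
def InStrip (ξ : ℤ → ℝ) (N : ℤ) (y : ℝ) (i : ℤ) : Prop :=
  0 ≤ i ∧ i < N ∧ (i = 0 ∨ ξ i ≤ y) ∧ (i = N - 1 ∨ y ≤ ξ (i + 1))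

theorem exists_inStrip {ξ : ℤ → ℝ} {N : ℤ} (hN : 0 < N) (y : ℝ) : ∃ i, InStrip ξ N y i := by
  classical
  obtain ⟨i, hi, hmax⟩ := ((Finset.Ico 0 N).filter fun i => i = 0 ∨ ξ i ≤ y).exists_max_image id
    ⟨0, by simp [hN]⟩
  simp only [Finset.mem_filter, Finset.mem_Ico, id] at hi hmax
  refine ⟨i, hi.1.1, hi.1.2, hi.2, ?_⟩
  by_contra! h
  have := hmax (i + 1) ⟨⟨by omega, by omega⟩, Or.inr h.2.le⟩
  omega

/-- The strips are closed and finite in number, so a point close to `y` only lies in strips that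
already contain `y`. -/
theorem eventually_inStrip (ξ : ℤ → ℝ) (N : ℤ) (y : ℝ) :
    ∀ᶠ y' in 𝓝 y, ∀ i, InStrip ξ N y' i → InStrip ξ N y i := by
  have h : ∀ i ∈ Finset.Ico 0 N, ∀ᶠ y' in 𝓝 y, InStrip ξ N y' i → InStrip ξ N y i := by
    intro i _
    have h1 : ∀ᶠ y' in 𝓝 y, (i = 0 ∨ ξ i ≤ y') → (i = 0 ∨ ξ i ≤ y) := by
      by_cases h : i = 0 ∨ ξ i ≤ y
      · exact Eventually.of_forall fun _ _ => h
      · push Not at h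
        filter_upwards [eventually_lt_nhds h.2] with y' hy' h'
        rcases h' with h' | h'
        · exact Or.inl h'
        · exact absurd hy' (not_lt.2 h')
    have h2 : ∀ᶠ y' in 𝓝 y, (i = N - 1 ∨ y' ≤ ξ (i + 1)) → (i = N - 1 ∨ y ≤ ξ (i + 1)) := by
      by_cases h : i = N - 1 ∨ y ≤ ξ (i + 1)
      · exact Eventually.of_forall fun _ _ => h
      · push Not at h
        filter_upwards [eventually_gt_nhds h.2] with y' hy' h'
        rcases h' with h' | h'
        · exact Or.inl h'
        · exact absurd hy' (not_lt.2 h')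
    filter_upwards [h1, h2] with y' h1 h2 h
    exact ⟨h.1, h.2.1, h1 h.2.2.1, h2 h.2.2.2⟩
  filter_upwards [(Finset.eventually_all _).2 h] with y' h' i hi
  exact h' i (Finset.mem_Ico.2 ⟨hi.1, hi.2.1⟩) hi

/-- Two strips with a common point are equal or adjacent. -/
theorem InStrip.lt_cases {ξ : ℤ → ℝ} (hξ : StrictMono ξ) {N : ℤ} {y : ℝ} {i i' : ℤ}
    (h : InStrip ξ N y i) (h' : InStrip ξ N y i') (hlt : i < i') : i' = i + 1 ∧ y = ξ i' := by
  have h1 : y ≤ ξ (i + 1) := h.2.2.2.resolve_left (by have := h'.2.1; omega)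
  have h2 : ξ i' ≤ y := h'.2.2.1.resolve_left (by have := h.1; omega)
  have h3 : i' ≤ i + 1 := hξ.le_iff_le.1 (h2.trans h1)
  have h4 : i' = i + 1 := by omega
  exact ⟨h4, le_antisymm (by rwa [h4]) h2⟩

theorem inStrip_mid {ξ : ℤ → ℝ} (hξ : StrictMono ξ) {N i : ℤ} (h0 : 0 ≤ i) (h1 : i < N) :
    InStrip ξ N ((ξ i + ξ (i + 1)) / 2) i := by
  have := hξ (show i < i + 1 by omega)
  exact ⟨h0, h1, Or.inr (by linarith), Or.inr (by linarith)⟩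

theorem inStrip_mid_iff {ξ : ℤ → ℝ} (hξ : StrictMono ξ) {N i j : ℤ} (h0 : 0 ≤ i) (h1 : i < N)
    (h : InStrip ξ N ((ξ i + ξ (i + 1)) / 2) j) : j = i := by
  have h2 := hξ (show i < i + 1 by omega)
  rcases lt_trichotomy i j with h3 | h3 | h3
  · have := (inStrip_mid hξ h0 h1).lt_cases hξ h h3
    rw [this.1] at this
    linarith [this.2]
  · exact h3.symm
  · have := h.lt_cases hξ (inStrip_mid hξ h0 h1) h3
    linarith [this.2]

theorem inStrip_line {ξ : ℤ → ℝ} (hξ : StrictMono ξ) {N i : ℤ} (h0 : 0 < i) (h1 : i < N) :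
    InStrip ξ N (ξ i) i ∧ InStrip ξ N (ξ i) (i - 1) := by
  have := hξ (show i < i + 1 by omega)
  have h3 := hξ (show i - 1 < i by omega)
  exact ⟨⟨h0.le, h1, Or.inr le_rfl, Or.inr this.le⟩, by omega, by omega, Or.inr h3.le,
    Or.inr (by rw [sub_add_cancel])⟩

theorem inStrip_line_iff {ξ : ℤ → ℝ} (hξ : StrictMono ξ) {N i j : ℤ} (h0 : 0 < i) (h1 : i < N)
    (h : InStrip ξ N (ξ i) j) : j = i ∨ j = i - 1 := by
  rcases lt_trichotomy i j with h3 | h3 | h3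
  · have := (inStrip_line hξ h0 h1).1.lt_cases hξ h h3
    have := hξ.injective this.2
    omega
  · exact Or.inl h3.symm
  · have := h.lt_cases hξ (inStrip_line hξ h0 h1).1 h3
    omega

theorem mem_connectedComponentIn_iff_of_isPreconnected {X : Type*} [TopologicalSpace X]
    {U K : Set X} {x p q : X} (hK : IsPreconnected K) (hKU : K ⊆ U) (hp : p ∈ K) (hq : q ∈ K) :
    p ∈ connectedComponentIn U x ↔ q ∈ connectedComponentIn U x := by
  constructor
  · intro h
    rw [connectedComponentIn_eq h]
    exact hK.subset_connectedComponentIn hp hKU hq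
  · intro h
    rw [connectedComponentIn_eq h]
    exact hK.subset_connectedComponentIn hq hKU hp

/-! ### From a component of the complement to a region of cells -/

namespace GridArrangement

variable {ι : Type*} (A : GridArrangement ι) (ξ : ℤ → ℝ)

/-- The union of the segments of the arrangement. -/
def union : Set (ℝ × ℝ) := ⋃ s, (A.seg s).carrier ξ

/-- The centre of a grid cell. -/
noncomputable def center (c : ℤ × ℤ) : ℝ × ℝ :=
  ((ξ c.1 + ξ (c.1 + 1)) / 2, (ξ c.2 + ξ (c.2 + 1)) / 2)

variable {A ξ}

theorem strict_not_mem_union (hξ : StrictMono ξ) {p : ℝ × ℝ} {c : ℤ × ℤ}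
    (h1 : c.1 = 0 ∨ ξ c.1 < p.1) (h2 : c.1 = A.N - 1 ∨ p.1 < ξ (c.1 + 1))
    (h3 : c.2 = 0 ∨ ξ c.2 < p.2) (h4 : c.2 = A.N - 1 ∨ p.2 < ξ (c.2 + 1)) : p ∉ A.union ξ := by
  simp only [union, Set.mem_iUnion, not_exists]
  intro s hs
  have a1 := A.line_pos s
  have a2 := A.line_lt s
  cases hv : (A.seg s).vert with
  | true =>
    rw [GridSeg.mem_carrier_of_vert hv] at hs
    rw [← hs.1, hξ.lt_iff_lt] at h1 h2
    omega
  | false =>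
    rw [GridSeg.mem_carrier_of_not_vert hv] at hs
    rw [← hs.1, hξ.lt_iff_lt] at h3 h4
    omega

/-- Every point of the segment other than `p` lies strictly inside the cell, where no segment of the
arrangement passes. So a point of the complement belongs to the same component as the centre of any
closed cell containing it. -/
theorem segment_center_subset (hξ : StrictMono ξ) {p : ℝ × ℝ} (hp : p ∉ A.union ξ) {c : ℤ × ℤ}
    (h1 : InStrip ξ A.N p.1 c.1) (h2 : InStrip ξ A.N p.2 c.2) :
    segment ℝ p (center ξ c) ⊆ (A.union ξ)ᶜ := by
  rintro q ⟨a, b, ha, hb, hab, rfl⟩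
  rcases hb.eq_or_lt with rfl | hb
  · have : a = 1 := by linarith
    simpa [this] using hp
  · have key : ∀ {x y z : ℝ}, x ≤ y → x < z → x < a * y + b * z := by
      intro x y z hy hz
      have e1 := mul_le_mul_of_nonneg_left hy ha
      have e2 := mul_lt_mul_of_pos_left hz hb
      have e3 : x = a * x + b * x := by rw [← add_mul, hab, one_mul]
      linarith
    have key' : ∀ {x y z : ℝ}, y ≤ x → z < x → a * y + b * z < x := by
      intro x y z hy hz
      have e1 := mul_le_mul_of_nonneg_left hy ha
      have e2 := mul_lt_mul_of_pos_left hz hb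
      have e3 : x = a * x + b * x := by rw [← add_mul, hab, one_mul]
      linarith
    have m1 := hξ (show c.1 < c.1 + 1 by omega)
    have m2 := hξ (show c.2 < c.2 + 1 by omega)
    exact strict_not_mem_union hξ (c := c)
      (h1.2.2.1.imp_right fun h => key h (by simp only [center]; linarith))
      (h1.2.2.2.imp_right fun h => key' h (by simp only [center]; linarith))
      (h2.2.2.1.imp_right fun h => key h (by simp only [center]; linarith))
      (h2.2.2.2.imp_right fun h => key' h (by simp only [center]; linarith))

variable {x : ℝ × ℝ}

theorem mem_iff_center_mem (hξ : StrictMono ξ) {p : ℝ × ℝ} (hp : p ∉ A.union ξ) {c : ℤ × ℤ}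
    (h1 : InStrip ξ A.N p.1 c.1) (h2 : InStrip ξ A.N p.2 c.2) :
    p ∈ connectedComponentIn (A.union ξ)ᶜ x ↔
      center ξ c ∈ connectedComponentIn (A.union ξ)ᶜ x :=
  mem_connectedComponentIn_iff_of_isPreconnected (convex_segment _ _).isPreconnected
    (segment_center_subset hξ hp h1 h2) (left_mem_segment _ _ _) (right_mem_segment _ _ _)

open Classical in
/-- The cells of the box whose centre belongs to the component of `x`. -/
noncomputable def region (A : GridArrangement ι) (ξ : ℤ → ℝ) (x : ℝ × ℝ) : Finset (ℤ × ℤ) :=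
  (Finset.Ico 0 A.N ×ˢ Finset.Ico 0 A.N).filter fun c =>
    center ξ c ∈ connectedComponentIn (A.union ξ)ᶜ x

theorem mem_region {c : ℤ × ℤ} : c ∈ region A ξ x ↔
    (0 ≤ c.1 ∧ c.1 < A.N) ∧ (0 ≤ c.2 ∧ c.2 < A.N) ∧
      center ξ c ∈ connectedComponentIn (A.union ξ)ᶜ x := by
  simp [region, and_assoc]

theorem mem_region_of_inStrip (hξ : StrictMono ξ) {p : ℝ × ℝ}
    (hp : p ∈ connectedComponentIn (A.union ξ)ᶜ x) {c : ℤ × ℤ}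
    (h1 : InStrip ξ A.N p.1 c.1) (h2 : InStrip ξ A.N p.2 c.2) : c ∈ region A ξ x :=
  mem_region.2 ⟨⟨h1.1, h1.2.1⟩, ⟨h2.1, h2.2.1⟩,
    (mem_iff_center_mem hξ (connectedComponentIn_subset _ _ hp) h1 h2).1 hp⟩

theorem region_closedH (hξ : StrictMono ξ) {i j : ℤ} (h0 : 0 ≤ i) (h1 : i < A.N) (h2 : 0 < j)
    (h3 : j < A.N) (h : ¬ A.walls.h i j) : (i, j) ∈ region A ξ x ↔ (i, j - 1) ∈ region A ξ x := by
  -- The midpoint of an unblocked unit edge lies in both adjacent closed cells and thus ties their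
  -- centres to the same component.
  have hm : ((ξ i + ξ (i + 1)) / 2, ξ j) ∉ A.union ξ := by
    simp only [union, Set.mem_iUnion, not_exists]
    intro s hs
    have m := hξ (show i < i + 1 by omega)
    cases hv : (A.seg s).vert with
    | true =>
      rw [GridSeg.mem_carrier_of_vert hv] at hs
      have e1 := hξ.lt_iff_lt.1 (show ξ i < ξ (A.seg s).line by rw [hs.1]; simp only; linarith)
      have e2 := hξ.lt_iff_lt.1 (show ξ (A.seg s).line < ξ (i + 1) by rw [hs.1]; simp only; linarith)
      omega
    | false =>
      rw [GridSeg.mem_carrier_of_not_vert hv] at hs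
      simp only at hs
      have e1 := hξ.lt_iff_lt.1 (show ξ (A.seg s).lo < ξ (i + 1) by linarith)
      have e2 := hξ.lt_iff_lt.1 (show ξ i < ξ (A.seg s).hi by linarith)
      exact h ⟨s, hv, hξ.injective hs.1, by omega, e2⟩
  have k1 := mem_iff_center_mem (x := x) hξ hm (c := (i, j)) (inStrip_mid hξ h0 h1)
    (inStrip_line hξ h2 h3).1
  have k2 := mem_iff_center_mem (x := x) hξ hm (c := (i, j - 1)) (inStrip_mid hξ h0 h1)
    (inStrip_line hξ h2 h3).2
  rw [mem_region, mem_region, ← k1, ← k2]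
  refine and_congr_right fun _ => and_congr_left fun _ => ?_
  simp only
  omega

theorem region_closedV (hξ : StrictMono ξ) {i j : ℤ} (h0 : 0 ≤ j) (h1 : j < A.N) (h2 : 0 < i)
    (h3 : i < A.N) (h : ¬ A.walls.v i j) : (i, j) ∈ region A ξ x ↔ (i - 1, j) ∈ region A ξ x := by
  have hm : (ξ i, (ξ j + ξ (j + 1)) / 2) ∉ A.union ξ := by
    simp only [union, Set.mem_iUnion, not_exists]
    intro s hs
    have m := hξ (show j < j + 1 by omega)
    cases hv : (A.seg s).vert with
    | false =>
      rw [GridSeg.mem_carrier_of_not_vert hv] at hs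
      have e1 := hξ.lt_iff_lt.1 (show ξ j < ξ (A.seg s).line by rw [hs.1]; simp only; linarith)
      have e2 := hξ.lt_iff_lt.1 (show ξ (A.seg s).line < ξ (j + 1) by rw [hs.1]; simp only; linarith)
      omega
    | true =>
      rw [GridSeg.mem_carrier_of_vert hv] at hs
      simp only at hs
      have e1 := hξ.lt_iff_lt.1 (show ξ (A.seg s).lo < ξ (j + 1) by linarith)
      have e2 := hξ.lt_iff_lt.1 (show ξ j < ξ (A.seg s).hi by linarith)
      exact h ⟨s, hv, hξ.injective hs.1, by omega, e2⟩
  have k1 := mem_iff_center_mem (x := x) hξ hm (c := (i, j)) (inStrip_line hξ h2 h3).1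
    (inStrip_mid hξ h0 h1)
  have k2 := mem_iff_center_mem (x := x) hξ hm (c := (i - 1, j)) (inStrip_line hξ h2 h3).2
    (inStrip_mid hξ h0 h1)
  rw [mem_region, mem_region, ← k1, ← k2]
  refine and_congr_left fun _ => ?_
  simp only
  omega

open Relation Walls

/-- Two cells around a point of the component are joined across unblocked edges. -/
theorem eqvGen_of_inStrip (hξ : StrictMono ξ) {p : ℝ × ℝ}
    (hp : p ∈ connectedComponentIn (A.union ξ)ᶜ x) {c c' : ℤ × ℤ}
    (h1 : InStrip ξ A.N p.1 c.1) (h2 : InStrip ξ A.N p.2 c.2)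
    (h1' : InStrip ξ A.N p.1 c'.1) (h2' : InStrip ξ A.N p.2 c'.2) :
    EqvGen (Step (A.walls.openH (region A ξ x)) (A.walls.openV (region A ξ x))) c c' := by
  have hpU : ∀ s, p ∉ (A.seg s).carrier ξ := by
    have := connectedComponentIn_subset _ _ hp
    simpa [union] using this
  have hbd : ∀ {y : ℝ} {i : ℤ} {s : ι}, InStrip ξ A.N y i → (A.seg s).lo ≤ i → i < (A.seg s).hi →
      ξ (A.seg s).lo ≤ y ∧ y ≤ ξ (A.seg s).hi := by
    intro y i s hi hlo hhi
    have a3 := A.lo_pos s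
    have a4 := A.hi_lt s
    exact ⟨(hξ.monotone hlo).trans (hi.2.2.1.resolve_left (by omega)),
      (hi.2.2.2.resolve_left (by omega)).trans (hξ.monotone (by omega))⟩
  have stepV : ∀ {i i' j : ℤ}, InStrip ξ A.N p.1 i → InStrip ξ A.N p.1 i' →
      InStrip ξ A.N p.2 j → i < i' → EqvGen (Step (A.walls.openH (region A ξ x))
        (A.walls.openV (region A ξ x))) (i', j) (i, j) := by
    intro i i' j hi hi' hj hlt
    obtain ⟨rfl, hy⟩ := hi.lt_cases hξ hi' hlt
    refine .rel _ _ (Or.inr ⟨mem_openV.2 ⟨mem_region_of_inStrip hξ hp hi' hj, ?_, ?_⟩, by simp⟩)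
    · exact mem_region_of_inStrip hξ hp (by simpa using hi) hj
    · rintro ⟨s, s1, s2, s3, s4⟩
      exact hpU s ((GridSeg.mem_carrier_of_vert s1).2 ⟨by rw [hy, s2], hbd hj s3 s4⟩)
  have stepH : ∀ {i j j' : ℤ}, InStrip ξ A.N p.2 j → InStrip ξ A.N p.2 j' →
      InStrip ξ A.N p.1 i → j < j' → EqvGen (Step (A.walls.openH (region A ξ x))
        (A.walls.openV (region A ξ x))) (i, j') (i, j) := by
    intro i j j' hj hj' hi hlt
    obtain ⟨rfl, hy⟩ := hj.lt_cases hξ hj' hlt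
    refine .rel _ _ (Or.inl ⟨mem_openH.2 ⟨mem_region_of_inStrip hξ hp hi hj', ?_, ?_⟩, by simp⟩)
    · exact mem_region_of_inStrip hξ hp hi (by simpa using hj)
    · rintro ⟨s, s1, s2, s3, s4⟩
      exact hpU s ((GridSeg.mem_carrier_of_not_vert s1).2 ⟨by rw [hy, s2], hbd hi s3 s4⟩)
  obtain ⟨i, j⟩ := c
  obtain ⟨i', j'⟩ := c'
  simp only at h1 h2 h1' h2'
  refine .trans _ (i', j) _ ?_ ?_
  · rcases lt_trichotomy i i' with h | rfl | h
    · exact .symm _ _ (stepV h1 h1' h2 h)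
    · exact .refl _
    · exact stepV h1' h1 h2 h
  · rcases lt_trichotomy j j' with h | rfl | h
    · exact .symm _ _ (stepH h2 h2' h1' h)
    · exact .refl _
    · exact stepH h2' h2 h1' h

/-- Connectedness passes from the component to its cells by a local argument: all cells containing
points near `p` contain `p`, and the cells around `p` are joined across edges through `p`, which are
unblocked. `IsPreconnected.induction₂` spreads this over the component. -/
theorem isRegion_region (hξ : StrictMono ξ) : A.IsRegion (region A ξ x) where
  box c hc := by
    have := mem_region.1 hc
    omega
  closedH i j h0 h1 h2 h3 h := region_closedH hξ h0 h1 h2 h3 h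
  closedV i j h0 h1 h2 h3 h := region_closedV hξ h0 h1 h2 h3 h
  conn c hc c' hc' := by
    have hc := mem_region.1 hc
    have hc' := mem_region.1 hc'
    have hN : 0 < A.N := by omega
    have := isPreconnected_connectedComponentIn.induction₂ (s := connectedComponentIn (A.union ξ)ᶜ x)
      (fun p q => ∀ c c' : ℤ × ℤ, InStrip ξ A.N p.1 c.1 → InStrip ξ A.N p.2 c.2 →
        InStrip ξ A.N q.1 c'.1 → InStrip ξ A.N q.2 c'.2 →
        EqvGen (Step (A.walls.openH (region A ξ x)) (A.walls.openV (region A ξ x))) c c')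
      ?_ ?_ ?_ hc.2.2 hc'.2.2
    · exact this c c' (inStrip_mid hξ hc.1.1 hc.1.2) (inStrip_mid hξ hc.2.1.1 hc.2.1.2)
        (inStrip_mid hξ hc'.1.1 hc'.1.2) (inStrip_mid hξ hc'.2.1.1 hc'.2.1.2)
    · intro p hp
      refine Filter.Eventually.filter_mono nhdsWithin_le_nhds ?_
      have e1 := (continuous_fst.tendsto p).eventually (eventually_inStrip ξ A.N p.1)
      have e2 := (continuous_snd.tendsto p).eventually (eventually_inStrip ξ A.N p.2)
      filter_upwards [e1, e2] with q h1 h2 c c' k1 k2 k3 k4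
      exact eqvGen_of_inStrip hξ hp k1 k2 (h1 _ k3) (h2 _ k4)
    · intro p q r _ _ _ h h' c c' k1 k2 k3 k4
      obtain ⟨i, hi⟩ := exists_inStrip (ξ := ξ) hN q.1
      obtain ⟨j, hj⟩ := exists_inStrip (ξ := ξ) hN q.2
      exact .trans _ _ _ (h c (i, j) k1 k2 hi hj) (h' (i, j) c' hi hj k3 k4)
    · intro p q _ _ h c c' k1 k2 k3 k4
      exact .symm _ _ (h c' c k3 k4 k1 k2)

/-- A unit edge of a segment in the closure of the component has a cell of the component
next to it. -/
theorem lc_or_rc_mem_region (hξ : StrictMono ξ) {s : ι} {u : ℤ} (h1 : (A.seg s).lo ≤ u)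
    (h2 : u < (A.seg s).hi)
    (h : (A.seg s).param ξ ((ξ u + ξ (u + 1)) / 2) ∈ closure (connectedComponentIn (A.union ξ)ᶜ x)) :
    (A.seg s).lc u ∈ region A ξ x ∨ (A.seg s).rc u ∈ region A ξ x := by
  have a1 := A.line_pos s
  have a2 := A.line_lt s
  have a3 := A.lo_pos s
  have a4 := A.hi_lt s
  set m := (A.seg s).param ξ ((ξ u + ξ (u + 1)) / 2) with hm
  have e1 := (continuous_fst.tendsto m).eventually (eventually_inStrip ξ A.N m.1)
  have e2 := (continuous_snd.tendsto m).eventually (eventually_inStrip ξ A.N m.2)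
  obtain ⟨q, hq, q1, q2⟩ := ((mem_closure_iff_frequently.1 h).and_eventually (e1.and e2)).exists
  obtain ⟨i, hi⟩ := exists_inStrip (ξ := ξ) (by omega : 0 < A.N) q.1
  obtain ⟨j, hj⟩ := exists_inStrip (ξ := ξ) (by omega : 0 < A.N) q.2
  have hc : (i, j) ∈ region A ξ x := mem_region_of_inStrip hξ hq hi hj
  have k1 := q1 _ hi
  have k2 := q2 _ hj
  cases hv : (A.seg s).vert with
  | true =>
    simp only [hm, GridSeg.param, hv, axisLine_true] at k1 k2
    obtain rfl := inStrip_mid_iff hξ (by omega) (by omega) k2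
    simp only [GridSeg.lc, GridSeg.rc, hv, if_true]
    rcases inStrip_line_iff hξ a1 a2 k1 with rfl | rfl
    · exact Or.inr hc
    · exact Or.inl hc
  | false =>
    simp only [hm, GridSeg.param, hv, axisLine_false] at k1 k2
    obtain rfl := inStrip_mid_iff hξ (by omega) (by omega) k1
    simp only [GridSeg.lc, GridSeg.rc, hv, Bool.false_eq_true, if_false]
    rcases inStrip_line_iff hξ a1 a2 k2 with rfl | rfl
    · exact Or.inl hc
    · exact Or.inr hc

end GridArrangement

/-! ### Representing the real segments on a grid -/

/-- Finitely many reals are among the values of a strictly monotone function on `ℤ`. -/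
theorem exists_strictMono_grid (X : Finset ℝ) (L : ℝ) (hL : ∀ x ∈ X, L < x) :
    -- The bound on `ξ (N - 1)` serves the induction: it lets the next larger value be placed at
    -- index `N`.
    ∃ (ξ : ℤ → ℝ) (N : ℤ), StrictMono ξ ∧ 0 < N ∧
      (∀ a, L < a → (∀ x ∈ X, x < a) → ξ (N - 1) < a) ∧ ∀ x ∈ X, ∃ i, 0 < i ∧ i < N ∧ ξ i = x := by
  induction X using Finset.induction_on_max with
  | empty =>
    refine ⟨fun i => L + i, 1, fun i j h => ?_, one_pos, fun a h _ => by simpa using h, by simp⟩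
    have : (i : ℝ) < j := by exact_mod_cast h
    linarith
  | insert a X ha ih =>
    obtain ⟨ξ, N, hξ, hN, hlast, hX⟩ := ih fun x hx => hL x (Finset.mem_insert_of_mem hx)
    have hNa : ξ (N - 1) < a := hlast a (hL a (Finset.mem_insert_self _ _)) ha
    refine ⟨fun i => if i < N then ξ i else a + ((i - N : ℤ) : ℝ), N + 1, ?_, by omega, ?_, ?_⟩
    · intro i j hij
      simp only
      split_ifs with h1 h2 h2
      · exact hξ hij
      · have h3 : ξ i ≤ ξ (N - 1) := hξ.monotone (by omega)
        have h4 : (0 : ℝ) ≤ ((j - N : ℤ) : ℝ) := by exact_mod_cast (by omega : 0 ≤ j - N)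
        linarith
      · omega
      · have : ((i - N : ℤ) : ℝ) < ((j - N : ℤ) : ℝ) := by exact_mod_cast (by omega : i - N < j - N)
        linarith
    · intro b _ hb
      simpa using hb a (Finset.mem_insert_self _ _)
    · intro x hx
      rcases Finset.mem_insert.1 hx with rfl | hx
      · exact ⟨N, hN, by omega, by simp⟩
      · obtain ⟨i, h1, h2, h3⟩ := hX x hx
        exact ⟨i, h1, by omega, by simp [h2, h3]⟩

namespace GridSeg

theorem image_param_Icc (s : GridSeg) (ξ : ℤ → ℝ) {a b : ℝ} (h : a ≤ b) :
    s.param ξ '' Set.Icc a b = segment ℝ (s.param ξ a) (s.param ξ b) := by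
  rw [← segment_eq_Icc h, image_segment]

theorem param_injective (s : GridSeg) (ξ : ℤ → ℝ) : Function.Injective (s.param ξ) :=
  axisLine_injective _ _

theorem param_mem_carrier {s : GridSeg} {ξ : ℤ → ℝ} {r : ℝ} :
    s.param ξ r ∈ s.carrier ξ ↔ ξ s.lo ≤ r ∧ r ≤ ξ s.hi := by
  rw [carrier, (s.param_injective ξ).mem_set_image, Set.mem_Icc]

theorem carrier_of_mem {s : GridSeg} {ξ : ℤ → ℝ} (hξ : StrictMono ξ) {p : ℤ × ℤ} :
    (ξ p.1, ξ p.2) ∈ s.carrier ξ ↔ s.Mem p := by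
  cases h : s.vert with
  | true => simp [mem_carrier_of_vert h, mem_of_vert h, hξ.injective.eq_iff, hξ.le_iff_le]
  | false => simp [mem_carrier_of_not_vert h, mem_of_not_vert h, hξ.injective.eq_iff, hξ.le_iff_le]

end GridSeg

theorem AxisSegment.exists_gridSeg {ξ : ℤ → ℝ} (hξ : StrictMono ξ) {N : ℤ} (s : AxisSegment)
    (h : ∀ x ∈ ({s.a.1, s.a.2, s.b.1, s.b.2} : Set ℝ), ∃ i, 0 < i ∧ i < N ∧ ξ i = x) :
    ∃ g : GridSeg, (0 < g.line ∧ g.line < N ∧ 0 < g.lo ∧ g.hi < N) ∧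
      s.carrier = g.carrier ξ ∧ s.endpoints = {g.param ξ (ξ g.lo), g.param ξ (ξ g.hi)} := by
  have build : ∀ (v : Bool) (k i j : ℤ), (0 < k ∧ k < N) → (0 < i ∧ i < N) → (0 < j ∧ j < N) →
      axisLine v (ξ k) (ξ i) = s.a → axisLine v (ξ k) (ξ j) = s.b →
      ∃ g : GridSeg, (0 < g.line ∧ g.line < N ∧ 0 < g.lo ∧ g.hi < N) ∧
      s.carrier = g.carrier ξ ∧ s.endpoints = {g.param ξ (ξ g.lo), g.param ξ (ξ g.hi)} := by
    intro v k i j hk hi hj ha hb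
    rcases lt_trichotomy i j with hij | rfl | hij
    · refine ⟨⟨v, k, i, j, hij⟩, ⟨hk.1, hk.2, hi.1, hj.2⟩, ?_, ?_⟩
      · rw [GridSeg.carrier, GridSeg.image_param_Icc _ _ (hξ hij).le]
        simp [AxisSegment.carrier, GridSeg.param, ha, hb]
      · simp [AxisSegment.endpoints, GridSeg.param, ha, hb]
    · exact absurd (ha.symm.trans hb) s.ne
    · refine ⟨⟨v, k, j, i, hij⟩, ⟨hk.1, hk.2, hj.1, hi.2⟩, ?_, ?_⟩
      · rw [GridSeg.carrier, GridSeg.image_param_Icc _ _ (hξ hij).le]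
        simp [AxisSegment.carrier, GridSeg.param, ha, hb, segment_symm ℝ s.b]
      · simp [AxisSegment.endpoints, GridSeg.param, ha, hb, Set.pair_comm s.b]
  obtain ⟨i, hi, hi', hia⟩ := h s.a.1 (by simp)
  obtain ⟨j, hj, hj', hja⟩ := h s.a.2 (by simp)
  obtain ⟨i', ki, ki', hib⟩ := h s.b.1 (by simp)
  obtain ⟨j', kj, kj', hjb⟩ := h s.b.2 (by simp)
  rcases s.axisParallel with hp | hp
  · refine build true i j j' ⟨hi, hi'⟩ ⟨hj, hj'⟩ ⟨kj, kj'⟩ ?_ ?_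
    · rw [axisLine_true, hia, hja]
    · rw [axisLine_true, hia, hjb, hp]
  · refine build false j i i' ⟨hj, hj'⟩ ⟨hi, hi'⟩ ⟨ki, ki'⟩ ?_ ?_
    · rw [axisLine_false, hia, hja]
    · rw [axisLine_false, hja, hib, hp]

namespace Arrangement

/-- The grid arrangement `A` with line coordinates `ξ` represents the segments of `S`. -/
structure Represents {S : Finset AxisSegment} (A : GridArrangement S) (ξ : ℤ → ℝ) : Prop where
  strictMono : StrictMono ξ
  carrier : ∀ s, s.1.carrier = (A.seg s).carrier ξ
  endpoints : ∀ s, s.1.endpoints =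
    {(A.seg s).param ξ (ξ (A.seg s).lo), (A.seg s).param ξ (ξ (A.seg s).hi)}

/-- The grid coordinates are all coordinates of endpoints, with the same `ξ` on both axes. Touching
collinear segments would have an endpoint of one inside the other and hence overlap in infinitely
many points; perpendicular ones may not share an endpoint. These give `parallel` and `cross`. -/
theorem exists_represents {S : Finset AxisSegment} (hS : GeneralPosition S) :
    ∃ (A : GridArrangement S) (ξ : ℤ → ℝ), Represents A ξ := by
  classical
  let X : Finset ℝ := S.biUnion fun s => {s.a.1, s.a.2, s.b.1, s.b.2}
  obtain ⟨L, hL⟩ : ∃ L, ∀ x ∈ X, L < x := by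
    obtain ⟨L, hL⟩ := X.bddBelow
    exact ⟨L - 1, fun x hx => by have := hL hx; linarith⟩
  obtain ⟨ξ, N, hξ, hN, -, hX⟩ := exists_strictMono_grid X L hL
  have hex := fun s : S => AxisSegment.exists_gridSeg hξ (N := N) s.1 fun x hx =>
    hX x (Finset.mem_biUnion.2 ⟨s.1, s.2, by simpa using hx⟩)
  choose g hbox hcar hend using hex
  have hparam : ∀ s t : S, (g s).vert = (g t).vert → (g s).line = (g t).line →
      (g s).param ξ = (g t).param ξ := fun s t h h' => by rw [GridSeg.param, GridSeg.param, h, h']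
  -- A point of `s` inside the collinear segment `t` forces a whole common unit edge, contradicting
  -- finiteness of the intersection.
  have hpar : ∀ s t : S, ∀ u : ℤ, (g s).vert = (g t).vert → (g s).line = (g t).line → s ≠ t →
      (g s).lo ≤ u → u ≤ (g s).hi → (g t).lo < u → u < (g t).hi → False := by
    intro s t u hv hl hst h1 h2 h3 h4
    have hfin := hS.finite_inter s.1 s.2 t.1 t.2 (fun h => hst (Subtype.ext h))
    rw [hcar, hcar] at hfin
    obtain ⟨w, hw1, hw2, hw3, hw4⟩ : ∃ w, (g s).lo ≤ w ∧ w + 1 ≤ (g s).hi ∧ (g t).lo ≤ w ∧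
        w + 1 ≤ (g t).hi := by
      have := (g s).lt
      rcases lt_or_ge u (g s).hi with h | h
      · exact ⟨u, by omega, by omega, by omega, by omega⟩
      · exact ⟨u - 1, by omega, by omega, by omega, by omega⟩
    refine ((Set.Icc_infinite (hξ (show w < w + 1 by omega))).image
      ((g s).param_injective ξ).injOn) (hfin.subset ?_)
    rintro _ ⟨r, hr, rfl⟩
    refine ⟨GridSeg.param_mem_carrier.2 ⟨(hξ.monotone hw1).trans hr.1,
      hr.2.trans (hξ.monotone hw2)⟩, ?_⟩
    rw [hparam s t hv hl]
    exact GridSeg.param_mem_carrier.2 ⟨(hξ.monotone hw3).trans hr.1,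
      hr.2.trans (hξ.monotone hw4)⟩
  have hint : ∀ s : S, ∀ u : ℤ, (g s).lo ≤ u → u ≤ (g s).hi →
      (g s).param ξ (ξ u) ∉ s.1.endpoints → (g s).lo < u ∧ u < (g s).hi := by
    intro s u h1 h2 h3
    rw [hend] at h3
    constructor
    · refine lt_of_le_of_ne h1 ?_
      rintro rfl
      simp at h3
    · refine lt_of_le_of_ne h2 ?_
      rintro rfl
      simp at h3
  refine ⟨⟨g, N, fun s => (hbox s).1, fun s => (hbox s).2.1, fun s => (hbox s).2.2.1,
    fun s => (hbox s).2.2.2, ?_, ?_⟩, ξ, hξ, hcar, hend⟩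
  · intro s t p hv hs ht
    by_contra hst
    have hps := (GridSeg.carrier_of_mem hξ).2 hs
    have hpt := (GridSeg.carrier_of_mem hξ).2 ht
    obtain ⟨u, h1, h2, rfl⟩ := hs
    obtain ⟨w, h3, h4, h5⟩ := ht
    have hlu : (g t).line = (g s).line ∧ w = u := by
      cases h : (g s).vert with
      | true => simpa [GridSeg.pos, ← hv, h] using h5
      | false => simpa [GridSeg.pos, ← hv, h, and_comm] using h5
    obtain ⟨hl, rfl⟩ := hlu
    rw [← GridSeg.param_apply] at hps
    have hpt' := hpt
    rw [← GridSeg.param_apply, hparam s t hv hl.symm] at hpt'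
    rcases hS.crossing_or_endpoint s.1 s.2 t.1 t.2 (fun h => hst (Subtype.ext h))
      ((g s).param ξ (ξ w)) ⟨by rwa [hcar], by rwa [hcar, hparam s t hv hl.symm]⟩ with
      ⟨-, h⟩ | ⟨-, h⟩ | ⟨h, -⟩
    · rw [hparam s t hv hl.symm] at h
      have := hint t w h3 h4 h.2
      exact hpar s t w hv hl.symm hst h1 h2 this.1 this.2
    · rw [hparam s t hv hl.symm] at h
      have := hint t w h3 h4 h.2
      exact hpar s t w hv hl.symm hst h1 h2 this.1 this.2
    · have := hint s w h1 h2 h.2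
      exact hpar t s w hv.symm hl (Ne.symm hst) h3 h4 this.1 this.2
  · intro s t u u' hs ht hp hu hu'
    have hst : s ≠ t := by
      rintro rfl
      rw [hs] at ht
      cases ht
    have e1 : (g s).param ξ (ξ u) ∈ s.1.endpoints := by
      rw [hend]
      rcases hu with rfl | rfl <;> simp
    have e2 : (g s).param ξ (ξ u) ∈ t.1.endpoints := by
      rw [GridSeg.param_apply, hp, ← GridSeg.param_apply, hend]
      rcases hu' with rfl | rfl <;> simp
    have hsub : ∀ r : AxisSegment, r.endpoints ⊆ r.carrier := by
      rintro r p (rfl | rfl)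
      · exact left_mem_segment _ _ _
      · exact right_mem_segment _ _ _
    rcases hS.crossing_or_endpoint s.1 s.2 t.1 t.2 (fun h => hst (Subtype.ext h))
      ((g s).param ξ (ξ u)) ⟨hsub _ e1, hsub _ e2⟩ with ⟨h, -⟩ | ⟨-, h⟩ | ⟨h, -⟩
    · exact h.2 e1
    · exact h.2 e2
    · exact h.2 e1

namespace Represents

variable {S : Finset AxisSegment} {A : GridArrangement S} {ξ : ℤ → ℝ} (hR : Represents A ξ)
include hR

theorem support_eq : support S = A.union ξ := by
  ext p
  simp only [support, GridArrangement.union, Set.mem_iUnion, ← hR.carrier, Subtype.exists]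

theorem mem_vertices {s : S} {u : ℤ} (h1 : (A.seg s).lo ≤ u) (h2 : u ≤ (A.seg s).hi)
    (h : A.IsVertexOn s u) : (A.seg s).param ξ (ξ u) ∈ vertices S := by
  rcases h with rfl | rfl | h
  · exact Or.inl ⟨s.1, s.2, by simp [hR.endpoints]⟩
  · exact Or.inl ⟨s.1, s.2, by simp [hR.endpoints]⟩
  · simp only [GridArrangement.Free, not_forall, not_not] at h
    obtain ⟨t, hts, ht⟩ := h
    refine Or.inr ⟨s.1, s.2, t.1, t.2, fun h => hts (Subtype.ext h.symm), ?_, ?_⟩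
    · rw [hR.carrier, GridSeg.param_mem_carrier]
      exact ⟨hR.strictMono.monotone h1, hR.strictMono.monotone h2⟩
    · rw [hR.carrier, GridSeg.param_apply]
      exact (GridSeg.carrier_of_mem hR.strictMono).2 ht

/-- Perpendicular segments meet at a crossing of their grid lines. Parallel ones with a common real
point would share the grid point at the larger of their lower ends. -/
theorem exists_of_mem_inter {s t : S} (hst : t ≠ s) {p : ℝ × ℝ} (hs : p ∈ s.1.carrier)
    (ht : p ∈ t.1.carrier) : ∃ u, (A.seg s).lo ≤ u ∧ u ≤ (A.seg s).hi ∧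
      p = (A.seg s).param ξ (ξ u) ∧ ¬ A.Free s u := by
  have hξ := hR.strictMono
  have hs' := hs
  rw [hR.carrier] at hs ht
  have fin : ∀ u, (A.seg s).lo ≤ u → u ≤ (A.seg s).hi → p = (A.seg s).param ξ (ξ u) →
      ∃ u, (A.seg s).lo ≤ u ∧ u ≤ (A.seg s).hi ∧ p = (A.seg s).param ξ (ξ u) ∧ ¬ A.Free s u := by
    intro u h1 h2 h3
    refine ⟨u, h1, h2, h3, fun hf => hf t hst ?_⟩
    rw [h3, GridSeg.param_apply] at ht
    exact (GridSeg.carrier_of_mem hξ).1 ht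
  have par : (A.seg s).vert = (A.seg t).vert → (A.seg s).line = (A.seg t).line → ∀ r : ℝ,
      (ξ (A.seg s).lo ≤ r ∧ r ≤ ξ (A.seg s).hi) → (ξ (A.seg t).lo ≤ r ∧ r ≤ ξ (A.seg t).hi) →
      False := by
    intro h1 h2 r h3 h4
    have e1 := (A.seg s).lt
    have e2 := (A.seg t).lt
    have e3 := hξ.le_iff_le.1 (h3.1.trans h4.2)
    have e4 := hξ.le_iff_le.1 (h4.1.trans h3.2)
    exact hst.symm (A.parallel s t ((A.seg s).pos (max (A.seg s).lo (A.seg t).lo)) h1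
      (GridArrangement.IsRegion.mem_pos_of rfl rfl (le_max_left _ _) (by omega))
      (GridArrangement.IsRegion.mem_pos_of h1.symm h2.symm (le_max_right _ _) (by omega)))
  obtain ⟨x, y⟩ := p
  cases hv : (A.seg s).vert <;> cases hw : (A.seg t).vert
  · rw [GridSeg.mem_carrier_of_not_vert hv] at hs
    rw [GridSeg.mem_carrier_of_not_vert hw] at ht
    exact (par (hv.trans hw.symm) (hξ.injective (hs.1.trans ht.1.symm)) _ hs.2 ht.2).elim
  · rw [GridSeg.mem_carrier_of_not_vert hv] at hs
    rw [GridSeg.mem_carrier_of_vert hw] at ht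
    simp only at hs ht
    refine fin (A.seg t).line (hξ.le_iff_le.1 (hs.2.1.trans ht.1.ge))
      (hξ.le_iff_le.1 (ht.1.le.trans hs.2.2)) ?_
    rw [GridSeg.param, hv, axisLine_false, ht.1, hs.1]
  · rw [GridSeg.mem_carrier_of_vert hv] at hs
    rw [GridSeg.mem_carrier_of_not_vert hw] at ht
    simp only at hs ht
    refine fin (A.seg t).line (hξ.le_iff_le.1 (hs.2.1.trans ht.1.ge))
      (hξ.le_iff_le.1 (ht.1.le.trans hs.2.2)) ?_
    rw [GridSeg.param, hv, axisLine_true, ht.1, hs.1]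
  · rw [GridSeg.mem_carrier_of_vert hv] at hs
    rw [GridSeg.mem_carrier_of_vert hw] at ht
    exact (par (hv.trans hw.symm) (hξ.injective (hs.1.trans ht.1.symm)) _ hs.2 ht.2).elim

theorem exists_of_mem_vertices {s : S} {p : ℝ × ℝ} (hs : p ∈ s.1.carrier) (hp : p ∈ vertices S) :
    ∃ u, (A.seg s).lo ≤ u ∧ u ≤ (A.seg s).hi ∧ p = (A.seg s).param ξ (ξ u) ∧
      A.IsVertexOn s u := by
  have key : ∀ t : S, t ≠ s → p ∈ t.1.carrier → _ := fun t hts ht =>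
    hR.exists_of_mem_inter hts hs ht
  have key' : ∀ t : S, t ≠ s → p ∈ t.1.carrier → ∃ u, (A.seg s).lo ≤ u ∧ u ≤ (A.seg s).hi ∧
      p = (A.seg s).param ξ (ξ u) ∧ A.IsVertexOn s u := fun t hts ht => by
    obtain ⟨u, h1, h2, h3, h4⟩ := key t hts ht
    exact ⟨u, h1, h2, h3, Or.inr (Or.inr h4)⟩
  have hlt := (A.seg s).lt
  rcases hp with ⟨t, ht, hp⟩ | ⟨t, ht, t', ht', hne, hp, hp'⟩
  · by_cases hts : (⟨t, ht⟩ : S) = s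
    · subst hts
      rw [hR.endpoints ⟨t, ht⟩] at hp
      rcases hp with rfl | rfl
      · exact ⟨_, le_rfl, hlt.le, rfl, Or.inl rfl⟩
      · exact ⟨_, hlt.le, le_rfl, rfl, Or.inr (Or.inl rfl)⟩
    · refine key' ⟨t, ht⟩ hts ?_
      rcases hp with rfl | rfl
      · exact left_mem_segment _ _ _
      · exact right_mem_segment _ _ _
  · by_cases hts : (⟨t, ht⟩ : S) = s
    · refine key' ⟨t', ht'⟩ ?_ hp'
      rintro rfl
      exact hne (congrArg Subtype.val hts)
    · exact key' ⟨t, ht⟩ hts hp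

/-- Every edge joins two consecutive vertices of a segment. -/
theorem exists_of_isEdge {e : Set (ℝ × ℝ)} (he : IsEdge S e) :
    ∃ (s : S) (u w : ℤ), (A.seg s).lo ≤ u ∧ u < w ∧ w ≤ (A.seg s).hi ∧ A.IsVertexOn s u ∧
      A.IsVertexOn s w ∧ (∀ v, u < v → v < w → ¬ A.IsVertexOn s v) ∧
      e = (A.seg s).param ξ '' Set.Icc (ξ u) (ξ w) := by
  classical
  obtain ⟨s, hs, hmax⟩ := he
  have hξ := hR.strictMono
  lift s to S using hs
  obtain ⟨p, q, hpq, hepq, hsub, hfree⟩ := hmax.prop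
  have hlt := (A.seg s).lt
  obtain ⟨a, b, hab, ha, hb, heq, hfree'⟩ : ∃ a b : ℝ, a < b ∧ ξ (A.seg s).lo ≤ a ∧
      b ≤ ξ (A.seg s).hi ∧ e = (A.seg s).param ξ '' Set.Icc a b ∧
      ∀ v ∈ vertices S, v ∉ (A.seg s).param ξ '' Set.Ioo a b := by
    have hp : p ∈ s.1.carrier := hsub (hepq ▸ left_mem_segment _ _ _)
    have hq : q ∈ s.1.carrier := hsub (hepq ▸ right_mem_segment _ _ _)
    rw [hR.carrier] at hp hq
    obtain ⟨a, ha, rfl⟩ := hp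
    obtain ⟨b, hb, rfl⟩ := hq
    rcases lt_trichotomy a b with h | rfl | h
    · refine ⟨a, b, h, ha.1, hb.2, ?_, ?_⟩
      · rw [GridSeg.image_param_Icc _ _ h.le, hepq]
      · rwa [← openSegment_eq_Ioo h, image_openSegment]
    · exact absurd rfl hpq
    · refine ⟨b, a, h, hb.1, ha.2, ?_, ?_⟩
      · rw [GridSeg.image_param_Icc _ _ h.le, hepq, segment_symm]
      · rwa [← openSegment_eq_Ioo h, image_openSegment, openSegment_symm]
  -- `u` and `w` are the nearest vertices enclosing the edge; the piece between them is free of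
  -- inner vertices, so maximality makes it the whole edge.
  obtain ⟨u, hu, humax⟩ := ((Finset.Icc (A.seg s).lo (A.seg s).hi).filter fun u =>
    A.IsVertexOn s u ∧ ξ u ≤ a).exists_max_image id ⟨(A.seg s).lo, by
      simp only [Finset.mem_filter, Finset.mem_Icc]
      exact ⟨⟨le_rfl, hlt.le⟩, Or.inl rfl, ha⟩⟩
  obtain ⟨w, hw, hwmin⟩ := ((Finset.Icc (A.seg s).lo (A.seg s).hi).filter fun u =>
    A.IsVertexOn s u ∧ b ≤ ξ u).exists_min_image id ⟨(A.seg s).hi, by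
      simp only [Finset.mem_filter, Finset.mem_Icc]
      exact ⟨⟨hlt.le, le_rfl⟩, Or.inr (Or.inl rfl), hb⟩⟩
  simp only [Finset.mem_filter, Finset.mem_Icc, id] at hu humax hw hwmin
  have huw : u < w := hξ.lt_iff_lt.1 (hu.2.2.trans_lt (hab.trans_le hw.2.2))
  have hno : ∀ v, u < v → v < w → ¬ A.IsVertexOn s v := by
    intro v h1 h2 hv
    have hva : a < ξ v := by
      by_contra! h
      have := humax v ⟨⟨by omega, by omega⟩, hv, h⟩
      omega
    have hvb : ξ v < b := by
      by_contra! h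
      have := hwmin v ⟨⟨by omega, by omega⟩, hv, h⟩
      omega
    exact hfree' _ (hR.mem_vertices (by omega) (by omega) hv) ⟨_, ⟨hva, hvb⟩, rfl⟩
  refine ⟨s, u, w, hu.1.1, huw, hw.1.2, hu.2.1, hw.2.1, hno, ?_⟩
  have hle : e ⊆ (A.seg s).param ξ '' Set.Icc (ξ u) (ξ w) := by
    rw [heq]
    exact Set.image_mono (Set.Icc_subset_Icc hu.2.2 hw.2.2)
  refine Set.Subset.antisymm hle (hmax.2 ⟨_, _, ?_, GridSeg.image_param_Icc _ _ (hξ huw).le, ?_, ?_⟩ hle)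
  · exact fun h => (hξ huw).ne ((A.seg s).param_injective ξ h)
  · rw [hR.carrier, GridSeg.carrier]
    exact Set.image_mono (Set.Icc_subset_Icc (hξ.monotone hu.1.1) (hξ.monotone hw.1.2))
  · intro v hv hv'
    rw [← image_openSegment, openSegment_eq_Ioo (hξ huw)] at hv'
    obtain ⟨r, hr, rfl⟩ := hv'
    obtain ⟨x, h1, h2, h3, h4⟩ := hR.exists_of_mem_vertices (s := s) (by
      rw [hR.carrier, GridSeg.param_mem_carrier]
      exact ⟨(hξ.monotone hu.1.1).trans hr.1.le, hr.2.le.trans (hξ.monotone hw.1.2)⟩) hv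
    obtain rfl := (A.seg s).param_injective ξ h3
    exact hno x (hξ.lt_iff_lt.1 hr.1) (hξ.lt_iff_lt.1 hr.2) h4

/-- The edges of a face inject into the discrete edges of its region. -/
theorem ncard_boundingEdges_le (x : ℝ × ℝ) :
    (boundingEdges S (closure (connectedComponentIn (support S)ᶜ x))).Finite ∧
    (boundingEdges S (closure (connectedComponentIn (support S)ᶜ x))).ncard ≤
      ∑ s, (A.edgesOn (A.region ξ x) s).card := by
  classical
  have hξ := hR.strictMono
  set B := boundingEdges S (closure (connectedComponentIn (support S)ᶜ x)) with hB
  set T := Finset.univ.sigma (fun s => A.edgesOn (A.region ξ x) s) with hT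
  -- An edge is determined by its segment and its lower endpoint, as its upper endpoint is the next
  -- vertex.
  let Rel : Set (ℝ × ℝ) → ((_ : S) × ℤ) → Prop := fun e t => ∃ w, t.2 < w ∧ w ≤ (A.seg t.1).hi ∧
    A.IsVertexOn t.1 w ∧ (∀ v, t.2 < v → v < w → ¬ A.IsVertexOn t.1 v) ∧
      e = (A.seg t.1).param ξ '' Set.Icc (ξ t.2) (ξ w)
  have hex : ∀ e ∈ B, ∃ t ∈ T, Rel e t := by
    rintro e ⟨he, heF⟩
    obtain ⟨s, u, w, h1, h2, h3, h4, h5, h6, h7⟩ := hR.exists_of_isEdge he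
    refine ⟨⟨s, u⟩, ?_, w, h2, h3, h5, h6, h7⟩
    simp only [hT, Finset.mem_sigma, Finset.mem_univ, true_and, GridArrangement.edgesOn,
      Finset.mem_filter, Finset.mem_Ico]
    refine ⟨⟨h1, by omega⟩, h4, GridArrangement.lc_or_rc_mem_region hξ h1 (by omega) ?_⟩
    rw [← hR.support_eq]
    apply heF
    rw [h7]
    have e1 := hξ (show u < u + 1 by omega)
    have e2 := hξ.monotone (show u + 1 ≤ w by omega)
    exact ⟨_, ⟨by linarith, by linarith⟩, rfl⟩
  have huniq : ∀ e e' t, Rel e t → Rel e' t → e = e' := by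
    rintro e e' ⟨s, u⟩ ⟨w, h1, h2, h3, h4, h5⟩ ⟨w', k1, k2, k3, k4, k5⟩
    have : w = w' := by
      rcases lt_trichotomy w w' with h | h | h
      · exact absurd h3 (k4 w h1 h)
      · exact h
      · exact absurd k3 (h4 w' k1 h)
    rw [h5, k5, this]
  rcases B.eq_empty_or_nonempty with hB0 | ⟨e₀, he₀⟩
  · simp [hB0]
  have : Nonempty ((_ : S) × ℤ) := (hex e₀ he₀).nonempty
  choose! f hfT hfR using hex
  have hinj : Set.InjOn f B := fun e he e' he' h =>
    huniq e e' (f e) (hfR e he) (h ▸ hfR e' he')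
  have hmaps : Set.MapsTo f B T := fun e he => hfT e he
  refine ⟨Set.Finite.of_injOn hmaps hinj T.finite_toSet, ?_⟩
  rw [← Finset.card_sigma, ← Set.ncard_coe_finset]
  exact Set.ncard_le_ncard_of_injOn f hmaps hinj T.finite_toSet

end Represents

theorem ncard_boundingEdges_le_of_meet {S : Finset AxisSegment} (hS : GeneralPosition S)
    (hne : S.Nonempty)
    (hmeet : ∀ s ∈ S, ∃ t ∈ S, s ≠ t ∧ (s.carrier ∩ t.carrier).Nonempty) (x : ℝ × ℝ) :
    (boundingEdges S (closure (connectedComponentIn (support S)ᶜ x))).Finite ∧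
    (boundingEdges S (closure (connectedComponentIn (support S)ᶜ x))).ncard + 4 ≤ 4 * S.card := by
  obtain ⟨A, ξ, hR⟩ := exists_represents hS
  have := hne.to_subtype
  have h1 := hR.ncard_boundingEdges_le x
  have h2 := (GridArrangement.isRegion_region (A := A) (x := x)
    hR.strictMono).sum_card_edgesOn_le_four_mul fun s => by
      obtain ⟨t, ht, hne, p, hp, hp'⟩ := hmeet s.1 s.2
      obtain ⟨u, h1, h2, -, h3⟩ := hR.exists_of_mem_inter (s := s) (t := ⟨t, ht⟩)
        (fun h => hne (congrArg Subtype.val h).symm) hp hp'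
      exact ⟨u, h1, h2, h3⟩
  rw [Fintype.card_coe] at h2
  exact ⟨h1.1, by omega⟩

end Arrangement

/-! ### Removing isolated segments: the upper bound -/

namespace Arrangement

theorem GeneralPosition.subset {S S' : Finset AxisSegment} (hS : GeneralPosition S)
    (h : S' ⊆ S) : GeneralPosition S' where
  finite_inter s hs t ht := hS.finite_inter s (h hs) t (h ht)
  no_triple r hr s hs t ht := hS.no_triple r (h hr) s (h hs) t (h ht)
  crossing_or_endpoint s hs t ht := hS.crossing_or_endpoint s (h hs) t (h ht)

theorem endpoints_subset_carrier (s : AxisSegment) : s.endpoints ⊆ s.carrier := by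
  rintro p (rfl | rfl)
  · exact left_mem_segment _ _ _
  · exact right_mem_segment _ _ _

theorem boundingEdges_empty (F : Set (ℝ × ℝ)) : boundingEdges ∅ F = ∅ := by
  ext e
  simp [boundingEdges, IsEdge]

/-- A vertex on `s` is an endpoint of `s` or lies on another segment. -/
theorem mem_vertices_on {S : Finset AxisSegment} {s : AxisSegment} {v : ℝ × ℝ}
    (hv : v ∈ vertices S) : v ∈ s.endpoints ∨ ∃ t ∈ S, s ≠ t ∧ v ∈ t.carrier := by
  rcases hv with ⟨t, ht, hv⟩ | ⟨t, ht, t', ht', hne, hv, hv'⟩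
  · by_cases hst : s = t
    · exact Or.inl (hst ▸ hv)
    · exact Or.inr ⟨t, ht, hst, endpoints_subset_carrier t hv⟩
  · by_cases hst : s = t
    · exact Or.inr ⟨t', ht', hst ▸ hne, hv'⟩
    · exact Or.inr ⟨t, ht, hst, hv⟩

open Classical in
/-- The segments that meet another segment. -/
noncomputable def meeting (S : Finset AxisSegment) : Finset AxisSegment :=
  S.filter fun s => ∃ t ∈ S, s ≠ t ∧ (s.carrier ∩ t.carrier).Nonempty

theorem exists_meeting {S : Finset AxisSegment} {s : AxisSegment} (hs : s ∈ meeting S) :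
    ∃ t ∈ meeting S, s ≠ t ∧ (s.carrier ∩ t.carrier).Nonempty := by
  classical
  obtain ⟨hs, t, ht, hne, hmeet⟩ := Finset.mem_filter.1 hs
  exact ⟨t, Finset.mem_filter.2 ⟨ht, s, hs, hne.symm, by rwa [Set.inter_comm]⟩, hne, hmeet⟩

theorem vertices_subset {S S' : Finset AxisSegment} (h : S' ⊆ S) : vertices S' ⊆ vertices S := by
  rintro v (⟨t, ht, hv⟩ | ⟨t, ht, t', ht', hv⟩)
  · exact Or.inl ⟨t, h ht, hv⟩
  · exact Or.inr ⟨t, h ht, t', h ht', hv⟩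

/-- A segment of `meeting S` loses no vertices when the isolated ones are removed, so its edges stay
the same; an isolated segment is a single edge. -/
theorem isEdge_meeting_or {S : Finset AxisSegment} {e : Set (ℝ × ℝ)} (he : IsEdge S e) :
    IsEdge (meeting S) e ∨ ∃ s ∈ S, s ∉ meeting S ∧ e = s.carrier := by
  classical
  have hsub : meeting S ⊆ S := Finset.filter_subset _ _
  obtain ⟨s, hs, hmax⟩ := he
  by_cases hm : s ∈ meeting S
  · refine Or.inl ⟨s, hm, ?_, ?_⟩
    · obtain ⟨p, q, h1, h2, h3, h4⟩ := hmax.prop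
      exact ⟨p, q, h1, h2, h3, fun v hv => h4 v (vertices_subset hsub hv)⟩
    · intro e' he' hle
      refine hmax.2 ?_ hle
      obtain ⟨p, q, h1, h2, h3, h4⟩ := he'
      refine ⟨p, q, h1, h2, h3, fun v hv hvo => h4 v ?_ hvo⟩
      have hvs : v ∈ s.carrier := h3 (h2 ▸ openSegment_subset_segment ℝ p q hvo)
      rcases mem_vertices_on (s := s) hv with h | ⟨t, ht, hst, hvt⟩
      · exact Or.inl ⟨s, hm, h⟩
      · exact Or.inr ⟨s, hm, t, Finset.mem_filter.2 ⟨ht, s, hs, hst.symm, v, hvt, hvs⟩, hst,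
          hvs, hvt⟩
  · refine Or.inr ⟨s, hs, hm, ?_⟩
    have hle : e ⊆ s.carrier := by
      obtain ⟨p, q, h1, h2, h3, h4⟩ := hmax.prop
      exact h3
    refine hle.antisymm (hmax.2 ⟨s.a, s.b, s.ne, rfl, subset_rfl, fun v hv hvo => ?_⟩ hle)
    rcases mem_vertices_on (s := s) hv with (h | h) | ⟨t, ht, hst, hvt⟩
    · rw [h, left_mem_openSegment_iff] at hvo
      exact s.ne hvo
    · rw [Set.mem_singleton_iff.1 h, right_mem_openSegment_iff] at hvo
      exact s.ne hvo
    · exact hm (Finset.mem_filter.2 ⟨hs, t, ht, hst, v, openSegment_subset_segment ℝ _ _ hvo, hvt⟩)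

/-- A face of an arrangement of `n > 1` segments has at most `4 n - 4` edges. -/
theorem ncard_boundingEdges_le {S : Finset AxisSegment} (hS : GeneralPosition S)
    (hn : 1 < S.card) (x : ℝ × ℝ) :
    (boundingEdges S (closure (connectedComponentIn (support S)ᶜ x))).Finite ∧
    (boundingEdges S (closure (connectedComponentIn (support S)ᶜ x))).ncard ≤ 4 * S.card - 4 := by
  classical
  have hsub : meeting S ⊆ S := Finset.filter_subset _ _
  set F := closure (connectedComponentIn (support S)ᶜ x)
  set F' := closure (connectedComponentIn (support (meeting S))ᶜ x)
  -- With fewer segments the component of `x` can only grow.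
  have hF : F ⊆ F' := closure_mono (connectedComponentIn_mono _ (Set.compl_subset_compl.2
    (Set.biUnion_subset_biUnion_left hsub)))
  have hcover : boundingEdges S F ⊆ boundingEdges (meeting S) F' ∪
      ((S \ meeting S).image AxisSegment.carrier : Finset (Set (ℝ × ℝ))) := by
    rintro e ⟨he, heF⟩
    rcases isEdge_meeting_or he with h | ⟨s, hs, hm, rfl⟩
    · exact Or.inl ⟨h, heF.trans hF⟩
    · exact Or.inr (Finset.mem_coe.2 (Finset.mem_image_of_mem _ (Finset.mem_sdiff.2 ⟨hs, hm⟩)))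
  have hmain : (boundingEdges (meeting S) F').Finite ∧ (boundingEdges (meeting S) F').ncard +
      (if (meeting S).Nonempty then 4 else 0) ≤ 4 * (meeting S).card := by
    split_ifs with hne
    · exact ncard_boundingEdges_le_of_meet (hS.subset hsub) hne
        (fun s hs => exists_meeting hs) x
    · rw [Finset.not_nonempty_iff_eq_empty.1 hne, boundingEdges_empty]
      simp
  have hfin := hmain.1.union (Finset.finite_toSet ((S \ meeting S).image AxisSegment.carrier))
  refine ⟨hfin.subset hcover, ?_⟩
  have h1 := (Set.ncard_le_ncard hcover hfin).trans (Set.ncard_union_le _ _)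
  rw [Set.ncard_coe_finset] at h1
  have h2 : ((S \ meeting S).image AxisSegment.carrier).card ≤ _ := Finset.card_image_le
  have h3 := Finset.card_sdiff_add_card_eq_card hsub
  have h4 := hmain.2
  -- With `m` meeting segments the count is at most `(4m - 4) + (n - m)` if `m > 0`, and at most `n`
  -- otherwise; both are at most `4n - 4` as `n > 1`.
  by_cases hne : (meeting S).Nonempty
  · rw [if_pos hne] at h4
    omega
  · rw [if_neg hne] at h4
    have h0 : (meeting S).card = 0 := by
      rw [Finset.card_eq_zero, Finset.not_nonempty_iff_eq_empty.1 hne]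
    omega

/-- A larger vertex-free part must have the vertices `p` and `q` among its own two endpoints, so it
is no larger. -/
theorem isEdge_segment {S : Finset AxisSegment} {s : AxisSegment} (hs : s ∈ S) {p q : ℝ × ℝ}
    (hpq : p ≠ q) (hsub : segment ℝ p q ⊆ s.carrier) (hp : p ∈ vertices S) (hq : q ∈ vertices S)
    (hfree : ∀ v ∈ vertices S, v ∉ openSegment ℝ p q) : IsEdge S (segment ℝ p q) := by
  refine ⟨s, hs, ⟨p, q, hpq, rfl, hsub, hfree⟩, ?_⟩
  rintro _ ⟨p', q', hne, rfl, hsub', hfree'⟩ hle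
  have key : ∀ v ∈ vertices S, v ∈ segment ℝ p q → v = p' ∨ v = q' := by
    intro v hv hvs
    have h := hle hvs
    rw [← insert_endpoints_openSegment] at h
    rcases h with h | h | h
    · exact Or.inl h
    · exact Or.inr h
    · exact absurd h (hfree' v hv)
  rcases key p hp (left_mem_segment _ _ _) with h1 | h1 <;>
    rcases key q hq (right_mem_segment _ _ _) with h2 | h2
  · exact absurd (h1.trans h2.symm) hpq
  · rw [h1, h2]
  · rw [h1, h2, segment_symm]
  · exact absurd (h1.trans h2.symm) hpq

end Arrangement

/-! ### Tightness: the outer face of a lattice of segments -/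

/-- The segment from `r` to `r'` on a vertical or horizontal line. -/
def AxisSegment.ofLine (v : Bool) (c r r' : ℝ) (h : r < r') : AxisSegment where
  a := axisLine v c r
  b := axisLine v c r'
  ne h' := h.ne (axisLine_injective v c h')
  axisParallel := by cases v <;> simp [axisLine_true, axisLine_false]

theorem segment_axisLine (v : Bool) (c : ℝ) {r r' : ℝ} (h : r ≤ r') :
    segment ℝ (axisLine v c r) (axisLine v c r') = axisLine v c '' Set.Icc r r' := by
  rw [← segment_eq_Icc h, image_segment]

theorem openSegment_axisLine (v : Bool) (c : ℝ) {r r' : ℝ} (h : r < r') :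
    openSegment ℝ (axisLine v c r) (axisLine v c r') = axisLine v c '' Set.Ioo r r' := by
  rw [← openSegment_eq_Ioo h, image_openSegment]

theorem AxisSegment.carrier_ofLine (v : Bool) (c r r' : ℝ) (h : r < r') :
    (ofLine v c r r' h).carrier = axisLine v c '' Set.Icc r r' :=
  segment_axisLine v c h.le

theorem AxisSegment.mem_carrier_ofLine_true {c r r' : ℝ} {h : r < r'} {p : ℝ × ℝ} :
    p ∈ (ofLine true c r r' h).carrier ↔ p.1 = c ∧ r ≤ p.2 ∧ p.2 ≤ r' := by
  obtain ⟨x, y⟩ := p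
  rw [carrier_ofLine]
  simp only [Set.mem_image, axisLine_true, Set.mem_Icc, Prod.mk.injEq]
  constructor
  · rintro ⟨_, h, rfl, rfl⟩; exact ⟨rfl, h⟩
  · rintro ⟨rfl, h⟩; exact ⟨_, h, rfl, rfl⟩

theorem AxisSegment.mem_carrier_ofLine_false {c r r' : ℝ} {h : r < r'} {p : ℝ × ℝ} :
    p ∈ (ofLine false c r r' h).carrier ↔ p.2 = c ∧ r ≤ p.1 ∧ p.1 ≤ r' := by
  obtain ⟨x, y⟩ := p
  rw [carrier_ofLine]
  simp only [Set.mem_image, axisLine_false, Set.mem_Icc, Prod.mk.injEq]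
  constructor
  · rintro ⟨_, h, rfl, rfl⟩; exact ⟨rfl, h⟩
  · rintro ⟨rfl, h⟩; exact ⟨_, h, rfl, rfl⟩

namespace Lattice

/-- The segment with number `c` of one of the two parallel classes of a lattice of segments, which
crosses the `m` segments of the other class. -/
noncomputable def line (m : ℕ) (v : Bool) (c : ℕ) : AxisSegment :=
  AxisSegment.ofLine v c 0 (m + 1) (by positivity)

open Classical in
/-- The lattice of `a` vertical and `b` horizontal segments, each crossing all those of the other
class. -/
noncomputable def lattice (a b : ℕ) : Finset AxisSegment :=
  (Finset.Icc 1 a).image (line b true) ∪ (Finset.Icc 1 b).image (line a false)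

theorem mem_lattice {a b : ℕ} {s : AxisSegment} : s ∈ lattice a b ↔
    (∃ c, (1 ≤ c ∧ c ≤ a) ∧ line b true c = s) ∨ ∃ c, (1 ≤ c ∧ c ≤ b) ∧ line a false c = s := by
  simp [lattice]

theorem mem_line_true {m c : ℕ} {p : ℝ × ℝ} :
    p ∈ (line m true c).carrier ↔ p.1 = c ∧ 0 ≤ p.2 ∧ p.2 ≤ m + 1 :=
  AxisSegment.mem_carrier_ofLine_true

theorem mem_line_false {m c : ℕ} {p : ℝ × ℝ} :
    p ∈ (line m false c).carrier ↔ p.2 = c ∧ 0 ≤ p.1 ∧ p.1 ≤ m + 1 :=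
  AxisSegment.mem_carrier_ofLine_false

theorem endpoints_line_true (m c : ℕ) :
    (line m true c).endpoints = {((c : ℝ), 0), ((c : ℝ), (m : ℝ) + 1)} := by
  simp [line, AxisSegment.endpoints, AxisSegment.ofLine, axisLine_true]

theorem endpoints_line_false (m c : ℕ) :
    (line m false c).endpoints = {(0, (c : ℝ)), ((m : ℝ) + 1, (c : ℝ))} := by
  simp [line, AxisSegment.endpoints, AxisSegment.ofLine, axisLine_false]

theorem inter_line_same {m : ℕ} {v : Bool} {c c' : ℕ} {p : ℝ × ℝ}
    (h : p ∈ (line m v c).carrier) (h' : p ∈ (line m v c').carrier) : c = c' := by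
  cases v
  · rw [mem_line_false] at h h'
    exact_mod_cast h.1.symm.trans h'.1
  · rw [mem_line_true] at h h'
    exact_mod_cast h.1.symm.trans h'.1

theorem line_injective (m : ℕ) (v : Bool) : Function.Injective (line m v) := by
  intro c c' h
  exact inter_line_same (p := (line m v c).a) (left_mem_segment _ _ _)
    (by rw [← h]; exact left_mem_segment _ _ _)

theorem line_true_ne_line_false (m m' c c' : ℕ) : line m true c ≠ line m' false c' := by
  intro h
  have h1 : (line m true c).a.1 = (line m true c).b.1 := by
    simp [line, AxisSegment.ofLine, axisLine_true]
  rw [h] at h1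
  simp only [line, AxisSegment.ofLine, axisLine_false] at h1
  have : (0 : ℝ) < m' + 1 := by positivity
  exact this.ne h1

theorem card_lattice (a b : ℕ) : (lattice a b).card = a + b := by
  classical
  rw [lattice, Finset.card_union_of_disjoint, Finset.card_image_of_injective _ (line_injective _ _),
    Finset.card_image_of_injective _ (line_injective _ _), Nat.card_Icc, Nat.card_Icc]
  · omega
  · rw [Finset.disjoint_left]
    intro s hs hs'
    obtain ⟨c, -, rfl⟩ := Finset.mem_image.1 hs
    obtain ⟨c', -, h⟩ := Finset.mem_image.1 hs'
    exact line_true_ne_line_false _ _ _ _ h.symm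

theorem crossing_interior {a b c c' : ℕ} (hc : 1 ≤ c ∧ c ≤ a) (hc' : 1 ≤ c' ∧ c' ≤ b) {p : ℝ × ℝ}
    (h : p ∈ (line b true c).carrier) (h' : p ∈ (line a false c').carrier) :
    p ∈ (line b true c).interior ∧ p ∈ (line a false c').interior := by
  have e1 := (mem_line_true.1 h).1
  have e2 := (mem_line_false.1 h').1
  obtain ⟨x, y⟩ := p
  simp only at e1 e2
  subst e1 e2
  refine ⟨⟨h, ?_⟩, ⟨h', ?_⟩⟩
  · rw [endpoints_line_true]
    rintro (h | h)
    · have h1 : (c' : ℝ) = 0 := (Prod.mk.inj h).2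
      have : c' = 0 := by exact_mod_cast h1
      omega
    · have h1 : (c' : ℝ) = b + 1 := (Prod.mk.inj (Set.mem_singleton_iff.1 h)).2
      have : c' = b + 1 := by exact_mod_cast h1
      omega
  · rw [endpoints_line_false]
    rintro (h | h)
    · have h1 : (c : ℝ) = 0 := (Prod.mk.inj h).1
      have : c = 0 := by exact_mod_cast h1
      omega
    · have h1 : (c : ℝ) = a + 1 := (Prod.mk.inj (Set.mem_singleton_iff.1 h)).1
      have : c = a + 1 := by exact_mod_cast h1
      omega

theorem generalPosition_lattice (a b : ℕ) : Arrangement.GeneralPosition (lattice a b) := by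
  constructor
  · intro s hs t ht hst
    rcases mem_lattice.1 hs with ⟨c, hc, rfl⟩ | ⟨c, hc, rfl⟩ <;>
      rcases mem_lattice.1 ht with ⟨c', hc', rfl⟩ | ⟨c', hc', rfl⟩
    · convert Set.finite_empty
      ext p
      simp only [Set.mem_inter_iff, Set.mem_empty_iff_false, iff_false]
      rintro ⟨h, h'⟩
      exact hst (congrArg _ (inter_line_same h h'))
    · refine (Set.finite_singleton ((c : ℝ), (c' : ℝ))).subset ?_
      rintro p ⟨h, h'⟩
      exact Prod.ext (mem_line_true.1 h).1 (mem_line_false.1 h').1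
    · refine (Set.finite_singleton ((c' : ℝ), (c : ℝ))).subset ?_
      rintro p ⟨h, h'⟩
      exact Prod.ext (mem_line_true.1 h').1 (mem_line_false.1 h).1
    · convert Set.finite_empty
      ext p
      simp only [Set.mem_inter_iff, Set.mem_empty_iff_false, iff_false]
      rintro ⟨h, h'⟩
      exact hst (congrArg _ (inter_line_same h h'))
  · intro r hr s hs t ht hrs hrt hst
    ext p
    simp only [Set.mem_inter_iff, Set.mem_empty_iff_false, iff_false]
    rintro ⟨⟨h1, h2⟩, h3⟩
    rcases mem_lattice.1 hr with ⟨c, hc, rfl⟩ | ⟨c, hc, rfl⟩ <;>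
      rcases mem_lattice.1 hs with ⟨c', hc', rfl⟩ | ⟨c', hc', rfl⟩
    · exact hrs (congrArg _ (inter_line_same h1 h2))
    · rcases mem_lattice.1 ht with ⟨c'', hc'', rfl⟩ | ⟨c'', hc'', rfl⟩
      · exact hrt (congrArg _ (inter_line_same h1 h3))
      · exact hst (congrArg _ (inter_line_same h2 h3))
    · rcases mem_lattice.1 ht with ⟨c'', hc'', rfl⟩ | ⟨c'', hc'', rfl⟩
      · exact hst (congrArg _ (inter_line_same h2 h3))
      · exact hrt (congrArg _ (inter_line_same h1 h3))
    · exact hrs (congrArg _ (inter_line_same h1 h2))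
  · rintro s hs t ht hst p ⟨h, h'⟩
    left
    rcases mem_lattice.1 hs with ⟨c, hc, rfl⟩ | ⟨c, hc, rfl⟩ <;>
      rcases mem_lattice.1 ht with ⟨c', hc', rfl⟩ | ⟨c', hc', rfl⟩
    · exact absurd (congrArg _ (inter_line_same h h')) hst
    · exact crossing_interior hc hc' h h'
    · exact (crossing_interior hc' hc h' h).symm
    · exact absurd (congrArg _ (inter_line_same h h')) hst

open Arrangement

theorem exists_nat_of_mem_vertices {a b : ℕ} {p : ℝ × ℝ} (hp : p ∈ vertices (lattice a b)) :
    ∃ m n : ℕ, p = ((m : ℝ), (n : ℝ)) := by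
  rcases hp with ⟨s, hs, hp⟩ | ⟨s, hs, t, ht, hst, h, h'⟩
  · rcases mem_lattice.1 hs with ⟨c, hc, rfl⟩ | ⟨c, hc, rfl⟩
    · rw [endpoints_line_true] at hp
      rcases hp with rfl | rfl
      · exact ⟨c, 0, by simp⟩
      · exact ⟨c, b + 1, by simp⟩
    · rw [endpoints_line_false] at hp
      rcases hp with rfl | rfl
      · exact ⟨0, c, by simp⟩
      · exact ⟨a + 1, c, by simp⟩
  · rcases mem_lattice.1 hs with ⟨c, hc, rfl⟩ | ⟨c, hc, rfl⟩ <;>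
      rcases mem_lattice.1 ht with ⟨c', hc', rfl⟩ | ⟨c', hc', rfl⟩
    · exact absurd (congrArg _ (inter_line_same h h')) hst
    · exact ⟨c, c', Prod.ext (mem_line_true.1 h).1 (mem_line_false.1 h').1⟩
    · exact ⟨c', c, Prod.ext (mem_line_true.1 h').1 (mem_line_false.1 h).1⟩
    · exact absurd (congrArg _ (inter_line_same h h')) hst

theorem mem_vertices_true {a b c r : ℕ} (hc : 1 ≤ c ∧ c ≤ a) (hr : r ≤ b + 1) :
    ((c : ℝ), (r : ℝ)) ∈ vertices (lattice a b) := by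
  have hs : line b true c ∈ lattice a b := mem_lattice.2 (Or.inl ⟨c, hc, rfl⟩)
  by_cases h0 : r = 0
  · exact Or.inl ⟨_, hs, by simp [endpoints_line_true, h0]⟩
  by_cases h1 : r = b + 1
  · exact Or.inl ⟨_, hs, by simp [endpoints_line_true, h1]⟩
  refine Or.inr ⟨_, hs, line a false r, mem_lattice.2 (Or.inr ⟨r, by omega, rfl⟩),
    line_true_ne_line_false _ _ _ _, ?_, ?_⟩
  · exact mem_line_true.2 ⟨rfl, by positivity, by simp only; exact_mod_cast hr⟩
  · exact mem_line_false.2 ⟨rfl, by positivity, by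
    simp only; exact_mod_cast (by omega : c ≤ a + 1)⟩

theorem mem_vertices_false {a b c r : ℕ} (hc : 1 ≤ c ∧ c ≤ b) (hr : r ≤ a + 1) :
    ((r : ℝ), (c : ℝ)) ∈ vertices (lattice a b) := by
  have hs : line a false c ∈ lattice a b := mem_lattice.2 (Or.inr ⟨c, hc, rfl⟩)
  by_cases h0 : r = 0
  · exact Or.inl ⟨_, hs, by simp [endpoints_line_false, h0]⟩
  by_cases h1 : r = a + 1
  · exact Or.inl ⟨_, hs, by simp [endpoints_line_false, h1]⟩
  exact mem_vertices_true (by omega) (by omega)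

/-- The unit edge from `r` to `r + 1` on the line with number `c`. -/
def unitEdge (e : Bool × ℕ × ℕ) : Set (ℝ × ℝ) :=
  segment ℝ (axisLine e.1 e.2.1 e.2.2) (axisLine e.1 e.2.1 (e.2.2 + 1))

theorem unitEdge_eq (v : Bool) (c r : ℕ) :
    unitEdge (v, c, r) = axisLine v c '' Set.Icc (r : ℝ) (r + 1) :=
  segment_axisLine _ _ (by simp)

theorem unitEdge_injective : Function.Injective unitEdge := by
  rintro ⟨v, c, r⟩ ⟨v', c', r'⟩ h
  -- The midpoint of a unit edge has exactly one half-integral coordinate, which reveals the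
  -- direction and the position of the edge.
  have hm : axisLine v c (r + 1 / 2) ∈ unitEdge (v', c', r') := by
    rw [← h, unitEdge_eq]
    exact ⟨_, ⟨by linarith, by linarith⟩, rfl⟩
  rw [unitEdge_eq] at hm
  obtain ⟨y, ⟨hy, hy'⟩, hyz⟩ := hm
  have half : ∀ m n : ℕ, (m : ℝ) ≠ n + 1 / 2 := by
    intro m n h
    have h1 : ((2 * m : ℕ) : ℝ) = ((2 * n + 1 : ℕ) : ℝ) := by push_cast; linarith
    have h2 : 2 * m = 2 * n + 1 := by exact_mod_cast h1
    omega
  cases v <;> cases v'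
  · simp only [axisLine_false, Prod.mk.injEq] at hyz
    obtain ⟨rfl, hc⟩ := hyz
    have h1 : (r' : ℝ) < ((r + 1 : ℕ) : ℝ) := by push_cast; linarith
    have h2 : (r : ℝ) < ((r' + 1 : ℕ) : ℝ) := by push_cast; linarith
    have h1 : r' < r + 1 := by exact_mod_cast h1
    have h2 : r < r' + 1 := by exact_mod_cast h2
    have h3 : c' = c := by exact_mod_cast hc
    have h4 : r = r' := by omega
    rw [h3, h4]
  · simp only [axisLine_false, axisLine_true, Prod.mk.injEq] at hyz
    exact absurd hyz.1 (half _ _)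
  · simp only [axisLine_false, axisLine_true, Prod.mk.injEq] at hyz
    exact absurd hyz.2 (half _ _)
  · simp only [axisLine_true, Prod.mk.injEq] at hyz
    obtain ⟨hc, rfl⟩ := hyz
    have h1 : (r' : ℝ) < ((r + 1 : ℕ) : ℝ) := by push_cast; linarith
    have h2 : (r : ℝ) < ((r' + 1 : ℕ) : ℝ) := by push_cast; linarith
    have h1 : r' < r + 1 := by exact_mod_cast h1
    have h2 : r < r' + 1 := by exact_mod_cast h2
    have h3 : c' = c := by exact_mod_cast hc
    have h4 : r = r' := by omega
    rw [h3, h4]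

theorem not_nat_between {n m : ℕ} (h : (m : ℝ) < n) (h' : (n : ℝ) < m + 1) : False := by
  have h1 : m < n := by exact_mod_cast h
  have h2 : n < m + 1 := by exact_mod_cast h'
  omega

theorem isEdge_unitEdge_true {a b c r : ℕ} (hc : 1 ≤ c ∧ c ≤ a) (hr : r ≤ b) :
    IsEdge (lattice a b) (unitEdge (true, c, r)) := by
  have hr' : (r : ℝ) ≤ b := by exact_mod_cast hr
  refine isEdge_segment (s := line b true c) (mem_lattice.2 (Or.inl ⟨c, hc, rfl⟩))
    (fun h => by simpa using axisLine_injective _ _ h) ?_ ?_ ?_ ?_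
  · change unitEdge (true, c, r) ⊆ _
    rw [unitEdge_eq]
    rintro _ ⟨y, hy, rfl⟩
    have h0 : (0 : ℝ) ≤ r := by positivity
    simp only [axisLine_true, mem_line_true, true_and]
    exact ⟨h0.trans hy.1, by linarith [hy.2]⟩
  · simpa [axisLine_true] using mem_vertices_true hc (by omega : r ≤ b + 1)
  · simpa [axisLine_true] using mem_vertices_true hc (by omega : r + 1 ≤ b + 1)
  · intro v hv hvo
    obtain ⟨m, n, rfl⟩ := exists_nat_of_mem_vertices hv
    rw [openSegment_axisLine _ _ (by simp)] at hvo
    obtain ⟨y, hy, hyv⟩ := hvo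
    simp only [axisLine_true, Prod.mk.injEq] at hyv
    obtain ⟨-, rfl⟩ := hyv
    exact not_nat_between hy.1 hy.2

theorem isEdge_unitEdge_false {a b c r : ℕ} (hc : 1 ≤ c ∧ c ≤ b) (hr : r ≤ a) :
    IsEdge (lattice a b) (unitEdge (false, c, r)) := by
  have hr' : (r : ℝ) ≤ a := by exact_mod_cast hr
  refine isEdge_segment (s := line a false c) (mem_lattice.2 (Or.inr ⟨c, hc, rfl⟩))
    (fun h => by simpa using axisLine_injective _ _ h) ?_ ?_ ?_ ?_
  · change unitEdge (false, c, r) ⊆ _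
    rw [unitEdge_eq]
    rintro _ ⟨y, hy, rfl⟩
    have h0 : (0 : ℝ) ≤ r := by positivity
    simp only [axisLine_false, mem_line_false, true_and]
    exact ⟨h0.trans hy.1, by linarith [hy.2]⟩
  · simpa [axisLine_false] using mem_vertices_false hc (by omega : r ≤ a + 1)
  · simpa [axisLine_false] using mem_vertices_false hc (by omega : r + 1 ≤ a + 1)
  · intro v hv hvo
    obtain ⟨m, n, rfl⟩ := exists_nat_of_mem_vertices hv
    rw [openSegment_axisLine _ _ (by simp)] at hvo
    obtain ⟨y, hy, hyv⟩ := hvo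
    simp only [axisLine_false, Prod.mk.injEq] at hyv
    obtain ⟨rfl, -⟩ := hyv
    exact not_nat_between hy.1 hy.2

theorem not_mem_support {a b : ℕ} {p : ℝ × ℝ}
    (h1 : ∀ c : ℕ, 1 ≤ c → c ≤ a → p.1 = c → 0 ≤ p.2 → p.2 ≤ b + 1 → False)
    (h2 : ∀ c : ℕ, 1 ≤ c → c ≤ b → p.2 = c → 0 ≤ p.1 → p.1 ≤ a + 1 → False) :
    p ∈ (support (lattice a b))ᶜ := by
  simp only [support, Set.mem_compl_iff, Set.mem_iUnion, not_exists]
  intro s hs hp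
  rcases mem_lattice.1 hs with ⟨c, hc, rfl⟩ | ⟨c, hc, rfl⟩
  · have := mem_line_true.1 hp
    exact h1 c hc.1 hc.2 this.1 this.2.1 this.2.2
  · have := mem_line_false.1 hp
    exact h2 c hc.1 hc.2 this.1 this.2.1 this.2.2

/-- The unbounded component of the complement of the lattice. -/
noncomputable def outer (a b : ℕ) : Set (ℝ × ℝ) :=
  connectedComponentIn (support (lattice a b))ᶜ (-1, -1)

theorem prod_subset_outer {a b : ℕ} {I J : Set ℝ} (hI : I.OrdConnected) (hJ : J.OrdConnected)
    (hsub : I ×ˢ J ⊆ (support (lattice a b))ᶜ) {p : ℝ × ℝ} (hp : p ∈ I ×ˢ J)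
    (hpo : p ∈ outer a b) : I ×ˢ J ⊆ outer a b := fun _ hq =>
  (mem_connectedComponentIn_iff_of_isPreconnected
    (hI.isPreconnected.prod hJ.isPreconnected) hsub hp hq).1 hpo

theorem mem_support_compl_of_neg {a b : ℕ} {p : ℝ × ℝ}
    (h : p.1 < 0 ∨ (a : ℝ) + 1 < p.1 ∨ p.2 < 0 ∨ (b : ℝ) + 1 < p.2) :
    p ∈ (support (lattice a b))ᶜ := by
  refine not_mem_support ?_ ?_
  · intro c _ hca h1 h2 h3
    have hc : (0 : ℝ) ≤ c := by positivity
    have hca' : (c : ℝ) ≤ a := by exact_mod_cast hca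
    rcases h with h | h | h | h <;> linarith
  · intro c _ hca h1 h2 h3
    have hc : (0 : ℝ) ≤ c := by positivity
    have hca' : (c : ℝ) ≤ b := by exact_mod_cast hca
    rcases h with h | h | h | h <;> linarith

theorem half_planes_subset_outer (a b : ℕ) :
    (Set.Iio 0 ×ˢ Set.univ ⊆ outer a b ∧ Set.univ ×ˢ Set.Iio 0 ⊆ outer a b) ∧
    (Set.Ioi ((a : ℝ) + 1) ×ˢ Set.univ ⊆ outer a b ∧
      Set.univ ×ˢ Set.Ioi ((b : ℝ) + 1) ⊆ outer a b) := by
  have h0 : ((-1, -1) : ℝ × ℝ) ∈ outer a b :=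
    mem_connectedComponentIn (mem_support_compl_of_neg (by simp))
  have hL : Set.Iio (0 : ℝ) ×ˢ Set.univ ⊆ outer a b :=
    prod_subset_outer Set.ordConnected_Iio Set.ordConnected_univ
      (fun p hp => mem_support_compl_of_neg (Or.inl hp.1)) (p := (-1, -1)) (by simp) h0
  have hB : Set.univ ×ˢ Set.Iio (0 : ℝ) ⊆ outer a b :=
    prod_subset_outer Set.ordConnected_univ Set.ordConnected_Iio
      (fun p hp => mem_support_compl_of_neg (Or.inr (Or.inr (Or.inl hp.2)))) (p := (-1, -1))
      (by simp) h0
  refine ⟨⟨hL, hB⟩, ?_, ?_⟩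
  · exact prod_subset_outer Set.ordConnected_Ioi Set.ordConnected_univ
      (fun p hp => mem_support_compl_of_neg (Or.inr (Or.inl hp.1))) (p := (a + 2, -1))
      (by simp) (hB (by simp))
  · exact prod_subset_outer Set.ordConnected_univ Set.ordConnected_Ioi
      (fun p hp => mem_support_compl_of_neg (Or.inr (Or.inr (Or.inr hp.2)))) (p := (-1, b + 2))
      (by simp) (hL (by simp))

/-- Vertical segments have abscissa at least 1 and horizontal ones integral ordinate, so the strip
is free of segments and reaches the left half-plane. Its closure contains the stubs and the leftmost
vertical edges; the other three sides are alike. -/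
theorem left_strip_subset_outer (a b r : ℕ) :
    Set.Iio (1 : ℝ) ×ˢ Set.Ioo (r : ℝ) (r + 1) ⊆ outer a b := by
  refine prod_subset_outer Set.ordConnected_Iio Set.ordConnected_Ioo ?_ (p := (-1, r + 1 / 2))
    (by norm_num) ((half_planes_subset_outer a b).1.1 (by simp))
  rintro p ⟨h, h'⟩
  refine not_mem_support (fun c hc _ h1 _ _ => ?_) fun c _ _ h1 _ _ => ?_
  · have : (1 : ℝ) ≤ c := by exact_mod_cast hc
    have h2 : p.1 < 1 := h
    linarith
  · rw [h1] at h'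
    exact not_nat_between h'.1 h'.2

theorem right_strip_subset_outer (a b r : ℕ) :
    Set.Ioi (a : ℝ) ×ˢ Set.Ioo (r : ℝ) (r + 1) ⊆ outer a b := by
  refine prod_subset_outer Set.ordConnected_Ioi Set.ordConnected_Ioo ?_ (p := (a + 2, r + 1 / 2))
    (by norm_num) ((half_planes_subset_outer a b).2.1 (by simp))
  rintro p ⟨h, h'⟩
  refine not_mem_support (fun c _ hc h1 _ _ => ?_) fun c _ _ h1 _ _ => ?_
  · have : (c : ℝ) ≤ a := by exact_mod_cast hc
    have h2 : (a : ℝ) < p.1 := h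
    linarith
  · rw [h1] at h'
    exact not_nat_between h'.1 h'.2

theorem bottom_strip_subset_outer (a b r : ℕ) :
    Set.Ioo (r : ℝ) (r + 1) ×ˢ Set.Iio (1 : ℝ) ⊆ outer a b := by
  refine prod_subset_outer Set.ordConnected_Ioo Set.ordConnected_Iio ?_ (p := (r + 1 / 2, -1))
    (by norm_num) ((half_planes_subset_outer a b).1.2 (by simp))
  rintro p ⟨h', h⟩
  refine not_mem_support (fun c _ _ h1 _ _ => ?_) fun c hc _ h1 _ _ => ?_
  · rw [h1] at h'
    exact not_nat_between h'.1 h'.2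
  · have : (1 : ℝ) ≤ c := by exact_mod_cast hc
    have h2 : p.2 < 1 := h
    linarith

theorem top_strip_subset_outer (a b r : ℕ) :
    Set.Ioo (r : ℝ) (r + 1) ×ˢ Set.Ioi (b : ℝ) ⊆ outer a b := by
  refine prod_subset_outer Set.ordConnected_Ioo Set.ordConnected_Ioi ?_ (p := (r + 1 / 2, b + 2))
    (by norm_num) ((half_planes_subset_outer a b).2.2 (by simp))
  rintro p ⟨h', h⟩
  refine not_mem_support (fun c _ _ h1 _ _ => ?_) fun c _ hc h1 _ _ => ?_
  · rw [h1] at h'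
    exact not_nat_between h'.1 h'.2
  · have : (c : ℝ) ≤ b := by exact_mod_cast hc
    have h2 : (b : ℝ) < p.2 := h
    linarith

theorem subset_closure_outer {a b : ℕ} {I J K : Set ℝ} (h : I ×ˢ J ⊆ outer a b) {v : Bool} {c : ℕ}
    (hK : ∀ y ∈ K, axisLine v c y ∈ closure I ×ˢ closure J) :
    axisLine v c '' K ⊆ closure (outer a b) := by
  rintro _ ⟨y, hy, rfl⟩
  refine closure_mono h ?_
  rw [closure_prod_eq]
  exact hK y hy

theorem unitEdge_true_mem {a b c r : ℕ} (hc : 1 ≤ c ∧ c ≤ a) (hr : r ≤ b)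
    (h : r = 0 ∨ r = b ∨ c = 1 ∨ c = a) :
    unitEdge (true, c, r) ∈ boundingEdges (lattice a b) (closure (outer a b)) := by
  refine ⟨isEdge_unitEdge_true hc hr, ?_⟩
  rw [unitEdge_eq]
  have hr01 : (r : ℝ) ≠ r + 1 := by simp
  have hc01 : (c : ℝ) ≠ c + 1 := by simp
  rcases h with rfl | rfl | rfl | rfl
  · refine subset_closure_outer (bottom_strip_subset_outer a b c) fun y hy => ?_
    rw [closure_Iio, closure_Ioo hc01, axisLine_true]
    exact ⟨⟨le_rfl, by simp⟩, by simpa using hy.2⟩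
  · refine subset_closure_outer (top_strip_subset_outer a r c) fun y hy => ?_
    rw [closure_Ioi, closure_Ioo hc01, axisLine_true]
    exact ⟨⟨le_rfl, by simp⟩, hy.1⟩
  · refine subset_closure_outer (left_strip_subset_outer a b r) fun y hy => ?_
    rw [closure_Iio, closure_Ioo hr01, axisLine_true]
    exact ⟨by simp, hy⟩
  · refine subset_closure_outer (right_strip_subset_outer c b r) fun y hy => ?_
    rw [closure_Ioi, closure_Ioo hr01, axisLine_true]
    exact ⟨by simp, hy⟩

theorem unitEdge_false_mem {a b c r : ℕ} (hc : 1 ≤ c ∧ c ≤ b) (hr : r ≤ a)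
    (h : r = 0 ∨ r = a ∨ c = 1 ∨ c = b) :
    unitEdge (false, c, r) ∈ boundingEdges (lattice a b) (closure (outer a b)) := by
  refine ⟨isEdge_unitEdge_false hc hr, ?_⟩
  rw [unitEdge_eq]
  have hr01 : (r : ℝ) ≠ r + 1 := by simp
  have hc01 : (c : ℝ) ≠ c + 1 := by simp
  rcases h with rfl | rfl | rfl | rfl
  · refine subset_closure_outer (left_strip_subset_outer a b c) fun y hy => ?_
    rw [closure_Iio, closure_Ioo hc01, axisLine_false]
    exact ⟨by simpa using hy.2, le_rfl, by simp⟩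
  · refine subset_closure_outer (right_strip_subset_outer r b c) fun y hy => ?_
    rw [closure_Ioi, closure_Ioo hc01, axisLine_false]
    exact ⟨hy.1, le_rfl, by simp⟩
  · refine subset_closure_outer (bottom_strip_subset_outer a b r) fun y hy => ?_
    rw [closure_Iio, closure_Ioo hr01, axisLine_false]
    exact ⟨hy, by simp⟩
  · refine subset_closure_outer (top_strip_subset_outer a c r) fun y hy => ?_
    rw [closure_Ioi, closure_Ioo hr01, axisLine_false]
    exact ⟨hy, by simp⟩

theorem isFace_outer (a b : ℕ) : IsFace (lattice a b) (closure (outer a b)) :=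
  ⟨(-1, -1), mem_support_compl_of_neg (by simp), rfl⟩

/-- The upper bound supplies the finiteness without which `Set.ncard` would not be monotone. -/
theorem card_le_ncard {a b : ℕ} (hab : 1 < a + b) (I : Finset (Bool × ℕ × ℕ))
    (hI : ∀ e ∈ I, unitEdge e ∈ boundingEdges (lattice a b) (closure (outer a b))) :
    I.card ≤ (boundingEdges (lattice a b) (closure (outer a b))).ncard := by
  rw [← Set.ncard_coe_finset]
  exact Set.ncard_le_ncard_of_injOn unitEdge (fun e he => hI e he) unitEdge_injective.injOn
    (ncard_boundingEdges_le (generalPosition_lattice a b) (by rwa [card_lattice]) _).1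

theorem le_ncard_of_two (b : ℕ) (hb : 2 ≤ b) :
    4 * b + 4 ≤ (boundingEdges (lattice 2 b) (closure (outer 2 b))).ncard := by
  let I₁ : Finset (Bool × ℕ × ℕ) := {false} ×ˢ (Finset.Icc 1 b ×ˢ {0, 2})
  let I₂ : Finset (Bool × ℕ × ℕ) := {false} ×ˢ ({1, b} ×ˢ {1})
  let I₃ : Finset (Bool × ℕ × ℕ) := {true} ×ˢ ({1, 2} ×ˢ Finset.range (b + 1))
  have h12 : Disjoint I₁ I₂ := by
    rw [Finset.disjoint_left]
    rintro ⟨v, c, r⟩ h h'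
    simp only [I₁, I₂, Finset.mem_product, Finset.mem_insert, Finset.mem_singleton] at h h'
    omega
  have h123 : Disjoint (I₁ ∪ I₂) I₃ := by
    rw [Finset.disjoint_left]
    rintro ⟨v, c, r⟩ h h'
    simp only [I₁, I₂, I₃, Finset.mem_union, Finset.mem_product, Finset.mem_singleton] at h h'
    rcases h with h | h <;> exact absurd (h.1.symm.trans h'.1) (by simp)
  have hcard : ((I₁ ∪ I₂) ∪ I₃).card = 4 * b + 4 := by
    rw [Finset.card_union_of_disjoint h123, Finset.card_union_of_disjoint h12]
    simp only [I₁, I₂, I₃, Finset.card_product, Finset.card_singleton, Nat.card_Icc,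
      Finset.card_pair (show (0 : ℕ) ≠ 2 by omega), Finset.card_pair (show 1 ≠ b by omega),
      Finset.card_pair (show (1 : ℕ) ≠ 2 by omega), Finset.card_range]
    omega
  rw [← hcard]
  refine card_le_ncard (by omega) _ ?_
  rintro ⟨v, c, r⟩ h
  simp only [I₁, I₂, I₃, Finset.mem_union, Finset.mem_product, Finset.mem_insert, Finset.mem_Icc,
    Finset.mem_range, Finset.mem_singleton] at h
  rcases h with (⟨rfl, h⟩ | ⟨rfl, h⟩) | ⟨rfl, h⟩
  · exact unitEdge_false_mem (by omega) (by omega) (by omega)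
  · exact unitEdge_false_mem (by omega) (by omega) (by omega)
  · exact unitEdge_true_mem (by omega) (by omega) (by omega)

theorem le_ncard_of_one : 4 ≤ (boundingEdges (lattice 1 1) (closure (outer 1 1))).ncard := by
  refine card_le_ncard (by omega)
    {(true, 1, 0), (true, 1, 1), (false, 1, 0), (false, 1, 1)} ?_
  intro e he
  simp only [Finset.mem_insert, Finset.mem_singleton] at he
  rcases he with rfl | rfl | rfl | rfl
  · exact unitEdge_true_mem (by omega) (by omega) (by omega)
  · exact unitEdge_true_mem (by omega) (by omega) (by omega)
  · exact unitEdge_false_mem (by omega) (by omega) (by omega)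
  · exact unitEdge_false_mem (by omega) (by omega) (by omega)

theorem exists_tight {n : ℕ} (hn : 1 < n) (hn3 : n ≠ 3) :
    ∃ S : Finset AxisSegment, S.card = n ∧ GeneralPosition S ∧
      ∃ F, IsFace S F ∧ (boundingEdges S F).ncard = 4 * n - 4 := by
  obtain ⟨a, b, hab, hle⟩ : ∃ a b : ℕ, a + b = n ∧
      4 * n - 4 ≤ (boundingEdges (lattice a b) (closure (outer a b))).ncard := by
    by_cases h2 : n = 2
    · exact ⟨1, 1, h2.symm, by rw [h2]; exact le_ncard_of_one⟩
    · exact ⟨2, n - 2, by omega, le_trans (by omega) (le_ncard_of_two (n - 2) (by omega))⟩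
  refine ⟨lattice a b, by rw [card_lattice, hab], generalPosition_lattice a b, _,
    isFace_outer a b, le_antisymm ?_ hle⟩
  have := (ncard_boundingEdges_le (generalPosition_lattice a b)
    (by rw [card_lattice, hab]; exact hn) (-1, -1)).2
  rwa [card_lattice, hab] at this

end Lattice

theorem mainTheorem6 :
    (∀ n : ℕ, 1 < n → ∀ S : Finset AxisSegment, S.card = n → Arrangement.GeneralPosition S →
      ∀ F : Set (ℝ × ℝ), Arrangement.IsFace S F →
        (Arrangement.boundingEdges S F).Finite ∧
        (Arrangement.boundingEdges S F).ncard ≤ 4 * n - 4) ∧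
    (∀ n : ℕ, 1 < n → n ≠ 3 →
      ∃ S : Finset AxisSegment, S.card = n ∧ Arrangement.GeneralPosition S ∧
        ∃ F : Set (ℝ × ℝ), Arrangement.IsFace S F ∧
          (Arrangement.boundingEdges S F).ncard = 4 * n - 4) := by
  constructor
  · rintro n hn S rfl hS F ⟨x, -, rfl⟩
    exact Arrangement.ncard_boundingEdges_le hS hn x
  · intro n hn hn3
    exact Lattice.exists_tight hn hn3
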